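/- Let $\hbar>0$, $m_e\ge 0$ and $\theta_1,\theta_2\in\mathbb R$ (in particular $\theta_i\in[0,2\pi)$). Let $\mathcal S_1=\{(s_{ph},s_{e_1},s_{e_2})\in\mathbb R^3: s_{e_1}<s_{ph}<s_{e_2}\}$, with boundary faces $\mathcal C_1=\{s_{e_1}=s_{ph}<s_{e_2}\}$ and $\mathcal C_2=\{s_{e_1}<s_{ph}=s_{e_2}\}$. Wave functions $\Psi\in L^2(\mathcal S_1,\mathbb C^8)$ have components $\psi_{\varsigma_0\varsigma_1\varsigma_2}$, $\varsigma_j\in\{-,+\}$, where $\mathbb C^8=\mathbb C^2\otimes\mathbb C^2\otimes\mathbb C^2$ (photon, first electron, second electron; basis order $-,+$). With $\gamma^0=\begin{pmatrix}0&1\\1&0\end{pmatrix}$ and $\gamma^1=\begin{pmatrix}0&-1\\1&0\end{pmatrix}$, let $$\hat H=(-i\hbar\gamma^0\gamma^1\partial_{s_{ph}})\otimes 1\otimes 1+1\otimes\gamma^0(m_e-i\hbar\gamma^1\partial_{s_{e_1}})\otimes 1+1\otimes 1\otimes\gamma^0(m_e-i\hbar\gamma^1\partial_{s_{e_2}}),\qquad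 D(\hat H)=C_c^\infty(\mathcal S_1,\mathbb C^8),$$ an unbounded operator on $L^2(\mathcal S_1,\mathbb C^8)$ with adjoint $\hat H^*$. For every $\varepsilon>0$ let $\mu_\varepsilon:[0,\infty)\to[0,1]$ be a smooth function that is $0$ on $[0,\varepsilon]$ and $1$ on $[2\varepsilon,\infty)$, and let $\hat H_\varepsilon$ be the restriction of $\hat H^*$ to the domain $$D(\hat H_\varepsilon)=\{\Psi\in D(\hat H^*):\ \psi_{-+\varsigma_2}=e^{i\theta_1}\mu_\varepsilon(|s_{e_1}-s_{e_2}|)\,\psi_{+-\varsigma_2}\text{ on }\mathcal C_1,\ \ \psi_{+\varsigma_1-}=e^{i\theta_2}\mu_\varepsilon(|s_{e_1}-s_{e_2}|)\,\psi_{-\varsigma_1+}\text{ on }\mathcal C_2,\ \ \varsigma_1,\varsigma_2\in\{-,+\}\}.$$ Let $\tilde H$ be the restriction of $\hat H^*$ to the domain given by the same conditions with $\mu_\varepsilon$ replaced by $1$. Boundary values are $L^2_{loc}$ traces on the open faces: in the coordinates $s_p=s_{ph}$, $s=\frac{s_{ph}-s_{e_1}}2$, $\tilde s=\frac{s_{e_2}-s_{ph}}2$,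 a measurable $g$ on $\mathcal C_1\cong\mathbb R\times(0,\infty)$ is the trace of $u$ on $\mathcal C_1$ if $\frac1h\int_0^h\int_K|u(s_p,s,\tilde s)-g(s_p,\tilde s)|^2\,d(s_p,\tilde s)\,ds\to0$ as $h\to0^+$ for every compact $K\subset\mathbb R\times(0,\infty)$, and similarly on $\mathcal C_2$ with $s$ and $\tilde s$ interchanged; the conditions include that the traces occurring in them exist. Then: 1. For every $\varepsilon>0$, $-\frac i\hbar\hat H_\varepsilon$ is a maximally dissipative extension of $-\frac i\hbar\hat H$. Here $B$ is dissipative if $\mathrm{Re}\langle B\Psi,\Psi\rangle\le0$ for all $\Psi\in D(B)$, and maximally dissipative if moreover it has no proper dissipative extension. 2. $\tilde H$ is a self-adjoint extension of $\hat H$. 3. The extended limit of the operators $-\frac i\hbar\hat H_\varepsilon$ as $\varepsilon\to0^+$ is (single-valued and equal to) $-\frac i\hbar\tilde H$. That is, for $\Psi,\eta\in L^2(\mathcal S_1,\mathbb C^8)$, there are $\Psi_\varepsilon\in D(\hat H_\varepsilon)$ with $\Psi_\varepsilon\to\Psi$ and $-\frac i\hbar\hat H_\varepsilon\Psi_\varepsilon\to\eta$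 in $L^2$ as $\varepsilon\to0^+$ if and only if $\Psi\in D(\tilde H)$ and $\eta=-\frac i\hbar\tilde H\Psi$. -/

import Mathlib

open MeasureTheory Set Filter Topology TopologicalSpace
open scoped Distributions ENNReal Kronecker ContDiff InnerProductSpace LinearPMap

noncomputable section

namespace ElPhEl

/-! ### Configuration space, spin space, Hilbert space -/

/-- Equal-time configurations `(s_ph, s_e1, s_e2)`, carrying Lebesgue measure. -/
abbrev Config : Type := Fin 3 → ℝ

/-- Spin labels `(ς₀, ς₁, ς₂)` of photon, first and second electron; `0` is `-`, `1` is `+`. -/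
abbrev Spin : Type := Fin 2 × Fin 2 × Fin 2

/-- The spin space `ℂ⁸`. -/
abbrev C8 : Type := EuclideanSpace ℂ Spin

/-- The configurations `s_e1 < s_ph < s_e2` with the photon between the two electrons. -/
def S1 : Opens Config where
  carrier := {x | x 1 < x 0 ∧ x 0 < x 2}
  is_open' := (isOpen_lt (continuous_apply 1) (continuous_apply 0)).inter
    (isOpen_lt (continuous_apply 0) (continuous_apply 2))

/-- Lebesgue measure on `S1`. -/
abbrev volS1 : Measure Config := (volume : Measure Config).restrict (S1 : Set Config)

/-- The Hilbert space `L²(S1, ℂ⁸)`. -/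
abbrev L2S1 : Type := Lp C8 2 volS1

/-! ### The Hamiltonian on `C_c^∞(S1, ℂ⁸)` -/

def gamma0 : Matrix (Fin 2) (Fin 2) ℂ := !![0, 1; 1, 0]

def gamma1 : Matrix (Fin 2) (Fin 2) ℂ := !![0, -1; 1, 0]

/-- The action on `ℂ⁸` of `A ⊗ 1 ⊗ 1`. -/
def actPh (A : Matrix (Fin 2) (Fin 2) ℂ) : C8 →L[ℂ] C8 :=
  Matrix.toEuclideanCLM (𝕜 := ℂ)
    (A ⊗ₖ ((1 : Matrix (Fin 2) (Fin 2) ℂ) ⊗ₖ (1 : Matrix (Fin 2) (Fin 2) ℂ)))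

/-- The action on `ℂ⁸` of `1 ⊗ A ⊗ 1`. -/
def actE1 (A : Matrix (Fin 2) (Fin 2) ℂ) : C8 →L[ℂ] C8 :=
  Matrix.toEuclideanCLM (𝕜 := ℂ)
    ((1 : Matrix (Fin 2) (Fin 2) ℂ) ⊗ₖ (A ⊗ₖ (1 : Matrix (Fin 2) (Fin 2) ℂ)))

/-- The action on `ℂ⁸` of `1 ⊗ 1 ⊗ A`. -/
def actE2 (A : Matrix (Fin 2) (Fin 2) ℂ) : C8 →L[ℂ] C8 :=
  Matrix.toEuclideanCLM (𝕜 := ℂ)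
    ((1 : Matrix (Fin 2) (Fin 2) ℂ) ⊗ₖ ((1 : Matrix (Fin 2) (Fin 2) ℂ) ⊗ₖ A))

/-- The partial derivative in the `k`-th configuration variable. -/
def pd (k : Fin 3) (ψ : Config → C8) (x : Config) : C8 :=
  fderiv ℝ ψ x (Pi.single k (1 : ℝ))

/-- The differential expression
`-iħ γ⁰γ¹ ∂_ph + γ⁰(m - iħ γ¹ ∂_e1) + γ⁰(m - iħ γ¹ ∂_e2)`, each summand acting on the tensor factor
of its particle. (On the basis `E₋, E₊` of antidiagonal matrices, which spans the photon factor,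
left multiplication by `γ⁰γ¹` is the same diagonal matrix as on `e₋, e₊`.) -/
def hamExpr (ħ m : ℝ) (ψ : Config → C8) (x : Config) : C8 :=
  (-(Complex.I * ħ)) • actPh (gamma0 * gamma1) (pd 0 ψ x)
  + ((m : ℂ) • actE1 gamma0 (ψ x) + (-(Complex.I * ħ)) • actE1 (gamma0 * gamma1) (pd 1 ψ x))
  + ((m : ℂ) • actE2 gamma0 (ψ x) + (-(Complex.I * ħ)) • actE2 (gamma0 * gamma1) (pd 2 ψ x))

lemma hamExpr_contDiff (ħ m : ℝ) {ψ : Config → C8} (h : ContDiff ℝ ∞ ψ) :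
    ContDiff ℝ ∞ (hamExpr ħ m ψ) := by
  have hp : ∀ k, ContDiff ℝ ∞ (pd k ψ) := fun k =>
    (h.fderiv_right (m := ∞) (by simp)).clm_apply contDiff_const
  have hA : ∀ (T : C8 →L[ℂ] C8) {f : Config → C8}, ContDiff ℝ ∞ f →
      ContDiff ℝ ∞ (fun x => T (f x)) := fun T f hf =>
    (T.restrictScalars ℝ).contDiff.comp hf
  unfold hamExpr
  exact (((hA _ (hp 0)).const_smul _).add
    (((hA _ h).const_smul _).add ((hA _ (hp 1)).const_smul _))).add
    (((hA _ h).const_smul _).add ((hA _ (hp 2)).const_smul _))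

lemma hamExpr_support (ħ m : ℝ) (ψ : Config → C8) :
    Function.support (hamExpr ħ m ψ) ⊆ tsupport ψ := by
  intro x hx
  by_contra hn
  apply hx
  have h0 : ψ x = 0 := image_eq_zero_of_notMem_tsupport hn
  have h1 : fderiv ℝ ψ x = 0 := by
    by_contra hne
    exact hn (support_fderiv_subset ℝ hne)
  simp [hamExpr, pd, h0, h1]

/-- The Hamiltonian as a linear map of `C_c^∞(S1, ℂ⁸)` into itself. -/
def hamTest (ħ m : ℝ) : 𝓓(S1, C8) →ₗ[ℂ] 𝓓(S1, C8) where
  toFun φ :=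
    { toFun := hamExpr ħ m φ
      contDiff' := hamExpr_contDiff ħ m φ.contDiff
      hasCompactSupport' := φ.hasCompactSupport.mono' (hamExpr_support ħ m φ)
      tsupport_subset' := (closure_minimal (hamExpr_support ħ m φ)
        (isClosed_tsupport _)).trans φ.tsupport_subset }
  map_add' φ χ := by
    ext1 x
    have h1 : DifferentiableAt ℝ (φ : Config → C8) x :=
      φ.contDiff.differentiable (by simp) x
    have h2 : DifferentiableAt ℝ (χ : Config → C8) x :=
      χ.contDiff.differentiable (by simp) x
    change hamExpr ħ m ((φ : Config → C8) + (χ : Config → C8)) x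
      = hamExpr ħ m φ x + hamExpr ħ m χ x
    simp only [hamExpr, pd, fderiv_add h1 h2, Pi.add_apply, add_apply,
      map_add, smul_add]
    abel
  map_smul' c φ := by
    ext1 x
    have h1 : DifferentiableAt ℝ (φ : Config → C8) x :=
      φ.contDiff.differentiable (by simp) x
    change hamExpr ħ m (c • (φ : Config → C8)) x = c • hamExpr ħ m φ x
    simp only [hamExpr, pd, fderiv_const_smul h1, Pi.smul_apply, smul_apply,
      map_smul, smul_add, smul_comm c]

lemma test_memLp (φ : 𝓓(S1, C8)) : MemLp (φ : Config → C8) 2 volS1 :=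
  φ.continuous.memLp_of_hasCompactSupport φ.hasCompactSupport

/-- The inclusion of `C_c^∞(S1, ℂ⁸)` into `L²(S1, ℂ⁸)`. -/
def testToL2 : 𝓓(S1, C8) →ₗ[ℂ] L2S1 where
  toFun φ := (test_memLp φ).toLp φ
  map_add' φ χ := MemLp.toLp_add (test_memLp φ) (test_memLp χ)
  map_smul' c φ := MemLp.toLp_const_smul c (test_memLp φ)

lemma testToL2_injective : Function.Injective testToL2 := by
  intro φ χ h
  have h1 : (φ : Config → C8) =ᵐ[volS1] χ :=
    (MemLp.toLp_eq_toLp_iff (test_memLp φ) (test_memLp χ)).1 h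
  have h2 : ∀ᵐ x ∂(volume : Measure Config), φ x = χ x := by
    filter_upwards [(ae_restrict_iff' S1.isOpen.measurableSet).1 h1] with x hx
    by_cases hxS : x ∈ (S1 : Set Config)
    · exact hx hxS
    · rw [image_eq_zero_of_notMem_tsupport (fun h => hxS (φ.tsupport_subset h)),
        image_eq_zero_of_notMem_tsupport (fun h => hxS (χ.tsupport_subset h))]
  exact DFunLike.coe_injective ((Continuous.ae_eq_iff_eq volume φ.continuous χ.continuous).1 h2)

/-- The Hamiltonian `Ĥ` as an unbounded operator on `L²(S1, ℂ⁸)` with domain `C_c^∞(S1, ℂ⁸)`. -/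
def freeH (ħ m : ℝ) : L2S1 →ₗ.[ℂ] L2S1 where
  domain := LinearMap.range testToL2
  toFun := testToL2 ∘ₗ hamTest ħ m ∘ₗ
    (LinearEquiv.ofInjective testToL2 testToL2_injective).symm.toLinearMap

/-- `Ĥ` is densely defined, so that its adjoint `(freeH ħ m)†` is the usual one. -/
lemma freeH_dense (ħ m : ℝ) : Dense ((freeH ħ m).domain : Set L2S1) := by
  change Dense ((LinearMap.range testToL2 : Submodule ℂ L2S1) : Set L2S1)
  rw [Submodule.dense_iff_topologicalClosure_eq_top, Submodule.topologicalClosure_eq_top_iff,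
    Submodule.eq_bot_iff]
  intro Ψ hΨ
  have hloc : LocallyIntegrableOn (Ψ : Config → C8) (S1 : Set Config) volume :=
    locallyIntegrableOn_of_locallyIntegrable_restrict
      ((Lp.memLp Ψ).locallyIntegrable (by norm_num))
  have key : ∀ a : Spin, ∀ᵐ x ∂(volume : Measure Config), x ∈ (S1 : Set Config) → Ψ x a = 0 := by
    intro a
    have hla : LocallyIntegrableOn (fun x => Ψ x a) (S1 : Set Config) volume := fun x hx => by
      obtain ⟨t, ht, hi⟩ := hloc x hx
      exact ⟨t, ht, (EuclideanSpace.proj (𝕜 := ℂ) a).integrable_comp hi⟩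
    refine S1.isOpen.ae_eq_zero_of_integral_contDiff_smul_eq_zero hla fun g hg hgc hgs => ?_
    let φ : 𝓓(S1, C8) :=
      { toFun := fun x => g x • (EuclideanSpace.single a (1 : ℂ) : C8)
        contDiff' := hg.smul contDiff_const
        hasCompactSupport' := hgc.smul_right
        tsupport_subset' := (tsupport_smul_subset_left _ _).trans hgs }
    have h0 : ⟪testToL2 φ, Ψ⟫_ℂ = 0 := hΨ _ ⟨φ, rfl⟩
    rw [L2.inner_def] at h0
    have h1 : ∫ x, g x • Ψ x a ∂volS1 = 0 := by
      rw [← h0]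
      refine integral_congr_ae ?_
      filter_upwards [(test_memLp φ).coeFn_toLp] with x hx
      change _ = ⟪((test_memLp φ).toLp φ : Config → C8) x, Ψ x⟫_ℂ
      rw [hx]
      change _ = ⟪g x • (EuclideanSpace.single a (1 : ℂ) : C8), Ψ x⟫_ℂ
      rw [inner_smul_left_eq_star_smul, EuclideanSpace.inner_single_left]
      simp
    rw [← h1]
    symm
    refine setIntegral_eq_integral_of_forall_compl_eq_zero fun x hx => ?_
    rw [image_eq_zero_of_notMem_tsupport fun h => hx (hgs h), zero_smul]
  refine (Lp.eq_zero_iff_ae_eq_zero).2 ?_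
  filter_upwards [(ae_restrict_iff' S1.isOpen.measurableSet).2 (ae_all_iff.2 key |>.mono
    fun x hx hxS a => hx a hxS)] with x hx
  ext a
  exact hx a

/-! ### Boundary traces and boundary conditions -/

/-- The configuration with relative coordinates `s_p = s_ph`, `s = (s_ph - s_e1) / 2`,
`s' = (s_e2 - s_ph) / 2`. -/
def relPoint (sp s s' : ℝ) : Config := ![sp, sp - 2 * s, sp + 2 * s']

/-- The slice at level `s = h`, parametrized by `(s_p, s')` with `s' > 0`; for `h = 0` this is the
coincidence set `C₁`, where `s_e1 = s_ph < s_e2`. -/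
def slice1 (h : ℝ) (q : ℝ × ℝ) : Config := relPoint q.1 h q.2

/-- The slice at level `s' = h`, parametrized by `(s_p, s)` with `s > 0`; for `h = 0` this is the
coincidence set `C₂`, where `s_e1 < s_ph = s_e2`. -/
def slice2 (h : ℝ) (q : ℝ × ℝ) : Config := relPoint q.1 q.2 h

/-- The open half plane parametrizing each of the two coincidence sets. -/
def halfPlane : Set (ℝ × ℝ) := univ ×ˢ Ioi (0 : ℝ)

/-- `g` is the boundary trace of `u` for the family of slices `σ`: locally in `L²` of the open
boundary face, the restriction of `u` to the slice at level `s` tends to `g` as `s → 0⁺`. As `u` is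
only defined almost everywhere, the limit is taken for the averages over `0 < s < h`, as `h → 0⁺`. -/
def HasTrace (σ : ℝ → ℝ × ℝ → Config) (u : Config → ℂ) (g : ℝ × ℝ → ℂ) : Prop :=
  AEStronglyMeasurable g (volume.restrict halfPlane) ∧
  ∀ K : Set (ℝ × ℝ), IsCompact K → K ⊆ halfPlane →
    Tendsto (fun h : ℝ => (ENNReal.ofReal h)⁻¹ *
        ∫⁻ p in Ioo (0 : ℝ) h ×ˢ K, ‖u (σ p.1 p.2) - g p.2‖ₑ ^ 2)
      (𝓝[>] 0) (𝓝 0)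

/-- The component `ψ_{ς₀ς₁ς₂}` of a wave function. -/
def comp (a : Spin) (Ψ : L2S1) : Config → ℂ := fun x => Ψ x a

/-- The distance `|s_e1 - s_e2|` of the electrons. -/
def elDist (x : Config) : ℝ := |x 1 - x 2|

/-- The boundary conditions with phases `θ₁, θ₂` and reflection coefficient `μ`:
`ψ_{-+ς₂} = μ(|s_e1 - s_e2|) e^{iθ₁} ψ_{+-ς₂}` on `C₁` and
`ψ_{+ς₁-} = μ(|s_e1 - s_e2|) e^{iθ₂} ψ_{-ς₁+}` on `C₂`. -/
def BoundaryCond (θ₁ θ₂ : ℝ) (μ : ℝ → ℝ) (Ψ : L2S1) : Prop :=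
  (∀ c : Fin 2, ∃ g : ℝ × ℝ → ℂ, HasTrace slice1 (comp (1, 0, c) Ψ) g ∧
    HasTrace slice1 (comp (0, 1, c) Ψ)
      (fun q => (μ (elDist (slice1 0 q)) : ℂ) * Complex.exp (Complex.I * θ₁) * g q)) ∧
  (∀ b : Fin 2, ∃ g : ℝ × ℝ → ℂ, HasTrace slice2 (comp (0, b, 1) Ψ) g ∧
    HasTrace slice2 (comp (1, b, 0) Ψ)
      (fun q => (μ (elDist (slice2 0 q)) : ℂ) * Complex.exp (Complex.I * θ₂) * g q))

lemma measurable_comp (a : Spin) (Ψ : L2S1) : Measurable (comp a Ψ) :=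
  (EuclideanSpace.proj (𝕜 := ℂ) a).continuous.measurable.comp
    (Lp.stronglyMeasurable Ψ).measurable

lemma continuous_slice1 : Continuous fun p : ℝ × (ℝ × ℝ) => slice1 p.1 p.2 := by
  unfold slice1 relPoint
  refine continuous_pi fun k => ?_
  fin_cases k <;> simp <;> fun_prop

lemma continuous_slice2 : Continuous fun p : ℝ × (ℝ × ℝ) => slice2 p.1 p.2 := by
  unfold slice2 relPoint
  refine continuous_pi fun k => ?_
  fin_cases k <;> simp <;> fun_prop

lemma HasTrace.zero (σ : ℝ → ℝ × ℝ → Config) : HasTrace σ (fun _ => 0) (fun _ => 0) := by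
  refine ⟨aestronglyMeasurable_const, fun K _ _ => ?_⟩
  simp

lemma HasTrace.smul {σ : ℝ → ℝ × ℝ → Config} {u : Config → ℂ} {g : ℝ × ℝ → ℂ} (c : ℂ)
    (h : HasTrace σ u g) : HasTrace σ (fun x => c * u x) (fun q => c * g q) := by
  refine ⟨h.1.const_mul c, fun K hK hKs => ?_⟩
  have := ENNReal.Tendsto.const_mul (a := ‖c‖ₑ ^ 2) (h.2 K hK hKs) (Or.inr (by simp))
  rw [mul_zero] at this
  refine this.congr fun r => ?_
  simp only [← mul_sub, enorm_mul, mul_pow]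
  rw [lintegral_const_mul' _ _ (by simp)]
  ring

lemma HasTrace.add {σ : ℝ → ℝ × ℝ → Config} (hσ : Continuous fun p : ℝ × (ℝ × ℝ) => σ p.1 p.2)
    {u v : Config → ℂ} {g k : ℝ × ℝ → ℂ} (hu : Measurable u)
    (h : HasTrace σ u g) (h' : HasTrace σ v k) :
    HasTrace σ (fun x => u x + v x) (fun q => g q + k q) := by
  refine ⟨h.1.add h'.1, fun K hK hKs => ?_⟩
  have := ENNReal.Tendsto.const_mul (a := 2) ((h.2 K hK hKs).add (h'.2 K hK hKs))
    (Or.inr (by simp))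
  rw [add_zero, mul_zero] at this
  refine tendsto_of_tendsto_of_tendsto_of_le_of_le tendsto_const_nhds this
    (fun _ => zero_le) (fun r => ?_)
  have hg : AEStronglyMeasurable (fun p : ℝ × (ℝ × ℝ) => g p.2)
      (volume.restrict (Ioo (0 : ℝ) r ×ˢ K)) := by
    rw [Measure.volume_eq_prod, ← Measure.prod_restrict]
    exact (h.1.mono_measure (Measure.restrict_mono hKs le_rfl)).comp_snd
  have hm : AEMeasurable (fun p : ℝ × (ℝ × ℝ) => ‖u (σ p.1 p.2) - g p.2‖ₑ ^ 2)
      (volume.restrict (Ioo (0 : ℝ) r ×ˢ K)) :=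
    (((hu.comp hσ.measurable).aemeasurable.sub hg.aemeasurable).enorm).pow_const 2
  simp only
  rw [← mul_add, ← lintegral_add_left' hm, mul_left_comm,
    ← lintegral_const_mul' 2 _ (by simp)]
  refine mul_le_mul_right (lintegral_mono fun p => ?_) _
  rw [add_sub_add_comm]
  refine (pow_le_pow_left' (enorm_add_le _ _) 2).trans ?_
  generalize ‖u (σ p.1 p.2) - g p.2‖ₑ = a
  generalize ‖v (σ p.1 p.2) - k p.2‖ₑ = b
  have := ENNReal.rpow_add_le_mul_rpow_add_rpow a b (p := 2) (by norm_num)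
  norm_num at this
  exact_mod_cast this

/-- The map `(h, (s_p, r)) ↦ slice1 h (s_p, r)` as a linear map. -/
def slice1Lin : ℝ × (ℝ × ℝ) →ₗ[ℝ] Config where
  toFun p := slice1 p.1 p.2
  map_add' p q := by
    ext k; fin_cases k <;> simp [slice1, relPoint] <;> ring
  map_smul' c p := by
    ext k; fin_cases k <;> simp [slice1, relPoint] <;> ring

/-- The map `(h, (s_p, r)) ↦ slice2 h (s_p, r)` as a linear map. -/
def slice2Lin : ℝ × (ℝ × ℝ) →ₗ[ℝ] Config where
  toFun p := slice2 p.1 p.2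
  map_add' p q := by
    ext k; fin_cases k <;> simp [slice2, relPoint] <;> ring
  map_smul' c p := by
    ext k; fin_cases k <;> simp [slice2, relPoint] <;> ring

lemma slice1Lin_surjective : Function.Surjective slice1Lin := fun x =>
  ⟨((x 0 - x 1) / 2, (x 0, (x 2 - x 0) / 2)), by
    ext k; fin_cases k <;> simp [slice1Lin, slice1, relPoint] <;> ring⟩

lemma slice2Lin_surjective : Function.Surjective slice2Lin := fun x =>
  ⟨((x 2 - x 0) / 2, (x 0, (x 0 - x 1) / 2)), by
    ext k; fin_cases k <;> simp [slice2Lin, slice2, relPoint] <;> ring⟩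

/-- A family of slices that fills `S1`, is continuous, and respects Lebesgue null sets. -/
structure GoodSlices (σ : ℝ → ℝ × ℝ → Config) : Prop where
  cont : Continuous fun p : ℝ × (ℝ × ℝ) => σ p.1 p.2
  qmp : Measure.QuasiMeasurePreserving (fun p : ℝ × (ℝ × ℝ) => σ p.1 p.2) volume volume
  mem : ∀ h > 0, ∀ q ∈ halfPlane, σ h q ∈ S1

lemma qmp_of_surjective (L : ℝ × (ℝ × ℝ) →ₗ[ℝ] Config) (hL : Function.Surjective L) :
    Measure.QuasiMeasurePreserving L volume volume := by
  have : (volume : Measure (ℝ × ℝ)).IsAddHaarMeasure := by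
    rw [Measure.volume_eq_prod]; infer_instance
  have : (volume : Measure (ℝ × (ℝ × ℝ))).IsAddHaarMeasure := by
    rw [Measure.volume_eq_prod]; infer_instance
  obtain ⟨c, -, hc⟩ := L.exists_map_addHaar_eq_smul_addHaar volume volume hL
  refine ⟨L.continuous_of_finiteDimensional.measurable, ?_⟩
  rw [hc]
  exact Measure.smul_absolutelyContinuous

lemma goodSlices1 : GoodSlices slice1 where
  cont := continuous_slice1
  qmp := qmp_of_surjective slice1Lin slice1Lin_surjective
  mem h hh q hq := by
    have h2 : 0 < q.2 := hq.2
    change relPoint q.1 h q.2 1 < relPoint q.1 h q.2 0 ∧ relPoint q.1 h q.2 0 < relPoint q.1 h q.2 2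
    simp [relPoint, hh, h2]

lemma goodSlices2 : GoodSlices slice2 where
  cont := continuous_slice2
  qmp := qmp_of_surjective slice2Lin slice2Lin_surjective
  mem h hh q hq := by
    have h2 : 0 < q.2 := hq.2
    change relPoint q.1 q.2 h 1 < relPoint q.1 q.2 h 0 ∧ relPoint q.1 q.2 h 0 < relPoint q.1 q.2 h 2
    simp [relPoint, hh, h2]

/-- The trace depends only on the almost everywhere class of the function on `S1`. -/
lemma HasTrace.congr {σ : ℝ → ℝ × ℝ → Config} (hσ : GoodSlices σ) {u v : Config → ℂ}
    {g : ℝ × ℝ → ℂ} (h : HasTrace σ u g) (huv : u =ᵐ[volS1] v) : HasTrace σ v g := by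
  refine ⟨h.1, fun K hK hKs => (h.2 K hK hKs).congr fun r => ?_⟩
  congr 1
  have h1 := hσ.qmp.ae ((ae_restrict_iff' S1.isOpen.measurableSet).1 huv)
  refine setLIntegral_congr_fun_ae (measurableSet_Ioo.prod hK.measurableSet) ?_
  filter_upwards [h1] with p hp hpK
  rw [hp (hσ.mem _ hpK.1.1 _ (hKs hpK.2))]

lemma comp_add (a : Spin) (Ψ Φ : L2S1) :
    comp a (Ψ + Φ) =ᵐ[volS1] fun x => comp a Ψ x + comp a Φ x := by
  filter_upwards [Lp.coeFn_add Ψ Φ] with x hx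
  change (Ψ + Φ : L2S1) x a = _
  rw [hx]
  rfl

lemma comp_smul (a : Spin) (c : ℂ) (Ψ : L2S1) :
    comp a (c • Ψ) =ᵐ[volS1] fun x => c * comp a Ψ x := by
  filter_upwards [Lp.coeFn_smul c Ψ] with x hx
  change (c • Ψ : L2S1) x a = _
  rw [hx]
  rfl

lemma comp_zero (a : Spin) : comp a (0 : L2S1) =ᵐ[volS1] fun _ => 0 := by
  filter_upwards [Lp.coeFn_zero C8 2 volS1] with x hx
  change (0 : L2S1) x a = _
  rw [hx]
  rfl

/-- The relation `trace ψ_b = k * trace ψ_a` for two components is linear in the wave function. -/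
lemma traceRel_zero {σ : ℝ → ℝ × ℝ → Config} (hσ : GoodSlices σ) (a b : Spin) (k : ℝ × ℝ → ℂ) :
    ∃ g, HasTrace σ (comp a 0) g ∧ HasTrace σ (comp b 0) (fun q => k q * g q) :=
  ⟨fun _ => 0, (HasTrace.zero σ).congr hσ (comp_zero a).symm, by
    simpa using (HasTrace.zero σ).congr hσ (comp_zero b).symm⟩

lemma traceRel_add {σ : ℝ → ℝ × ℝ → Config} (hσ : GoodSlices σ) {a b : Spin} {k : ℝ × ℝ → ℂ}
    {Ψ Φ : L2S1}
    (h : ∃ g, HasTrace σ (comp a Ψ) g ∧ HasTrace σ (comp b Ψ) (fun q => k q * g q))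
    (h' : ∃ g, HasTrace σ (comp a Φ) g ∧ HasTrace σ (comp b Φ) (fun q => k q * g q)) :
    ∃ g, HasTrace σ (comp a (Ψ + Φ)) g ∧ HasTrace σ (comp b (Ψ + Φ)) (fun q => k q * g q) := by
  obtain ⟨g, h1, h2⟩ := h
  obtain ⟨g', h1', h2'⟩ := h'
  refine ⟨fun q => g q + g' q, (h1.add hσ.cont (measurable_comp a Ψ) h1').congr hσ
    (comp_add a Ψ Φ).symm, ?_⟩
  simp only [mul_add]
  exact (h2.add hσ.cont (measurable_comp b Ψ) h2').congr hσ (comp_add b Ψ Φ).symm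

lemma traceRel_smul {σ : ℝ → ℝ × ℝ → Config} (hσ : GoodSlices σ) {a b : Spin} {k : ℝ × ℝ → ℂ}
    (c : ℂ) {Ψ : L2S1}
    (h : ∃ g, HasTrace σ (comp a Ψ) g ∧ HasTrace σ (comp b Ψ) (fun q => k q * g q)) :
    ∃ g, HasTrace σ (comp a (c • Ψ)) g ∧ HasTrace σ (comp b (c • Ψ)) (fun q => k q * g q) := by
  obtain ⟨g, h1, h2⟩ := h
  refine ⟨fun q => c * g q, (h1.smul c).congr hσ (comp_smul a c Ψ).symm, ?_⟩
  simp only [mul_left_comm _ c]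
  exact (h2.smul c).congr hσ (comp_smul b c Ψ).symm

/-- The wave functions satisfying the boundary conditions form a subspace. -/
def boundarySubmodule (θ₁ θ₂ : ℝ) (μ : ℝ → ℝ) : Submodule ℂ L2S1 where
  carrier := {Ψ | BoundaryCond θ₁ θ₂ μ Ψ}
  zero_mem' := ⟨fun _ => traceRel_zero goodSlices1 _ _ _, fun _ => traceRel_zero goodSlices2 _ _ _⟩
  add_mem' h h' := ⟨fun c => traceRel_add goodSlices1 (h.1 c) (h'.1 c),
    fun b => traceRel_add goodSlices2 (h.2 b) (h'.2 b)⟩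
  smul_mem' c _ h := ⟨fun d => traceRel_smul goodSlices1 c (h.1 d),
    fun b => traceRel_smul goodSlices2 c (h.2 b)⟩

/-- The restriction of `Ĥ*` to the `Ψ ∈ D(Ĥ*)` that satisfy the boundary conditions with phases
`θ₁, θ₂` and reflection coefficient `μ`. -/
def boundaryH (ħ m θ₁ θ₂ : ℝ) (μ : ℝ → ℝ) : L2S1 →ₗ.[ℂ] L2S1 :=
  (freeH ħ m)†.domRestrict (boundarySubmodule θ₁ θ₂ μ)

/-- The operator with the unleaky phase boundary conditions
`ψ_{-+ς₂} = e^{iθ₁} ψ_{+-ς₂}` on `C₁` and `ψ_{+ς₁-} = e^{iθ₂} ψ_{-ς₁+}` on `C₂`. -/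
def tildeH (ħ m θ₁ θ₂ : ℝ) : L2S1 →ₗ.[ℂ] L2S1 := boundaryH ħ m θ₁ θ₂ (fun _ => 1)

/-- Smooth transition functions `[0, ∞) → [0, 1]` that vanish on `[0, ε]` and equal `1` on
`[2ε, ∞)`; the values at negative arguments are irrelevant. -/
structure IsTransition (ε : ℝ) (μ : ℝ → ℝ) : Prop where
  smooth : ContDiffOn ℝ ∞ μ (Ici 0)
  mem_Icc : ∀ s, 0 ≤ s → μ s ∈ Icc (0 : ℝ) 1
  eq_zero : ∀ s ∈ Icc 0 ε, μ s = 0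
  eq_one : ∀ s, 2 * ε ≤ s → μ s = 1

/-! ### Dissipative operators and extended limits -/

section Abstract

variable {E : Type*} [NormedAddCommGroup E] [InnerProductSpace ℂ E]

/-- `Re ⟨BΨ, Ψ⟩ ≤ 0` on the domain of `B`. -/
def IsDissipative (B : E →ₗ.[ℂ] E) : Prop :=
  ∀ Ψ : B.domain, (⟪B Ψ, (Ψ : E)⟫_ℂ).re ≤ 0

/-- Dissipative, without a proper dissipative extension. -/
def IsMaximallyDissipative (B : E →ₗ.[ℂ] E) : Prop :=
  IsDissipative B ∧ ∀ A : E →ₗ.[ℂ] E, IsDissipative A → B ≤ A → B = A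

/-- The graph of the (a priori multivalued) extended limit as `ε → 0⁺` of a family of operators
`B ε`, `ε > 0`: all `(Ψ, η)` for which there are `Ψ_ε ∈ D(B ε)` with `Ψ_ε → Ψ` and
`B ε Ψ_ε → η`. -/
def extendedLimitGraph (B : ℝ → E →ₗ.[ℂ] E) : Set (E × E) :=
  {p | ∃ Φ : ∀ ε : ℝ, (B ε).domain,
    Tendsto (fun ε => (Φ ε : E)) (𝓝[>] 0) (𝓝 p.1) ∧
    Tendsto (fun ε => B ε (Φ ε)) (𝓝[>] 0) (𝓝 p.2)}

end Abstract

end ElPhEl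

end

/-! Since `gamma0 * gamma1` is diag(1, -1), the massless part of -(i/ħ)Ĥ* acts on each spin
component as -v·∇ with a constant velocity v whose entries are ±1. The mass term is a bounded
skew-adjoint perturbation and is carried along as an operator `K`. At each face one type of
component leaves `S1` (outgoing) and one enters it (incoming). The boundary condition gives the
incoming trace as a coefficient of modulus at most one times the outgoing trace. All claims reduce
to the resolvent equation (l + v·∇)Ψ = η with these conditions, for l > 0.

Existence and contractivity. Reflections stop after two steps. In labels (ς₀, ς₁, ς₂) with 0 for
velocity +1 and 1 for velocity -1, the only chains are (1,0,1) → (0,1,1) → (1,1,0) and (0,0,1) →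
(1,0,0) → (0,1,0), while (0,0,0) and (1,1,1) never meet a face. So the problem can be unfolded: η is
continued to the whole space by reflected copies of the sources (`source`), and Ψ is the restriction
of the free resolvent ∫₀^∞ e^{-lt} ζ(x - tv) dt. The electron distance on the face becomes the
difference of two coordinates with equal velocity, hence is constant along the flow, and this gives
the boundary condition exactly (`resolv_addReflected`). The copies of `S1` under the reflections are
disjoint chambers, so at each time t the transported data carry no more L² mass into `S1` than η has
(`chain_energy`, `sum_sourceBound_le`). Integration against e^{-lt} gives ‖lΨ‖ ≤ ‖η‖.

Uniqueness. A solution for η = 0 vanishes on components whose backward flow stays in `S1`, by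
exponential growth backwards in time. The vanishing passes along the chains because a vanishing
outgoing trace makes the incoming trace zero (`evolGraph_eq_zero`).

Conclusions. A contractive relation is dissipative, and surjectivity of 1 - B excludes proper
dissipative extensions. For coefficient 1, exchange of - and + reverses the velocities and turns -B
into the same problem with phases -θ₁, -θ₂; so both B and -B are contractive and the operator is
self-adjoint. As ε → 0 the sources agree at each point with the limiting ones for small ε, so the
resolvents converge by dominated convergence, and this determines the extended limit
(`extendedLimitGraph_eq`). -/

noncomputable section

namespace ElPhEl

/-! ### Abstract dissipative relations -/

section Relations

variable {E : Type*} [NormedAddCommGroup E] [InnerProductSpace ℂ E]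

/-- A linear relation `G`, thought of as the graph of `B`, such that `λ - B` has for all `λ > 0` an
inverse defined everywhere with norm at most `λ⁻¹`. -/
structure IsContractive (G : Submodule ℂ (E × E)) : Prop where
  exists_resolvent : ∀ l : ℝ, 0 < l → ∀ η : E, ∃ Ψ : E,
    (Ψ, (l : ℂ) • Ψ - η) ∈ G ∧ ‖(l : ℂ) • Ψ‖ ≤ ‖η‖
  eq_zero : ∀ l : ℝ, 0 < l → ∀ Ψ : E, (Ψ, (l : ℂ) • Ψ) ∈ G → Ψ = 0

lemma eq_of_re_inner_sub_nonpos {x y : E} (h : (⟪x - y, x - y⟫_ℂ).re ≤ 0) : x = y := by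
  have h1 : (⟪x - y, x - y⟫_ℂ).re = ‖x - y‖ ^ 2 := inner_self_eq_norm_sq (𝕜 := ℂ) _
  have h0 : ‖x - y‖ = 0 := by
    rw [h1] at h
    exact pow_eq_zero_iff two_ne_zero |>.1 (le_antisymm h (sq_nonneg _))
  exact sub_eq_zero.1 (norm_eq_zero.1 h0)

/-- By uniqueness Ψ is the solution for the right-hand side lΨ - η, so ‖lΨ‖² ≤ ‖lΨ - η‖². Expanding
gives 2l Re⟨η, Ψ⟩ ≤ ‖η‖² for every l > 0, and l may be taken large. -/
lemma IsContractive.re_inner_nonpos {G : Submodule ℂ (E × E)} (hG : IsContractive G) {Ψ η : E}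
    (h : (Ψ, η) ∈ G) : (⟪η, Ψ⟫_ℂ).re ≤ 0 := by
  have key : ∀ l : ℝ, 0 < l → 2 * l * (⟪η, Ψ⟫_ℂ).re ≤ ‖η‖ ^ 2 := by
    intro l hl
    obtain ⟨Ψ', h1, h2⟩ := hG.exists_resolvent l hl ((l : ℂ) • Ψ - η)
    have h3 : (Ψ' - Ψ, (l : ℂ) • (Ψ' - Ψ)) ∈ G := by
      convert G.sub_mem h1 h using 1
      ext
      · rfl
      · simp only [Prod.snd_sub, smul_sub]; abel
    have h4 : Ψ' = Ψ := sub_eq_zero.1 (hG.eq_zero l hl _ h3)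
    rw [h4] at h2
    have h5 := pow_le_pow_left₀ (norm_nonneg _) h2 2
    rw [norm_sub_sq (𝕜 := ℂ)] at h5
    have h6 : RCLike.re ⟪(l : ℂ) • Ψ, η⟫_ℂ = l * (⟪η, Ψ⟫_ℂ).re := by
      rw [inner_smul_left, ← inner_conj_symm]
      simp [-inner_conj_symm]
    rw [h6] at h5
    linarith
  by_contra hc
  push Not at hc
  -- This l makes the left side of `key` equal to ‖η‖² + 1.
  have h0 := key ((‖η‖ ^ 2 + 1) / (2 * (⟪η, Ψ⟫_ℂ).re)) (by positivity)
  have : 2 * ((‖η‖ ^ 2 + 1) / (2 * (⟪η, Ψ⟫_ℂ).re)) * (⟪η, Ψ⟫_ℂ).re = ‖η‖ ^ 2 + 1 := by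
    field_simp
  linarith

lemma exists_mem_graph_one {G : Submodule ℂ (E × E)} (hG : IsContractive G) (η : E) :
    ∃ Ψ : E, (Ψ, Ψ - η) ∈ G := by
  obtain ⟨Ψ, h, -⟩ := hG.exists_resolvent 1 one_pos η
  exact ⟨Ψ, by simpa using h⟩

/-- An operator whose graph is a contractive relation, up to a bounded skew perturbation, is
maximally dissipative. -/
lemma IsContractive.isMaximallyDissipative {G : Submodule ℂ (E × E)} (hG : IsContractive G)
    {K : E →L[ℂ] E} (hK : ∀ Ψ, (⟪K Ψ, Ψ⟫_ℂ).re = 0) {B : E →ₗ.[ℂ] E}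
    (hB : ∀ Ψ η, (Ψ, η) ∈ B.graph ↔ (Ψ, η - K Ψ) ∈ G) : IsMaximallyDissipative B := by
  refine ⟨fun Ψ => ?_, fun A hA hBA => LinearPMap.eq_of_le_of_domain_eq hBA
    (le_antisymm hBA.1 fun x hx => ?_)⟩
  · have h := hG.re_inner_nonpos ((hB _ _).1 (B.mem_graph Ψ))
    rw [inner_sub_left, Complex.sub_re, hK] at h
    linarith
  · obtain ⟨y, hy⟩ := exists_mem_graph_one hG (x - (A ⟨x, hx⟩ - K x))
    have hy' : (y, y - (x - (A ⟨x, hx⟩ - K x)) + K y) ∈ B.graph := by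
      rw [hB]; simpa using hy
    have hyA := LinearPMap.le_graph_of_le hBA hy'
    have hd := A.graph.sub_mem (A.mem_graph ⟨x, hx⟩) hyA
    obtain ⟨z, hz1, hz2⟩ := (LinearPMap.mem_graph_iff A).1 hd
    have h := hA z
    rw [hz1, hz2] at h
    simp only [Prod.fst_sub, Prod.snd_sub] at h
    have e : A ⟨x, hx⟩ - (y - (x - (A ⟨x, hx⟩ - K x)) + K y) = (x - y) + K (x - y) := by
      rw [map_sub]; abel
    rw [e, inner_add_left, Complex.add_re, hK, add_zero] at h
    rw [eq_of_re_inner_sub_nonpos h]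
    exact LinearPMap.mem_domain_of_mem_graph hy'

/-- The relation with the graph of `-B`. -/
def negGraph (G : Submodule ℂ (E × E)) : Submodule ℂ (E × E) :=
  G.comap (LinearMap.prodMap LinearMap.id (-LinearMap.id))

lemma mem_negGraph {G : Submodule ℂ (E × E)} {Ψ η : E} : (Ψ, η) ∈ negGraph G ↔ (Ψ, -η) ∈ G :=
  Iff.rfl

/-- Both signs of dissipativity give Re⟨BΨ, Ψ⟩ = 0. Polarization, with Φ and with iΦ, gives the full
identity. -/
lemma inner_skew {G : Submodule ℂ (E × E)} (hG : IsContractive G)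
    (hG' : IsContractive (negGraph G)) {Ψ η Φ ξ : E} (h : (Ψ, η) ∈ G) (h' : (Φ, ξ) ∈ G) :
    ⟪η, Φ⟫_ℂ = -⟪Ψ, ξ⟫_ℂ := by
  have h0 : ∀ {Ψ η : E}, (Ψ, η) ∈ G → (⟪η, Ψ⟫_ℂ).re = 0 := by
    intro Ψ η h
    refine le_antisymm (hG.re_inner_nonpos h) ?_
    have := hG'.re_inner_nonpos (Ψ := Ψ) (η := -η) (by rw [mem_negGraph, neg_neg]; exact h)
    rw [inner_neg_left, Complex.neg_re] at this
    linarith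
  have h1 : ∀ {Ψ η Φ ξ : E}, (Ψ, η) ∈ G → (Φ, ξ) ∈ G →
      (⟪η, Φ⟫_ℂ).re = -(⟪Ψ, ξ⟫_ℂ).re := by
    intro Ψ η Φ ξ h h'
    have := h0 (G.add_mem h h')
    rw [inner_add_left, inner_add_right, inner_add_right] at this
    simp only [Complex.add_re, h0 h, h0 h'] at this
    have h2 : (⟪ξ, Ψ⟫_ℂ).re = (⟪Ψ, ξ⟫_ℂ).re := by
      rw [← inner_conj_symm, Complex.conj_re]
    linarith
  apply Complex.ext
  · rw [Complex.neg_re]; exact h1 h h'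
  · have := h1 h (G.smul_mem Complex.I h')
    rw [inner_smul_right] at this
    simp only [inner_smul_right, Complex.mul_re, Complex.I_re, Complex.I_im] at this
    rw [Complex.neg_im]
    linarith

/-- A relation for which both `B` and `-B` are contractive is skew-adjoint. -/
lemma mem_of_skew {G : Submodule ℂ (E × E)} (hG : IsContractive G)
    (hG' : IsContractive (negGraph G)) {x w : E}
    (h : ∀ Φ ξ, (Φ, ξ) ∈ G → ⟪w, Φ⟫_ℂ = -⟪x, ξ⟫_ℂ) : (x, w) ∈ G := by
  obtain ⟨y, hy⟩ := exists_mem_graph_one hG (x - w)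
  -- With (1 - B)y = x - w and (1 + B)z = x - y, the weak identities for x and for y tested against
  -- z subtract to ⟨x - y, z + Bz⟩ = 0, that is, ‖x - y‖² = 0.
  obtain ⟨z, hz⟩ := exists_mem_graph_one hG' (x - y)
  rw [mem_negGraph] at hz
  have h1 := h _ _ hz
  have h2 := inner_skew hG hG' hy hz
  have h3 : ⟪x - y, x - y⟫_ℂ = 0 := by
    simp only [inner_sub_left, inner_sub_right, inner_neg_right] at h1 h2 ⊢
    linear_combination h1 - h2
  have h4 : x = y := sub_eq_zero.1 (inner_self_eq_zero.1 h3)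
  subst h4
  simpa using hy

/-- For purely imaginary c, symmetry of H is skewness of cH, and the skew part K does not affect it.
Symmetry gives H ≤ H†; the reverse inclusion of domains is the maximality in `mem_of_skew`. -/
lemma isSelfAdjoint_of_skew [CompleteSpace E] {G : Submodule ℂ (E × E)} (hG : IsContractive G)
    (hG' : IsContractive (negGraph G)) {K : E →L[ℂ] E} (hK : ∀ Ψ Φ, ⟪K Ψ, Φ⟫_ℂ = -⟪Ψ, K Φ⟫_ℂ)
    {H : E →ₗ.[ℂ] E} (hd : Dense (H.domain : Set E)) {c : ℂ} (hc0 : c ≠ 0)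
    (hc : (starRingEnd ℂ) c = -c)
    (hB : ∀ Ψ η, (Ψ, η) ∈ (c • H).graph ↔ (Ψ, η - K Ψ) ∈ G) : IsSelfAdjoint H := by
  have hH : ∀ Ψ : H.domain, ((Ψ : E), c • H Ψ - K Ψ) ∈ G := fun Ψ =>
    (hB _ _).1 ((c • H).mem_graph Ψ)
  have hsym : H.IsFormalAdjoint H := by
    intro x y
    have := inner_skew hG hG' (hH x) (hH y)
    simp only [inner_sub_left, inner_sub_right, inner_smul_left, inner_smul_right, hc, hK] at this
    have h2 : c * (⟪H x, (y : E)⟫_ℂ - ⟪(x : E), H y⟫_ℂ) = 0 := by linear_combination -this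
    exact sub_eq_zero.1 ((mul_eq_zero.1 h2).resolve_left hc0)
  rw [LinearPMap.isSelfAdjoint_def]
  have hle := hsym.le_adjoint hd
  refine (LinearPMap.eq_of_le_of_domain_eq hle (le_antisymm hle.1 fun x hx => ?_)).symm
  have : (x, c • H† ⟨x, hx⟩) ∈ (c • H).graph := by
    rw [hB]
    refine mem_of_skew hG hG' fun Φ ξ hΦ => ?_
    have h1 : (Φ, ξ + K Φ) ∈ (c • H).graph := by rw [hB]; simpa using hΦ
    obtain ⟨y, hy1, hy2⟩ := (LinearPMap.mem_graph_iff _).1 h1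
    have h2 := H.adjoint_isFormalAdjoint hd ⟨x, hx⟩ y
    rw [LinearPMap.smul_apply] at hy2
    simp only at hy1 hy2 h2
    have h3 : ξ = c • H y - K Φ := by rw [hy2]; abel
    rw [h3, inner_sub_left, inner_sub_right, inner_smul_left, inner_smul_right, hc, hK, ← hy1, h2]
    ring
  exact LinearPMap.mem_domain_of_mem_graph (f := c • H) this

/-- Convergence of resolvents at `1` determines the extended limit. -/
lemma extendedLimitGraph_eq {G : ℝ → Submodule ℂ (E × E)} {G₀ : Submodule ℂ (E × E)}
    (hG : ∀ ε, 0 < ε → IsContractive (G ε))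
    (hlim : ∀ η : E, ∃ Ψ : ℝ → E, ∃ Ψ₀ : E, (∀ ε, 0 < ε → (Ψ ε, Ψ ε - η) ∈ G ε) ∧
      (Ψ₀, Ψ₀ - η) ∈ G₀ ∧ Tendsto Ψ (𝓝[>] 0) (𝓝 Ψ₀))
    (hG₀ : IsContractive G₀) {K : E →L[ℂ] E} {B : ℝ → E →ₗ.[ℂ] E} {B₀ : E →ₗ.[ℂ] E}
    (hB : ∀ ε, 0 < ε → ∀ Ψ η, (Ψ, η) ∈ (B ε).graph ↔ (Ψ, η - K Ψ) ∈ G ε)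
    (hB₀ : ∀ Ψ η, (Ψ, η) ∈ B₀.graph ↔ (Ψ, η - K Ψ) ∈ G₀) :
    extendedLimitGraph B = (B₀.graph : Set (E × E)) := by
  have hpos : ∀ᶠ ε : ℝ in 𝓝[>] 0, 0 < ε := self_mem_nhdsWithin
  ext ⟨Ψ, η⟩
  rw [SetLike.mem_coe, hB₀]
  constructor
  · rintro ⟨Φ, h1, h2⟩
    simp only at h1 h2
    -- X ε solves the resolvent equation whose right-hand side is the limit of that solved by Φ ε.
    -- Dissipativity compares the two at fixed ε and in the limit becomes ‖Ψ - X₀‖² ≤ 0.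
    obtain ⟨X, X₀, hX, hX₀, hXl⟩ := hlim (Ψ - (η - K Ψ))
    have h3 : ∀ ε, 0 < ε → (⟪(B ε (Φ ε) - K (Φ ε)) - (X ε - (Ψ - (η - K Ψ))),
        (Φ ε : E) - X ε⟫_ℂ).re ≤ 0 := fun ε hε =>
      (hG ε hε).re_inner_nonpos
        ((G ε).sub_mem ((hB ε hε _ _).1 ((B ε).mem_graph (Φ ε))) (hX ε hε))
    have h4 : Tendsto (fun ε => (⟪(B ε (Φ ε) - K (Φ ε)) - (X ε - (Ψ - (η - K Ψ))),
        (Φ ε : E) - X ε⟫_ℂ).re) (𝓝[>] 0)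
        (𝓝 (⟪(η - K Ψ) - (X₀ - (Ψ - (η - K Ψ))), Ψ - X₀⟫_ℂ).re) := by
      refine (Complex.continuous_re.tendsto _).comp (Tendsto.inner ?_ (h1.sub hXl))
      exact (h2.sub ((K.continuous.tendsto _).comp h1)).sub (hXl.sub tendsto_const_nhds)
    have h5 := le_of_tendsto h4 (hpos.mono h3)
    have e : (η - K Ψ) - (X₀ - (Ψ - (η - K Ψ))) = Ψ - X₀ := by abel
    rw [e] at h5
    have : Ψ = X₀ := eq_of_re_inner_sub_nonpos h5
    subst this
    simpa using hX₀
  · intro h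
    obtain ⟨X, X₀, hX, hX₀, hXl⟩ := hlim (Ψ - (η - K Ψ))
    have h3 : (X₀ - Ψ, ((1 : ℝ) : ℂ) • (X₀ - Ψ)) ∈ G₀ := by
      convert G₀.sub_mem hX₀ h using 1
      ext
      · rfl
      · simp only [Complex.ofReal_one, one_smul, Prod.snd_sub]; abel
    have h4 : X₀ = Ψ := sub_eq_zero.1 (hG₀.eq_zero 1 one_pos _ h3)
    subst h4
    have h5 : ∀ ε, 0 < ε → (X ε, X ε - (X₀ - (η - K X₀)) + K (X ε)) ∈ (B ε).graph := by
      intro ε hε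
      rw [hB ε hε]
      simpa using hX ε hε
    -- The filter sees only ε > 0; elsewhere the approximating vector is an arbitrary 0.
    have h6 : ∀ ε, ∃ Y : (B ε).domain, 0 < ε →
        (Y : E) = X ε ∧ B ε Y = X ε - (X₀ - (η - K X₀)) + K (X ε) := by
      intro ε
      by_cases hε : 0 < ε
      · obtain ⟨y, hy1, hy2⟩ := (LinearPMap.mem_graph_iff _).1 (h5 ε hε)
        exact ⟨y, fun _ => ⟨hy1, hy2⟩⟩
      · exact ⟨0, fun h => absurd h hε⟩
    choose Y hY using h6
    refine ⟨Y, hXl.congr' (hpos.mono fun ε hε => (hY ε hε).1.symm), ?_⟩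
    have h7 : Tendsto (fun ε => X ε - (X₀ - (η - K X₀)) + K (X ε)) (𝓝[>] 0)
        (𝓝 (X₀ - (X₀ - (η - K X₀)) + K X₀)) :=
      (hXl.sub tendsto_const_nhds).add ((K.continuous.tendsto _).comp hXl)
    have e : X₀ - (X₀ - (η - K X₀)) + K X₀ = η := by abel
    rw [e] at h7
    exact h7.congr' (hpos.mono fun ε hε => (hY ε hε).2.symm)

end Relations

/-! ### Reduction to scalar transport equations -/

/-- The velocity `±1` belonging to a spin label. -/
def sgn : Fin 2 → ℝ := ![1, -1]

/-- The velocity with which a spin component is transported. -/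
def vel (a : Spin) : Config := ![sgn a.1, sgn a.2.1, sgn a.2.2]

/-- Diagonality of this product is what decouples the massless equation into scalar transport
equations. -/
lemma sgn_matrix (i j : Fin 2) : (gamma0 * gamma1) i j = if i = j then (sgn i : ℂ) else 0 := by
  fin_cases i <;> fin_cases j <;> simp [gamma0, gamma1, sgn]

lemma actPh_apply (A : Matrix (Fin 2) (Fin 2) ℂ) (ψ : C8) (a : Spin) :
    actPh A ψ a = ∑ i, A a.1 i * ψ (i, a.2) := by
  obtain ⟨a, b, c⟩ := a
  simp [actPh, Matrix.mulVec, dotProduct, Fintype.sum_prod_type, Matrix.one_apply, mul_ite,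
    ite_mul]

lemma actE1_apply (A : Matrix (Fin 2) (Fin 2) ℂ) (ψ : C8) (a : Spin) :
    actE1 A ψ a = ∑ i, A a.2.1 i * ψ (a.1, i, a.2.2) := by
  obtain ⟨a, b, c⟩ := a
  simp [actE1, Matrix.mulVec, dotProduct, Fintype.sum_prod_type, Matrix.one_apply, mul_ite,
    ite_mul]

lemma actE2_apply (A : Matrix (Fin 2) (Fin 2) ℂ) (ψ : C8) (a : Spin) :
    actE2 A ψ a = ∑ i, A a.2.2 i * ψ (a.1, a.2.1, i) := by
  obtain ⟨a, b, c⟩ := a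
  simp [actE2, Matrix.mulVec, dotProduct, Fintype.sum_prod_type, Matrix.one_apply, mul_ite,
    ite_mul]

lemma fderiv_comp_apply {ψ : Config → C8} {x : Config} (h : DifferentiableAt ℝ ψ x) (a : Spin)
    (v : Config) : fderiv ℝ (fun y => ψ y a) x v = fderiv ℝ ψ x v a := by
  have := (((EuclideanSpace.proj (𝕜 := ℂ) a).restrictScalars ℝ).hasFDerivAt (x := ψ x)).comp x
    h.hasFDerivAt
  rw [show (fun y => ψ y a) = (EuclideanSpace.proj (𝕜 := ℂ) a).restrictScalars ℝ ∘ ψ from rfl,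
    this.fderiv]
  rfl

lemma hamExpr_zero_apply (ħ : ℝ) {ψ : Config → C8} {x : Config} (h : DifferentiableAt ℝ ψ x)
    (a : Spin) :
    hamExpr ħ 0 ψ x a = -(Complex.I * ħ) * fderiv ℝ (fun y => ψ y a) x (vel a) := by
  have hv : vel a = sgn a.1 • Pi.single 0 1 + sgn a.2.1 • Pi.single 1 1
      + sgn a.2.2 • Pi.single 2 1 := by
    ext k; fin_cases k <;> simp [vel]
  rw [fderiv_comp_apply h, hv]
  simp only [hamExpr, pd, map_add, map_smul, PiLp.add_apply, PiLp.smul_apply, actPh_apply,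
    actE1_apply, actE2_apply, sgn_matrix, smul_eq_mul, Complex.ofReal_zero, zero_mul, zero_add,
    Complex.real_smul, ite_mul, Finset.sum_ite_eq, Finset.mem_univ, if_true]
  ring

/-! ### The mass term as a bounded skew-adjoint perturbation -/

/-- The matrix multiplying the mass in the Hamiltonian. -/
def massMat : C8 →L[ℂ] C8 := actE1 gamma0 + actE2 gamma0

lemma hamExpr_eq_add (ħ m : ℝ) (ψ : Config → C8) (x : Config) :
    hamExpr ħ m ψ x = hamExpr ħ 0 ψ x + (m : ℂ) • massMat (ψ x) := by
  simp only [hamExpr, massMat, add_apply, smul_add, Complex.ofReal_zero, zero_smul]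
  abel

lemma massMat_inner (x y : C8) : ⟪massMat x, y⟫_ℂ = ⟪x, massMat y⟫_ℂ := by
  have hA : ∀ A : Matrix Spin Spin ℂ, A.conjTranspose = A → ∀ x y : C8,
      ⟪Matrix.toEuclideanCLM (𝕜 := ℂ) A x, y⟫_ℂ = ⟪x, Matrix.toEuclideanCLM (𝕜 := ℂ) A y⟫_ℂ := by
    intro A hA x y
    rw [← ContinuousLinearMap.adjoint_inner_right, ← ContinuousLinearMap.star_eq_adjoint, ← map_star,
      Matrix.star_eq_conjTranspose, hA]
  have h0 : gamma0.conjTranspose = gamma0 := by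
    ext i j; fin_cases i <;> fin_cases j <;> simp [gamma0]
  simp only [massMat, add_apply, inner_add_left, inner_add_right]
  congr 1
  · exact hA _ (by simp [Matrix.conjTranspose_kronecker, h0]) x y
  · exact hA _ (by simp [Matrix.conjTranspose_kronecker, h0]) x y

/-- The bounded part of `-(i/ħ)H`. -/
def massOp (ħ m : ℝ) : L2S1 →L[ℂ] L2S1 :=
  (-(Complex.I / ħ) * m) • massMat.compLpL 2 volS1

lemma massMat_compLpL_inner (Ψ Φ : L2S1) :
    ⟪massMat.compLpL 2 volS1 Ψ, Φ⟫_ℂ = ⟪Ψ, massMat.compLpL 2 volS1 Φ⟫_ℂ := by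
  rw [L2.inner_def, L2.inner_def]
  refine integral_congr_ae ?_
  filter_upwards [massMat.coeFn_compLpL (p := 2) (μ := volS1) Ψ,
    massMat.coeFn_compLpL (p := 2) (μ := volS1) Φ] with x h1 h2
  rw [h1, h2, massMat_inner]

lemma conj_neg_I_div (ħ : ℝ) : (starRingEnd ℂ) (-(Complex.I / ħ)) = -(-(Complex.I / ħ)) := by
  simp [neg_div]

/-- The mass matrix is Hermitian and its prefactor is purely imaginary. -/
lemma massOp_inner (ħ m : ℝ) (Ψ Φ : L2S1) : ⟪massOp ħ m Ψ, Φ⟫_ℂ = -⟪Ψ, massOp ħ m Φ⟫_ℂ := by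
  simp only [massOp, smul_apply, inner_smul_left, inner_smul_right,
    massMat_compLpL_inner, map_mul, conj_neg_I_div, Complex.conj_ofReal]
  ring

lemma massOp_re_inner (ħ m : ℝ) (Ψ : L2S1) : (⟪massOp ħ m Ψ, Ψ⟫_ℂ).re = 0 := by
  have h := congrArg Complex.re (massOp_inner ħ m Ψ Ψ)
  rw [← inner_conj_symm Ψ, Complex.neg_re, Complex.conj_re] at h
  linarith

lemma massOp_zero (ħ : ℝ) : massOp ħ 0 = 0 := by simp [massOp]

/-! ### Graphs of the adjoint and of the boundary operators -/

lemma testToL2_hamTest (ħ m : ℝ) (φ : 𝓓(S1, C8)) :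
    testToL2 (hamTest ħ m φ)
      = testToL2 (hamTest ħ 0 φ) + (m : ℂ) • massMat.compLpL 2 volS1 (testToL2 φ) := by
  refine Lp.ext ?_
  filter_upwards [(test_memLp (hamTest ħ m φ)).coeFn_toLp, (test_memLp (hamTest ħ 0 φ)).coeFn_toLp,
    (test_memLp φ).coeFn_toLp,
    Lp.coeFn_add (testToL2 (hamTest ħ 0 φ)) ((m : ℂ) • massMat.compLpL 2 volS1 (testToL2 φ)),
    Lp.coeFn_smul (m : ℂ) (massMat.compLpL 2 volS1 (testToL2 φ)),
    massMat.coeFn_compLpL (p := 2) (μ := volS1) (testToL2 φ)] with x h1 h2 h3 h4 h5 h6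
  rw [h4, Pi.add_apply, h5, Pi.smul_apply, h6]
  change (test_memLp (hamTest ħ m φ)).toLp _ x = (test_memLp (hamTest ħ 0 φ)).toLp _ x
    + (m : ℂ) • massMat ((test_memLp φ).toLp _ x)
  rw [h1, h2, h3]
  exact hamExpr_eq_add ħ m φ x

/-- Because the domain is dense, the weak identity against test functions determines the value of
the adjoint. -/
lemma mem_adjoint_graph (ħ m : ℝ) (Ψ χ : L2S1) :
    (Ψ, χ) ∈ ((freeH ħ m)†).graph ↔
      ∀ φ : 𝓓(S1, C8), ⟪χ, testToL2 φ⟫_ℂ = ⟪Ψ, testToL2 (hamTest ħ m φ)⟫_ℂ := by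
  have hval : ∀ φ : 𝓓(S1, C8), freeH ħ m ⟨testToL2 φ, ⟨φ, rfl⟩⟩ = testToL2 (hamTest ħ m φ) := by
    intro φ
    change testToL2 (hamTest ħ m ((LinearEquiv.ofInjective testToL2 testToL2_injective).symm
      ⟨testToL2 φ, ⟨φ, rfl⟩⟩)) = _
    congr 2
    exact (LinearEquiv.ofInjective testToL2 testToL2_injective).symm_apply_apply φ
  constructor
  · intro h φ
    obtain ⟨y, hy1, hy2⟩ := (LinearPMap.mem_graph_iff _).1 h
    have := (freeH ħ m).adjoint_isFormalAdjoint (freeH_dense ħ m) y ⟨testToL2 φ, ⟨φ, rfl⟩⟩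
    rw [hval] at this
    simp only at hy1 hy2 this
    rw [← hy1, ← hy2]
    exact this
  · intro h
    have h' : ∀ x : (freeH ħ m).domain, ⟪χ, (x : L2S1)⟫_ℂ = ⟪Ψ, freeH ħ m x⟫_ℂ := by
      rintro ⟨_, φ, rfl⟩
      rw [hval]; exact h φ
    have hd := (freeH ħ m).mem_adjoint_domain_of_exists Ψ ⟨χ, h'⟩
    rw [LinearPMap.mem_graph_iff]
    exact ⟨⟨Ψ, hd⟩, rfl, LinearPMap.adjoint_apply_eq (freeH_dense ħ m) ⟨Ψ, hd⟩ h'⟩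

lemma mem_smul_graph {c : ℂ} (hc : c ≠ 0) (H : L2S1 →ₗ.[ℂ] L2S1) (Ψ η : L2S1) :
    (Ψ, η) ∈ (c • H).graph ↔ (Ψ, c⁻¹ • η) ∈ H.graph := by
  simp only [LinearPMap.mem_graph_iff]
  constructor
  · rintro ⟨y, h1, h2⟩
    refine ⟨y, h1, ?_⟩
    rw [LinearPMap.smul_apply] at h2
    rw [← h2, inv_smul_smul₀ hc]
  · rintro ⟨y, h1, h2⟩
    refine ⟨y, h1, ?_⟩
    rw [LinearPMap.smul_apply]
    rw [h2, smul_inv_smul₀ hc]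

lemma mem_boundaryH_graph (ħ m θ₁ θ₂ : ℝ) (μ : ℝ → ℝ) (Ψ χ : L2S1) :
    (Ψ, χ) ∈ (boundaryH ħ m θ₁ θ₂ μ).graph ↔
      BoundaryCond θ₁ θ₂ μ Ψ ∧ (Ψ, χ) ∈ ((freeH ħ m)†).graph := by
  simp only [LinearPMap.mem_graph_iff]
  constructor
  · rintro ⟨⟨y, hy⟩, h1, h2⟩
    refine ⟨?_, ⟨⟨y, hy.2⟩, h1, ?_⟩⟩
    · simp only at h1; rw [← h1]; exact hy.1
    · rw [← h2]
      exact (LinearPMap.domRestrict_apply rfl).symm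
  · rintro ⟨hb, ⟨y, hy⟩, h1, h2⟩
    simp only at h1
    subst h1
    refine ⟨⟨y, ⟨hb, hy⟩⟩, rfl, ?_⟩
    rw [← h2]
    exact LinearPMap.domRestrict_apply rfl

/-- The graph of the massless evolution generator. -/
def evolGraph (θ₁ θ₂ : ℝ) (μ : ℝ → ℝ) : Submodule ℂ (L2S1 × L2S1) :=
  ((-(Complex.I / (1 : ℝ))) • boundaryH 1 0 θ₁ θ₂ μ).graph

/-- `v · ∇u = -f` on `S1` in the sense of distributions. -/
def WeakTransport (v : Config) (u f : Config → ℂ) : Prop :=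
  ∀ φ : Config → ℂ, ContDiff ℝ ∞ φ → HasCompactSupport φ → tsupport φ ⊆ (S1 : Set Config) →
    ∫ x, (starRingEnd ℂ) (f x) * φ x ∂volS1 = ∫ x, (starRingEnd ℂ) (u x) * fderiv ℝ φ x v ∂volS1

lemma memLp_comp (a : Spin) (Ψ : L2S1) : MemLp (comp a Ψ) 2 volS1 :=
  (EuclideanSpace.proj (𝕜 := ℂ) a).comp_memLp' (Lp.memLp Ψ)

lemma inner_testToL2 (Ψ : L2S1) (φ : 𝓓(S1, C8)) :
    ⟪Ψ, testToL2 φ⟫_ℂ = ∑ a, ∫ x, (starRingEnd ℂ) (comp a Ψ x) * φ x a ∂volS1 := by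
  have hi : ∀ a ∈ Finset.univ,
      Integrable (fun x => (starRingEnd ℂ) (comp a Ψ x) * φ x a) volS1 := fun a _ =>
    (memLp_comp a Ψ).star.integrable_mul
      ((EuclideanSpace.proj (𝕜 := ℂ) a).comp_memLp' (test_memLp φ))
  rw [L2.inner_def, ← integral_finsetSum _ hi]
  refine integral_congr_ae ?_
  filter_upwards [(test_memLp φ).coeFn_toLp] with x hx
  change ⟪Ψ x, (test_memLp φ).toLp _ x⟫_ℂ = _
  rw [hx, PiLp.inner_apply]
  refine Finset.sum_congr rfl fun a _ => ?_
  rw [RCLike.inner_apply, mul_comm]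
  rfl

lemma inner_testToL2_hamTest (ħ : ℝ) (Ψ : L2S1) (φ : 𝓓(S1, C8)) :
    ⟪Ψ, testToL2 (hamTest ħ 0 φ)⟫_ℂ = -(Complex.I * ħ) *
      ∑ a, ∫ x, (starRingEnd ℂ) (comp a Ψ x) * fderiv ℝ (fun y => φ y a) x (vel a) ∂volS1 := by
  rw [inner_testToL2, Finset.mul_sum]
  refine Finset.sum_congr rfl fun a _ => ?_
  rw [← integral_const_mul]
  refine integral_congr_ae (Eventually.of_forall fun x => ?_)
  change _ * hamExpr ħ 0 φ x a = _
  rw [hamExpr_zero_apply ħ (φ.contDiff.differentiable (by simp) x)]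
  ring

/-- The factor -(i/ħ) cancels -iħ up to sign, so the adjoint equation says that the sum over spin
components of the weak transport equations holds. Testing with a single component separates the sum.
-/
lemma mem_graph_iff_weakTransport {ħ : ℝ} (hħ : 0 < ħ) (m θ₁ θ₂ : ℝ) (μ : ℝ → ℝ) (Ψ η : L2S1) :
    (Ψ, η) ∈ ((-(Complex.I / ħ)) • boundaryH ħ m θ₁ θ₂ μ).graph ↔
      BoundaryCond θ₁ θ₂ μ Ψ ∧
        ∀ a, WeakTransport (vel a) (comp a Ψ) (comp a (η - massOp ħ m Ψ)) := by
  have hħ' : (ħ : ℂ) ≠ 0 := by exact_mod_cast hħ.ne'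
  have hc : -(Complex.I / (ħ : ℂ)) ≠ 0 :=
    neg_ne_zero.2 (div_ne_zero Complex.I_ne_zero hħ')
  rw [mem_smul_graph hc, mem_boundaryH_graph, mem_adjoint_graph]
  refine and_congr_right fun _ => ?_
  have key : ∀ φ : 𝓓(S1, C8),
      ⟪(-(Complex.I / (ħ : ℂ)))⁻¹ • η, testToL2 φ⟫_ℂ = ⟪Ψ, testToL2 (hamTest ħ m φ)⟫_ℂ ↔
      ∑ a, ∫ x, (starRingEnd ℂ) (comp a (η - massOp ħ m Ψ) x) * φ x a ∂volS1 =
        ∑ a, ∫ x, (starRingEnd ℂ) (comp a Ψ x) * fderiv ℝ (fun y => φ y a) x (vel a) ∂volS1 := by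
    intro φ
    rw [← inner_testToL2, testToL2_hamTest, inner_add_right, inner_testToL2_hamTest,
      inner_smul_left, inner_smul_right, inner_sub_left, ← massMat_compLpL_inner]
    have e : ⟪massOp ħ m Ψ, testToL2 φ⟫_ℂ
        = (Complex.I / ħ) * (m * ⟪massMat.compLpL 2 volS1 Ψ, testToL2 φ⟫_ℂ) := by
      simp only [massOp, smul_apply, inner_smul_left, map_mul, conj_neg_I_div,
        Complex.conj_ofReal]
      ring
    rw [e]
    generalize ⟪η, testToL2 φ⟫_ℂ = A
    generalize (m : ℂ) * ⟪massMat.compLpL 2 volS1 Ψ, testToL2 φ⟫_ℂ = C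
    generalize ∑ a, ∫ x, (starRingEnd ℂ) (comp a Ψ x) *
      fderiv ℝ (fun y => φ y a) x (vel a) ∂volS1 = D
    have e2 : (starRingEnd ℂ) (-(Complex.I / (ħ : ℂ)))⁻¹ = -(Complex.I * ħ) := by
      rw [map_inv₀, conj_neg_I_div, neg_neg, inv_div, ← mul_one (-(Complex.I * (ħ : ℂ))),
        div_eq_iff Complex.I_ne_zero]
      linear_combination (ħ : ℂ) * Complex.I_sq
    rw [e2]
    have hI := Complex.I_sq
    have h1 : -(Complex.I * (ħ : ℂ)) ≠ 0 := neg_ne_zero.2 (mul_ne_zero Complex.I_ne_zero hħ')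
    rw [← (mul_right_injective₀ h1).eq_iff (a := A - _)]
    have e3 : -(Complex.I * (ħ : ℂ)) * (A - Complex.I / ħ * C) = -(Complex.I * ħ) * A - C := by
      field_simp
      linear_combination C * hI
    simp only [e3]
    constructor
    · intro h; linear_combination h
    · intro h; linear_combination h
  simp only [key]
  constructor
  · intro h a φ hφ hφc hφs
    -- A test function concentrated in the component a isolates the equation for that component.
    let Φ : 𝓓(S1, C8) :=
      { toFun := fun x => φ x • (EuclideanSpace.single a (1 : ℂ) : C8)
        contDiff' := hφ.smul contDiff_const
        hasCompactSupport' := hφc.smul_right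
        tsupport_subset' := (tsupport_smul_subset_left _ _).trans hφs }
    have h1 := h Φ
    have h2 : ∀ b x, Φ x b = if b = a then φ x else 0 := by
      intro b x
      change (φ x • (EuclideanSpace.single a (1 : ℂ) : C8)) b = _
      simp
    simp only [h2] at h1
    rw [Finset.sum_eq_single a, Finset.sum_eq_single a] at h1
    · simpa using h1
    · intro b _ hb; simp [hb]
    · simp
    · intro b _ hb; simp [hb]
    · simp
  · intro h φ
    refine Finset.sum_congr rfl fun a _ => ?_
    have hs : Function.support (fun y => φ y a) ⊆ tsupport φ := by
      intro x hx
      refine subset_tsupport _ fun h0 => hx ?_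
      change φ x a = 0
      rw [h0]; rfl
    refine h a (fun y => φ y a) ?_ (φ.hasCompactSupport.mono' hs)
      ((closure_minimal hs (isClosed_tsupport _)).trans φ.tsupport_subset)
    exact ((EuclideanSpace.proj (𝕜 := ℂ) a).restrictScalars ℝ).contDiff.comp φ.contDiff

lemma mem_evolGraph {θ₁ θ₂ : ℝ} {μ : ℝ → ℝ} {Ψ η : L2S1} :
    (Ψ, η) ∈ evolGraph θ₁ θ₂ μ ↔ BoundaryCond θ₁ θ₂ μ Ψ ∧
        ∀ a, WeakTransport (vel a) (comp a Ψ) (comp a η) := by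
  rw [evolGraph, mem_graph_iff_weakTransport one_pos, massOp_zero, zero_apply, sub_zero]

/-- All parameters ħ and m are reduced to one transport generator: ħ cancels, and m enters only
through the bounded skew operator. -/
lemma mem_graph_iff_evolGraph {ħ : ℝ} (hħ : 0 < ħ) (m θ₁ θ₂ : ℝ) (μ : ℝ → ℝ) (Ψ η : L2S1) :
    (Ψ, η) ∈ ((-(Complex.I / ħ)) • boundaryH ħ m θ₁ θ₂ μ).graph ↔
      (Ψ, η - massOp ħ m Ψ) ∈ evolGraph θ₁ θ₂ μ := by
  rw [mem_graph_iff_weakTransport hħ, mem_evolGraph]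

/-! ### Coordinates adapted to the two boundary faces -/

/-- Linear coordinates `(h, q)` in which `S1` is the quadrant `h > 0, q ∈ halfPlane` and the slices
`σ` are the levels of `h`. -/
structure IsFace (e : (ℝ × (ℝ × ℝ)) ≃L[ℝ] Config) (σ : ℝ → ℝ × ℝ → Config) : Prop where
  apply : ∀ h q, σ h q = e (h, q)
  mem_iff : ∀ p, e p ∈ S1 ↔ 0 < p.1 ∧ p.2 ∈ halfPlane

def faceEquiv1 : (ℝ × (ℝ × ℝ)) ≃L[ℝ] Config :=
  LinearEquiv.toContinuousLinearEquiv
    { slice1Lin with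
      invFun := fun x => ((x 0 - x 1) / 2, (x 0, (x 2 - x 0) / 2))
      left_inv := fun p => by
        simp [slice1Lin, slice1, relPoint]
      right_inv := fun x => by
        ext k; fin_cases k <;> simp [slice1Lin, slice1, relPoint] <;> ring }

def faceEquiv2 : (ℝ × (ℝ × ℝ)) ≃L[ℝ] Config :=
  LinearEquiv.toContinuousLinearEquiv
    { slice2Lin with
      invFun := fun x => ((x 2 - x 0) / 2, (x 0, (x 0 - x 1) / 2))
      left_inv := fun p => by
        simp [slice2Lin, slice2, relPoint]
      right_inv := fun x => by
        ext k; fin_cases k <;> simp [slice2Lin, slice2, relPoint] <;> ring }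

lemma faceEquiv1_symm_apply (x : Config) :
    faceEquiv1.symm x = ((x 0 - x 1) / 2, (x 0, (x 2 - x 0) / 2)) := rfl

lemma faceEquiv2_symm_apply (x : Config) :
    faceEquiv2.symm x = ((x 2 - x 0) / 2, (x 0, (x 0 - x 1) / 2)) := rfl

lemma mem_S1 {x : Config} : x ∈ S1 ↔ x 1 < x 0 ∧ x 0 < x 2 := Iff.rfl

lemma isFace1 : IsFace faceEquiv1 slice1 where
  apply _ _ := rfl
  mem_iff p := by
    change slice1 p.1 p.2 ∈ S1 ↔ _
    rw [mem_S1]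
    simp [slice1, relPoint, halfPlane]

lemma isFace2 : IsFace faceEquiv2 slice2 where
  apply _ _ := rfl
  mem_iff p := by
    change slice2 p.1 p.2 ∈ S1 ↔ _
    rw [mem_S1]
    simp [slice2, relPoint, halfPlane, and_comm]

lemma isCompact_subset_pos {X : Type*} [TopologicalSpace X] {s : Set X} (hs : IsCompact s)
    {f : X → ℝ} (hf : Continuous f) (hpos : ∀ x ∈ s, 0 < f x) : ∃ δ > 0, ∀ x ∈ s, δ ≤ f x := by
  rcases s.eq_empty_or_nonempty with rfl | hne
  · exact ⟨1, one_pos, by simp⟩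
  · obtain ⟨x, hx, hmin⟩ := hs.exists_isMinOn hne hf.continuousOn
    exact ⟨f x, hpos x hx, fun y hy => hmin hy⟩

lemma IsFace.goodSlices {e : (ℝ × (ℝ × ℝ)) ≃L[ℝ] Config} {σ : ℝ → ℝ × ℝ → Config}
    (h : IsFace e σ) : GoodSlices σ where
  cont := by simp only [h.apply]; exact e.continuous
  qmp := by
    simp only [h.apply]
    exact qmp_of_surjective e.toLinearEquiv.toLinearMap e.surjective
  mem r hr q hq := by rw [h.apply, h.mem_iff]; exact ⟨hr, hq⟩

/-- A function vanishing near the boundary has trace zero. -/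
lemma IsFace.hasTrace_zero {e : (ℝ × (ℝ × ℝ)) ≃L[ℝ] Config} {σ : ℝ → ℝ × ℝ → Config}
    (h : IsFace e σ) {u : Config → ℂ} (hc : HasCompactSupport u)
    (hu : tsupport u ⊆ (S1 : Set Config)) : HasTrace σ u (fun _ => 0) := by
  refine ⟨aestronglyMeasurable_const, fun K hK _ => ?_⟩
  -- The compact support lies in the open `S1`, hence at height at least δ above the face; averages
  -- over slabs thinner than δ are zero.
  obtain ⟨δ, hδ, hδ'⟩ := isCompact_subset_pos (s := tsupport u) hc
    (f := fun x => (e.symm x).1) (by fun_prop) (fun x hx => by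
      have := (h.mem_iff (e.symm x)).1 (by simpa using hu hx)
      exact this.1)
  refine tendsto_const_nhds.congr' ?_
  filter_upwards [Ioo_mem_nhdsGT hδ] with r hr
  have : ∫⁻ p in Ioo (0 : ℝ) r ×ˢ K, ‖u (σ p.1 p.2) - 0‖ₑ ^ 2 = 0 := by
    rw [setLIntegral_congr_fun (g := fun _ => 0) (measurableSet_Ioo.prod hK.measurableSet)]
    · simp
    · intro p hp
      have h0 : u (σ p.1 p.2) = 0 := by
        refine image_eq_zero_of_notMem_tsupport fun hm => ?_
        have := hδ' _ hm
        rw [h.apply, e.symm_apply_apply] at this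
        exact absurd this (not_le.2 (hp.1.2.trans hr.2))
      simp [h0]
  rw [this, mul_zero]

/-! ### The boundary operators extend the free Hamiltonian -/

lemma tsupport_component {φ : 𝓓(S1, C8)} (a : Spin) :
    tsupport (fun y => φ y a) ⊆ tsupport φ := by
  refine closure_minimal (fun x hx => subset_tsupport _ fun h0 => hx ?_) (isClosed_tsupport _)
  change φ x a = 0
  rw [h0]; rfl

lemma contDiff_component {φ : 𝓓(S1, C8)} (a : Spin) : ContDiff ℝ ∞ (fun y => φ y a) :=
  ((EuclideanSpace.proj (𝕜 := ℂ) a).restrictScalars ℝ).contDiff.comp φ.contDiff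

lemma hasCompactSupport_component {φ : 𝓓(S1, C8)} (a : Spin) :
    HasCompactSupport (fun y => φ y a) :=
  φ.hasCompactSupport.of_isClosed_subset (isClosed_tsupport _) (tsupport_component a)

lemma integral_volS1_eq {f : Config → ℂ} (hf : ∀ x, x ∉ (S1 : Set Config) → f x = 0) :
    ∫ x, f x ∂volS1 = ∫ x, f x :=
  setIntegral_eq_integral_of_forall_compl_eq_zero hf

lemma fderiv_conj {φ : Config → ℂ} {x : Config} (h : DifferentiableAt ℝ φ x) (v : Config) :
    fderiv ℝ (fun y => (starRingEnd ℂ) (φ y)) x v = (starRingEnd ℂ) (fderiv ℝ φ x v) := by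
  have := (Complex.conjCLE.toContinuousLinearMap.hasFDerivAt (x := φ x)).comp x h.hasFDerivAt
  rw [show (fun y => (starRingEnd ℂ) (φ y)) = Complex.conjCLE.toContinuousLinearMap ∘ φ from rfl,
    this.fderiv]
  rfl

lemma integral_conj_mul_fderiv {φ χ : Config → ℂ} (hφ : ContDiff ℝ ∞ φ)
    (hχ : ContDiff ℝ ∞ χ) (hχc : HasCompactSupport χ) (v : Config) :
    ∫ x, (starRingEnd ℂ) (φ x) * fderiv ℝ χ x v
      = -∫ x, (starRingEnd ℂ) (fderiv ℝ φ x v) * χ x := by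
  have hφd : Differentiable ℝ φ := hφ.differentiable (by simp)
  have hcd : Differentiable ℝ (fun y => (starRingEnd ℂ) (φ y)) :=
    Complex.conjCLE.differentiable.comp hφd
  have hdφ : Continuous fun x => fderiv ℝ φ x v :=
    (hφ.continuous_fderiv (by simp)).clm_apply continuous_const
  have hdχ : Continuous fun x => fderiv ℝ χ x v :=
    (hχ.continuous_fderiv (by simp)).clm_apply continuous_const
  have hcφ : Continuous fun x => (starRingEnd ℂ) (φ x) :=
    Complex.continuous_conj.comp hφ.continuous
  have key := integral_mul_fderiv_eq_neg_fderiv_mul_of_integrable (𝕜 := ℂ) (μ := volume)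
    (f := fun y => (starRingEnd ℂ) (φ y)) (g := χ) (v := v) ?_ ?_ ?_ (fun x _ => hcd x)
    (fun x _ => hχ.differentiable (by simp) x)
  · rw [key]
    simp only [fderiv_conj (hφd _)]
  · simp only [fderiv_conj (hφd _)]
    exact ((Complex.continuous_conj.comp hdφ).mul hχ.continuous).integrable_of_hasCompactSupport
      hχc.mul_left
  · exact (hcφ.mul hdχ).integrable_of_hasCompactSupport
      (HasCompactSupport.mul_left (hχc.fderiv_apply ℝ v))
  · exact (hcφ.mul hχ.continuous).integrable_of_hasCompactSupport hχc.mul_left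

/-- The mass part is Hermitian; for the rest, the sign from integration by parts is absorbed by
conjugating the imaginary prefactor, and compact support leaves no boundary term. -/
lemma hamTest_symmetric (ħ m : ℝ) (φ χ : 𝓓(S1, C8)) :
    ⟪testToL2 (hamTest ħ m φ), testToL2 χ⟫_ℂ = ⟪testToL2 φ, testToL2 (hamTest ħ m χ)⟫_ℂ := by
  have hout : ∀ (ρ : 𝓓(S1, C8)) (a : Spin) (x : Config), x ∉ (S1 : Set Config) → ρ x a = 0 := by
    intro ρ a x hx
    rw [image_eq_zero_of_notMem_tsupport fun h => hx (ρ.tsupport_subset h)]; rfl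
  have hswap : ∀ (ρ τ : 𝓓(S1, C8)),
      ⟪testToL2 ρ, testToL2 (hamTest ħ 0 τ)⟫_ℂ = -(Complex.I * ħ) *
        ∑ a, ∫ x, (starRingEnd ℂ) (ρ x a) * fderiv ℝ (fun y => τ y a) x (vel a) := by
    intro ρ τ
    rw [inner_testToL2_hamTest]
    congr 1
    refine Finset.sum_congr rfl fun a _ => ?_
    rw [← integral_volS1_eq fun x hx => by rw [hout ρ a x hx, map_zero, zero_mul]]
    refine integral_congr_ae ?_
    filter_upwards [(test_memLp ρ).coeFn_toLp] with x hx
    change (starRingEnd ℂ) ((test_memLp ρ).toLp _ x a) * _ = _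
    rw [hx]
  rw [testToL2_hamTest ħ m φ, testToL2_hamTest ħ m χ, inner_add_left, inner_add_right,
    inner_smul_left, inner_smul_right, massMat_compLpL_inner, Complex.conj_ofReal]
  congr 1
  rw [← inner_conj_symm, hswap, hswap, map_mul, map_sum]
  simp only [← integral_conj]
  have e : (starRingEnd ℂ) (-(Complex.I * (ħ : ℂ))) = Complex.I * ħ := by simp
  rw [e, neg_mul, ← mul_neg, ← Finset.sum_neg_distrib]
  congr 1
  refine Finset.sum_congr rfl fun a _ => ?_
  rw [integral_conj_mul_fderiv (contDiff_component a) (contDiff_component a)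
    (hasCompactSupport_component a), neg_neg]
  refine integral_congr_ae (Eventually.of_forall fun x => ?_)
  simp [mul_comm]

lemma boundaryCond_test (θ₁ θ₂ : ℝ) (μ : ℝ → ℝ) (φ : 𝓓(S1, C8)) :
    BoundaryCond θ₁ θ₂ μ (testToL2 φ) := by
  have h : ∀ {e : (ℝ × (ℝ × ℝ)) ≃L[ℝ] Config} {σ : ℝ → ℝ × ℝ → Config}, IsFace e σ →
      ∀ a, HasTrace σ (comp a (testToL2 φ)) (fun _ => 0) := by
    intro e σ h a
    refine (h.hasTrace_zero (hasCompactSupport_component (φ := φ) a)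
      ((tsupport_component a).trans φ.tsupport_subset)).congr h.goodSlices ?_
    filter_upwards [(test_memLp φ).coeFn_toLp] with x hx
    change _ = (test_memLp φ).toLp _ x a
    rw [hx]
  refine ⟨fun c => ⟨fun _ => 0, h isFace1 _, ?_⟩, fun b => ⟨fun _ => 0, h isFace2 _, ?_⟩⟩
  · simpa using h isFace1 _
  · simpa using h isFace2 _

lemma freeH_le_boundaryH (ħ m θ₁ θ₂ : ℝ) (μ : ℝ → ℝ) :
    freeH ħ m ≤ boundaryH ħ m θ₁ θ₂ μ := by
  refine LinearPMap.le_of_le_graph ?_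
  rintro ⟨Ψ, χ⟩ h
  rw [mem_boundaryH_graph, mem_adjoint_graph]
  obtain ⟨⟨_, φ, rfl⟩, h1, h2⟩ := (LinearPMap.mem_graph_iff _).1 h
  have hval : freeH ħ m ⟨testToL2 φ, ⟨φ, rfl⟩⟩ = testToL2 (hamTest ħ m φ) := by
    change testToL2 (hamTest ħ m ((LinearEquiv.ofInjective testToL2 testToL2_injective).symm
      ⟨testToL2 φ, ⟨φ, rfl⟩⟩)) = _
    congr 2
    exact (LinearEquiv.ofInjective testToL2 testToL2_injective).symm_apply_apply φ
  simp only at h1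
  subst h1
  rw [hval] at h2
  simp only at h2
  subst h2
  exact ⟨boundaryCond_test θ₁ θ₂ μ φ, fun ψ => hamTest_symmetric ħ m φ ψ⟩

lemma smul_le_smul_pmap (c : ℂ) {A B : L2S1 →ₗ.[ℂ] L2S1} (h : A ≤ B) : c • A ≤ c • B :=
  ⟨h.1, fun x y hxy => by
    rw [LinearPMap.smul_apply, LinearPMap.smul_apply]
    exact congrArg (c • ·) (h.2 hxy)⟩

/-! ### Reversal of all velocities -/

/-- The exchange of the labels `-` and `+` of all three particles. -/
def flipSpin : Spin ≃ Spin := Equiv.prodCongr Fin.revPerm (Equiv.prodCongr Fin.revPerm Fin.revPerm)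

lemma vel_flipSpin (a : Spin) : vel (flipSpin a) = -vel a := by
  obtain ⟨a, b, c⟩ := a
  ext k
  fin_cases k <;> fin_cases a <;> fin_cases b <;> fin_cases c <;>
    simp [vel, sgn, flipSpin, Fin.revPerm]

def flipC8 : C8 ≃ₗᵢ[ℂ] C8 := LinearIsometryEquiv.piLpCongrLeft 2 ℂ ℂ flipSpin

lemma flipC8_apply (x : C8) (a : Spin) : flipC8 x a = x (flipSpin a) := rfl

def flipOp : L2S1 →L[ℂ] L2S1 :=
  (flipC8.toContinuousLinearEquiv : C8 →L[ℂ] C8).compLpL 2 volS1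

lemma coeFn_flipOp (Ψ : L2S1) : flipOp Ψ =ᵐ[volS1] fun x => flipC8 (Ψ x) :=
  (flipC8.toContinuousLinearEquiv : C8 →L[ℂ] C8).coeFn_compLpL Ψ

lemma comp_flipOp (a : Spin) (Ψ : L2S1) : comp a (flipOp Ψ) =ᵐ[volS1] comp (flipSpin a) Ψ := by
  filter_upwards [coeFn_flipOp Ψ] with x hx
  change flipOp Ψ x a = _
  rw [hx]; rfl

lemma flipOp_flipOp (Ψ : L2S1) : flipOp (flipOp Ψ) = Ψ := by
  refine Lp.ext ?_
  filter_upwards [coeFn_flipOp (flipOp Ψ), coeFn_flipOp Ψ] with x h1 h2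
  rw [h1, h2]
  ext a
  rw [flipC8_apply, flipC8_apply]
  exact congrArg (Ψ x) (flipSpin.apply_symm_apply a)

lemma norm_flipOp (Ψ : L2S1) : ‖flipOp Ψ‖ = ‖Ψ‖ := by
  rw [Lp.norm_def, Lp.norm_def, eLpNorm_congr_ae (coeFn_flipOp Ψ)]
  congr 1
  exact eLpNorm_congr_norm_ae (Eventually.of_forall fun x => flipC8.norm_map _)

lemma WeakTransport.congr {v : Config} {u u' f f' : Config → ℂ} (h : WeakTransport v u f)
    (hu : u =ᵐ[volS1] u') (hf : f =ᵐ[volS1] f') : WeakTransport v u' f' := by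
  intro φ h1 h2 h3
  have e1 : ∫ x, (starRingEnd ℂ) (f' x) * φ x ∂volS1 = ∫ x, (starRingEnd ℂ) (f x) * φ x ∂volS1 :=
    integral_congr_ae (hf.mono fun x hx => by simp only [hx])
  have e2 : ∫ x, (starRingEnd ℂ) (u' x) * fderiv ℝ φ x v ∂volS1
      = ∫ x, (starRingEnd ℂ) (u x) * fderiv ℝ φ x v ∂volS1 :=
    integral_congr_ae (hu.mono fun x hx => by simp only [hx])
  rw [e1, e2]
  exact h φ h1 h2 h3

lemma WeakTransport.neg {v : Config} {u f : Config → ℂ} (h : WeakTransport v u f) :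
    WeakTransport (-v) u (fun x => -f x) := by
  intro φ h1 h2 h3
  simp only [map_neg, neg_mul, mul_neg, integral_neg, h φ h1 h2 h3]

/-- Exchanging all labels reverses the velocities and swaps incoming with outgoing, so the boundary
relation has to be inverted. This is possible because the coefficient is a pure phase, and it
changes the sign of the phases. -/
lemma flip_mem_evolGraph {θ₁ θ₂ : ℝ} {Ψ η : L2S1}
    (h : (Ψ, η) ∈ evolGraph (-θ₁) (-θ₂) (fun _ => 1)) :
    (flipOp Ψ, -flipOp η) ∈ evolGraph θ₁ θ₂ (fun _ => 1) := by
  rw [mem_evolGraph] at h ⊢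
  obtain ⟨⟨h1, h2⟩, h3⟩ := h
  have hexp : ∀ (θ : ℝ) (z : ℂ), Complex.exp (Complex.I * θ) *
      (Complex.exp (Complex.I * (-θ : ℝ)) * z) = z := by
    intro θ z
    rw [← mul_assoc, ← Complex.exp_add]
    simp
  refine ⟨⟨fun c => ?_, fun b => ?_⟩, fun a => ?_⟩
  · obtain ⟨g, hg1, hg2⟩ := h1 c.rev
    refine ⟨_, hg2.congr goodSlices1 (comp_flipOp (1, 0, c) Ψ).symm, ?_⟩
    simp only [Complex.ofReal_one, one_mul, hexp]
    exact hg1.congr goodSlices1 (comp_flipOp (0, 1, c) Ψ).symm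
  · obtain ⟨g, hg1, hg2⟩ := h2 b.rev
    refine ⟨_, hg2.congr goodSlices2 (comp_flipOp (0, b, 1) Ψ).symm, ?_⟩
    simp only [Complex.ofReal_one, one_mul, hexp]
    exact hg1.congr goodSlices2 (comp_flipOp (1, b, 0) Ψ).symm
  · have := (h3 (flipSpin a)).neg
    rw [vel_flipSpin, neg_neg] at this
    refine this.congr (comp_flipOp a Ψ).symm ?_
    filter_upwards [comp_flipOp a η, comp_smul a (-1) (flipOp η)] with x hx1 hx2
    rw [neg_one_smul] at hx2
    rw [hx2, hx1, neg_one_mul]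

/-- The label exchange is an isometric involution, so it transports resolvents and their bounds from
the problem with opposite phases. -/
lemma isContractive_negGraph {θ₁ θ₂ : ℝ}
    (h : IsContractive (evolGraph (-θ₁) (-θ₂) (fun _ => 1))) :
    IsContractive (negGraph (evolGraph θ₁ θ₂ (fun _ => 1))) where
  exists_resolvent l hl η := by
    obtain ⟨Ψ, h1, h2⟩ := h.exists_resolvent l hl (flipOp η)
    refine ⟨flipOp Ψ, ?_, ?_⟩
    · have := flip_mem_evolGraph h1
      rw [map_sub, map_smul, flipOp_flipOp] at this
      exact this
    · rw [← map_smul, norm_flipOp]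
      exact h2.trans_eq (norm_flipOp η)
  eq_zero l hl Ψ hΨ := by
    rw [mem_negGraph, ← neg_neg θ₁, ← neg_neg θ₂] at hΨ
    have := flip_mem_evolGraph hΨ
    rw [map_neg, neg_neg, map_smul] at this
    have h0 := h.eq_zero l hl _ this
    rw [← flipOp_flipOp Ψ, h0, map_zero]

/-! ### The resolvent of a translation flow -/

/-- The exponential weight as an extended nonnegative function. -/
def expWeight (l t : ℝ) : ℝ≥0∞ := ENNReal.ofReal (Real.exp (-(l * t)))

/-- The solution `∫₀^∞ e^{-lt} ζ(x - tv) dt` of `(l + v·∇) u = ζ`. -/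
def resolv (l : ℝ) (v : Config) (ζ : Config → ℂ) (x : Config) : ℂ :=
  ∫ t in Ioi (0 : ℝ), (Real.exp (-(l * t)) : ℂ) * ζ (x - t • v)

lemma measurable_expWeight (l : ℝ) : Measurable (expWeight l) := by
  unfold expWeight; fun_prop

lemma expWeight_ne_top (l t : ℝ) : expWeight l t ≠ ⊤ := ENNReal.ofReal_ne_top

lemma integrableOn_exp {l : ℝ} (hl : 0 < l) :
    IntegrableOn (fun t => Real.exp (-(l * t))) (Ioi 0) := by
  simpa [neg_mul] using integrableOn_exp_mul_Ioi (neg_lt_zero.2 hl) 0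

lemma lintegral_expWeight {l : ℝ} (hl : 0 < l) :
    ∫⁻ t in Ioi (0 : ℝ), expWeight l t = ENNReal.ofReal (1 / l) := by
  unfold expWeight
  rw [← ofReal_integral_eq_lintegral_ofReal (integrableOn_exp hl)
    (Eventually.of_forall fun t => (Real.exp_pos _).le)]
  congr 1
  have := integral_exp_mul_Ioi (neg_lt_zero.2 hl) 0
  simp only [neg_mul, mul_zero, Real.exp_zero] at this
  rw [this]; field_simp

lemma enorm_exp_mul (l t : ℝ) (z : ℂ) :
    ‖(Real.exp (-(l * t)) : ℂ) * z‖ₑ = expWeight l t * ‖z‖ₑ := by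
  rw [enorm_mul, expWeight, ← Real.enorm_eq_ofReal (Real.exp_pos _).le, ← ofReal_norm (_ : ℂ),
    Complex.norm_real, ofReal_norm]

/-- Cauchy-Schwarz with respect to the exponential weight. -/
lemma lintegral_expWeight_mul_sq_le {l : ℝ} (hl : 0 < l) {f : ℝ → ℝ≥0∞} (hf : Measurable f) :
    (∫⁻ t in Ioi (0 : ℝ), expWeight l t * f t) ^ 2
      ≤ ENNReal.ofReal (1 / l) * ∫⁻ t in Ioi (0 : ℝ), expWeight l t * f t ^ 2 := by
  -- The weight is split as e^{-lt} = e^{-lt/2} · e^{-lt/2}, one half going to each factor.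
  have h := ENNReal.lintegral_mul_le_Lp_mul_Lq (volume.restrict (Ioi (0 : ℝ)))
    (Real.HolderConjugate.two_two)
    (f := fun t => expWeight (l / 2) t) (g := fun t => expWeight (l / 2) t * f t)
    (measurable_expWeight _).aemeasurable ((measurable_expWeight _).mul hf).aemeasurable
  have hw : ∀ t, expWeight (l / 2) t ^ 2 = expWeight l t := by
    intro t
    rw [expWeight, ← ENNReal.ofReal_pow (Real.exp_pos _).le, ← Real.exp_nat_mul, expWeight]
    congr 2; push_cast; ring
  have h1 : ∀ t, ((fun t => expWeight (l / 2) t) * fun t => expWeight (l / 2) t * f t) t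
      = expWeight l t * f t := by
    intro t
    rw [Pi.mul_apply, ← mul_assoc, ← sq, hw]
  simp only [h1, ENNReal.rpow_two, mul_pow, hw, lintegral_expWeight hl] at h
  refine (pow_le_pow_left' h 2).trans_eq ?_
  rw [mul_pow, ← ENNReal.rpow_two, ← ENNReal.rpow_two, ← ENNReal.rpow_mul, ← ENNReal.rpow_mul]
  norm_num

lemma measurable_line {ζ : Config → ℂ} (hζ : Measurable ζ) (x v : Config) :
    Measurable fun t : ℝ => ζ (x - t • v) := hζ.comp (by fun_prop)

lemma enorm_resolv_sq_le {l : ℝ} (hl : 0 < l) (v : Config) {ζ : Config → ℂ} (hζ : Measurable ζ)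
    (x : Config) : ‖resolv l v ζ x‖ₑ ^ 2
      ≤ ENNReal.ofReal (1 / l) * ∫⁻ t in Ioi (0 : ℝ), expWeight l t * ‖ζ (x - t • v)‖ₑ ^ 2 := by
  refine (pow_le_pow_left' (enorm_integral_le_lintegral_enorm _) 2).trans ?_
  simp only [enorm_exp_mul]
  exact lintegral_expWeight_mul_sq_le hl (measurable_line hζ x v).enorm

lemma integrable_line {l : ℝ} (hl : 0 < l) {v : Config} {ζ : Config → ℂ} (hζ : Measurable ζ)
    {x : Config} (hx : ∫⁻ t in Ioi (0 : ℝ), expWeight l t * ‖ζ (x - t • v)‖ₑ ^ 2 ≠ ⊤) :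
    IntegrableOn (fun t => (Real.exp (-(l * t)) : ℂ) * ζ (x - t • v)) (Ioi 0) := by
  refine ⟨?_, ?_⟩
  · exact (Measurable.mul (by fun_prop) (measurable_line hζ x v)).aestronglyMeasurable
  · rw [hasFiniteIntegral_iff_enorm]
    simp only [enorm_exp_mul]
    have := (lintegral_expWeight_mul_sq_le hl (measurable_line hζ x v).enorm).trans_lt
      (ENNReal.mul_lt_top ENNReal.ofReal_lt_top (lt_top_iff_ne_top.2 hx))
    by_contra hc
    rw [not_lt, top_le_iff] at hc
    rw [hc] at this
    simp at this

lemma resolv_sub {l : ℝ} (hl : 0 < l) {v : Config} {ζ ξ : Config → ℂ} (hζ : Measurable ζ)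
    (hξ : Measurable ξ) {x : Config}
    (hx : ∫⁻ t in Ioi (0 : ℝ), expWeight l t * ‖ζ (x - t • v)‖ₑ ^ 2 ≠ ⊤)
    (hx' : ∫⁻ t in Ioi (0 : ℝ), expWeight l t * ‖ξ (x - t • v)‖ₑ ^ 2 ≠ ⊤) :
    resolv l v (fun y => ζ y - ξ y) x = resolv l v ζ x - resolv l v ξ x := by
  simp only [resolv]
  rw [← integral_sub (integrable_line hl hζ hx) (integrable_line hl hξ hx')]
  simp only [mul_sub]

lemma measurable_resolv (l : ℝ) (v : Config) {ζ : Config → ℂ} (hζ : Measurable ζ) :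
    Measurable (resolv l v ζ) := by
  refine StronglyMeasurable.measurable ?_
  refine StronglyMeasurable.integral_prod_right
    (f := fun x t => (Real.exp (-(l * t)) : ℂ) * ζ (x - t • v)) ?_
  refine Measurable.stronglyMeasurable ?_
  exact Measurable.mul (by fun_prop) (hζ.comp (by fun_prop))

lemma measurable_kernel (l : ℝ) (v : Config) {ζ : Config → ℂ} (hζ : Measurable ζ) :
    Measurable fun p : Config × ℝ => expWeight l p.2 * ‖ζ (p.1 - p.2 • v)‖ₑ ^ 2 :=
  ((measurable_expWeight l).comp measurable_snd).mul
    ((hζ.comp (by fun_prop)).enorm.pow_const 2)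

/-- The measure is left general: Lebesgue measure serves for the crude L² bound, and its restriction
to `S1` for the energy inequality, where mass outside `S1` must not be counted. -/
lemma setLIntegral_resolv_le {l : ℝ} (hl : 0 < l) (v : Config) {ζ : Config → ℂ}
    (hζ : Measurable ζ) (ν : Measure Config) [SFinite ν] :
    ∫⁻ x, ‖resolv l v ζ x‖ₑ ^ 2 ∂ν ≤ ENNReal.ofReal (1 / l) *
      ∫⁻ t in Ioi (0 : ℝ), expWeight l t * ∫⁻ x, ‖ζ (x - t • v)‖ₑ ^ 2 ∂ν := by
  refine (lintegral_mono fun x => enorm_resolv_sq_le hl v hζ x).trans_eq ?_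
  rw [lintegral_const_mul' _ _ ENNReal.ofReal_ne_top,
    lintegral_lintegral_swap (measurable_kernel l v hζ).aemeasurable]
  congr 1
  exact lintegral_congr fun t => lintegral_const_mul' _ _ (expWeight_ne_top l t)

lemma lintegral_translate (f : Config → ℝ≥0∞) (w : Config) :
    ∫⁻ x, f (x - w) = ∫⁻ x, f x := lintegral_sub_right_eq_self f w

lemma lintegral_resolv_le {l : ℝ} (hl : 0 < l) (v : Config) {ζ : Config → ℂ}
    (hζ : Measurable ζ) :
    ∫⁻ x, ‖resolv l v ζ x‖ₑ ^ 2 ≤ ENNReal.ofReal (1 / l) * (ENNReal.ofReal (1 / l) *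
      ∫⁻ x, ‖ζ x‖ₑ ^ 2) := by
  refine (setLIntegral_resolv_le hl v hζ volume).trans_eq ?_
  congr 1
  simp only [lintegral_translate (fun x => ‖ζ x‖ₑ ^ 2)]
  rw [lintegral_mul_const _ (measurable_expWeight l), lintegral_expWeight hl]

lemma lintegral_kernel {l : ℝ} (hl : 0 < l) (v : Config) {ζ : Config → ℂ} (hζ : Measurable ζ) :
    ∫⁻ x, ∫⁻ t in Ioi (0 : ℝ), expWeight l t * ‖ζ (x - t • v)‖ₑ ^ 2
      = ENNReal.ofReal (1 / l) * ∫⁻ x, ‖ζ x‖ₑ ^ 2 := by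
  rw [lintegral_lintegral_swap (measurable_kernel l v hζ).aemeasurable]
  simp only [lintegral_const_mul' _ _ (expWeight_ne_top l _),
    lintegral_translate (fun x => ‖ζ x‖ₑ ^ 2)]
  rw [lintegral_mul_const _ (measurable_expWeight l), lintegral_expWeight hl]

/-- The integral defining the resolvent converges only almost everywhere; this is the condition
under which `resolv_sub` applies. -/
lemma ae_kernel_ne_top {l : ℝ} (hl : 0 < l) (v : Config) {ζ : Config → ℂ} (hζ : Measurable ζ)
    (h2 : ∫⁻ x, ‖ζ x‖ₑ ^ 2 ≠ ⊤) :
    ∀ᵐ x, ∫⁻ t in Ioi (0 : ℝ), expWeight l t * ‖ζ (x - t • v)‖ₑ ^ 2 ≠ ⊤ := by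
  have := ae_lt_top (measurable_kernel l v hζ).lintegral_prod_right'
    (by rw [lintegral_kernel hl v hζ]; exact ENNReal.mul_ne_top ENNReal.ofReal_ne_top h2)
  exact this.mono fun x hx => hx.ne

/-! ### The weak equation for the resolvent -/

lemma enorm_mul_le_sq_add (a b : ℝ≥0∞) : a * b ≤ a ^ 2 + b ^ 2 := by
  rcases le_total a b with h | h
  · calc a * b ≤ b * b := mul_le_mul_left h b
      _ ≤ a ^ 2 + b ^ 2 := by rw [← sq]; exact le_add_self
  · calc a * b ≤ a * a := mul_le_mul_right h a
      _ ≤ a ^ 2 + b ^ 2 := by rw [← sq]; exact le_self_add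

lemma integrable_kernel_mul {l : ℝ} (hl : 0 < l) (v : Config) {ζ ρ : Config → ℂ}
    (hζ : Measurable ζ) (hρ : Measurable ρ) (h2 : ∫⁻ x, ‖ζ x‖ₑ ^ 2 ≠ ⊤)
    (h2' : ∫⁻ x, ‖ρ x‖ₑ ^ 2 ≠ ⊤) :
    Integrable (fun p : Config × ℝ =>
      (Real.exp (-(l * p.2)) : ℂ) * (ζ (p.1 - p.2 • v) * ρ p.1))
      (volume.prod (volume.restrict (Ioi (0 : ℝ)))) := by
  have hm : Measurable (fun p : Config × ℝ =>
      (Real.exp (-(l * p.2)) : ℂ) * (ζ (p.1 - p.2 • v) * ρ p.1)) :=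
    Measurable.mul (by fun_prop) ((hζ.comp (by fun_prop)).mul (hρ.comp (by fun_prop)))
  refine ⟨hm.aestronglyMeasurable, ?_⟩
  rw [hasFiniteIntegral_iff_enorm, lintegral_prod _ hm.enorm.aemeasurable]
  have hb : ∀ x : Config, ∀ t : ℝ,
      ‖(Real.exp (-(l * t)) : ℂ) * (ζ (x - t • v) * ρ x)‖ₑ
        ≤ expWeight l t * ‖ζ (x - t • v)‖ₑ ^ 2 + expWeight l t * ‖ρ x‖ₑ ^ 2 := by
    intro x t
    rw [enorm_exp_mul, enorm_mul, ← mul_add]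
    exact mul_le_mul_right (enorm_mul_le_sq_add _ _) _
  refine (lintegral_mono fun x => lintegral_mono fun t => hb x t).trans_lt ?_
  have hk : ∀ x, Measurable fun t => expWeight l t * ‖ζ (x - t • v)‖ₑ ^ 2 := fun x =>
    (measurable_kernel l v hζ).comp measurable_prodMk_left
  simp only [lintegral_add_left (hk _), lintegral_mul_const _ (measurable_expWeight l),
    lintegral_expWeight hl]
  rw [lintegral_add_left (measurable_kernel l v hζ).lintegral_prod_right', lintegral_kernel hl v hζ,
    lintegral_const_mul' _ _ ENNReal.ofReal_ne_top]
  exact ENNReal.add_lt_top.2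
    ⟨ENNReal.mul_lt_top ENNReal.ofReal_lt_top (lt_top_iff_ne_top.2 h2),
      ENNReal.mul_lt_top ENNReal.ofReal_lt_top (lt_top_iff_ne_top.2 h2')⟩

lemma hasDerivAt_line {φ : Config → ℂ} (hφ : ContDiff ℝ ∞ φ) (x v : Config) (t : ℝ) :
    HasDerivAt (fun s : ℝ => φ (x + s • v)) (fderiv ℝ φ (x + t • v) v) t := by
  have h1 : HasDerivAt (fun s : ℝ => x + s • v) v t := by
    simpa using ((hasDerivAt_id t).smul_const v).const_add x
  exact (hφ.differentiable (by simp) _).hasFDerivAt.comp_hasDerivAt t h1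

lemma exists_norm_le {F : Type*} [NormedAddCommGroup F] {f : Config → F} (hf : Continuous f)
    (hc : HasCompactSupport f) : ∃ C, ∀ x, ‖f x‖ ≤ C := by
  obtain ⟨C, hC⟩ := hc.exists_bound_of_continuousOn hf.continuousOn
  refine ⟨max C 0, fun x => ?_⟩
  by_cases hx : x ∈ tsupport f
  · exact (hC x hx).trans (le_max_left _ _)
  · rw [image_eq_zero_of_notMem_tsupport hx, norm_zero]; exact le_max_right _ _

/-- The integrand is the derivative of -e^{-lt} φ(x + tv), which tends to 0 at infinity and equals
-φ(x) at t = 0. -/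
lemma integral_exp_line {l : ℝ} (hl : 0 < l) (v : Config) {φ : Config → ℂ}
    (hφ : ContDiff ℝ ∞ φ) (hc : HasCompactSupport φ) (x : Config) :
    ∫ t in Ioi (0 : ℝ), (Real.exp (-(l * t)) : ℂ) *
      (l * φ (x + t • v) - fderiv ℝ φ (x + t • v) v) = φ x := by
  have hcd : Continuous fun y => fderiv ℝ φ y v :=
    (hφ.continuous_fderiv (by simp)).clm_apply continuous_const
  have hD : ∀ t : ℝ, HasDerivAt (fun t : ℝ => -((Real.exp (-(l * t)) : ℂ) * φ (x + t • v)))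
      ((Real.exp (-(l * t)) : ℂ) * (l * φ (x + t • v) - fderiv ℝ φ (x + t • v) v)) t := by
    intro t
    have h1 : HasDerivAt (fun t : ℝ => Real.exp (-(l * t))) (Real.exp (-(l * t)) * (-l)) t := by
      have := ((hasDerivAt_id t).const_mul l).neg.exp
      simpa using this
    have h2 := (h1.ofReal_comp.mul (hasDerivAt_line hφ x v t)).neg
    refine h2.congr_deriv ?_
    push_cast; ring
  obtain ⟨C, hC⟩ := exists_norm_le hφ.continuous hc
  obtain ⟨C', hC'⟩ := exists_norm_le hcd (hc.fderiv_apply ℝ v)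
  have hline : Continuous fun t : ℝ => x + t • v := by fun_prop
  have hint : IntegrableOn (fun t : ℝ => (Real.exp (-(l * t)) : ℂ) *
      (l * φ (x + t • v) - fderiv ℝ φ (x + t • v) v)) (Ioi 0) := by
    refine Integrable.mul_bdd (c := |l| * C + C') (integrableOn_exp hl).ofReal ?_ ?_
    · exact ((continuous_const.mul (hφ.continuous.comp hline)).sub
        (hcd.comp hline)).aestronglyMeasurable
    · refine Eventually.of_forall fun t => (norm_sub_le _ _).trans (add_le_add ?_ (hC' _))
      rw [norm_mul, Complex.norm_real, Real.norm_eq_abs]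
      exact mul_le_mul_of_nonneg_left (hC _) (abs_nonneg _)
  have hlim : Tendsto (fun t : ℝ => -((Real.exp (-(l * t)) : ℂ) * φ (x + t • v))) atTop (𝓝 0) := by
    have h0 : Tendsto (fun t : ℝ => Real.exp (-(l * t)) * C) atTop (𝓝 0) := by
      have := (Real.tendsto_exp_neg_atTop_nhds_zero.comp
        (tendsto_id.const_mul_atTop hl)).mul_const C
      simpa using this
    refine squeeze_zero_norm (fun t => ?_) h0
    rw [norm_neg, norm_mul, Complex.norm_real, Real.norm_eq_abs, abs_of_pos (Real.exp_pos _)]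
    exact mul_le_mul_of_nonneg_left (hC _) (Real.exp_pos _).le
  rw [integral_Ioi_of_hasDerivAt_of_tendsto' (fun t _ => hD t) hint hlim]
  simp

lemma lintegral_enorm_sq_ne_top {f : Config → ℂ} (hf : Continuous f) (hc : HasCompactSupport f) :
    ∫⁻ x, ‖f x‖ₑ ^ 2 ≠ ⊤ := by
  have := (hf.memLp_of_hasCompactSupport (p := 2) (μ := volume) hc).eLpNorm_lt_top
  have h2 := (eLpNorm_lt_top_iff_lintegral_rpow_enorm_lt_top two_ne_zero ENNReal.ofNat_ne_top).1
    this
  simpa using h2.ne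

/-- `(l + v·∇) resolv l v ζ = ζ` in the sense of distributions. -/
lemma integral_conj_resolv_mul {l : ℝ} (hl : 0 < l) (v : Config) {ζ φ : Config → ℂ}
    (hζ : Measurable ζ) (h2 : ∫⁻ x, ‖ζ x‖ₑ ^ 2 ≠ ⊤) (hφ : ContDiff ℝ ∞ φ)
    (hc : HasCompactSupport φ) :
    ∫ x, (starRingEnd ℂ) (resolv l v ζ x) * (l * φ x - fderiv ℝ φ x v)
      = ∫ x, (starRingEnd ℂ) (ζ x) * φ x := by
  have hcd : Continuous fun y => fderiv ℝ φ y v :=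
    (hφ.continuous_fderiv (by simp)).clm_apply continuous_const
  set ρ : Config → ℂ := fun x => l * φ x - fderiv ℝ φ x v with hρ
  have hρc : Continuous ρ := (continuous_const.mul hφ.continuous).sub hcd
  have hρs : HasCompactSupport ρ := (hc.mul_left).sub (hc.fderiv_apply ℝ v)
  have hρ2 := lintegral_enorm_sq_ne_top hρc hρs
  have hζc : Measurable fun x => (starRingEnd ℂ) (ζ x) :=
    Complex.continuous_conj.measurable.comp hζ
  have hζ2 : ∫⁻ x, ‖(starRingEnd ℂ) (ζ x)‖ₑ ^ 2 ≠ ⊤ := by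
    simpa only [RCLike.enorm_conj] using h2
  calc ∫ x, (starRingEnd ℂ) (resolv l v ζ x) * ρ x
      = ∫ x, ∫ t in Ioi (0 : ℝ),
          (Real.exp (-(l * t)) : ℂ) * ((starRingEnd ℂ) (ζ (x - t • v)) * ρ x) := by
        refine integral_congr_ae (Eventually.of_forall fun x => ?_)
        simp only [resolv, ← integral_conj, map_mul, Complex.conj_ofReal]
        rw [← integral_mul_const]
        simp only [mul_assoc]
    _ = ∫ t in Ioi (0 : ℝ), ∫ x,
          (Real.exp (-(l * t)) : ℂ) * ((starRingEnd ℂ) (ζ (x - t • v)) * ρ x) :=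
        integral_integral_swap (integrable_kernel_mul hl v hζc hρc.measurable hζ2 hρ2)
    _ = ∫ t in Ioi (0 : ℝ), ∫ x,
          (Real.exp (-(l * t)) : ℂ) * (ρ (x - t • (-v)) * (starRingEnd ℂ) (ζ x)) := by
        refine integral_congr_ae (Eventually.of_forall fun t => ?_)
        simp only
        -- Translation by tv moves the flow from the source to the test function and reverses its
        -- velocity.
        rw [← integral_add_right_eq_self _ (t • v)]
        simp only [add_sub_cancel_right, smul_neg, sub_neg_eq_add, mul_comm]
    _ = ∫ x, ∫ t in Ioi (0 : ℝ),
          (Real.exp (-(l * t)) : ℂ) * (ρ (x - t • (-v)) * (starRingEnd ℂ) (ζ x)) :=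
        (integral_integral_swap
          (integrable_kernel_mul hl (-v) hρc.measurable hζc hρ2 hζ2)).symm
    _ = ∫ x, (starRingEnd ℂ) (ζ x) * φ x := by
        refine integral_congr_ae (Eventually.of_forall fun x => ?_)
        simp only [← mul_assoc, smul_neg, sub_neg_eq_add]
        rw [integral_mul_const, integral_exp_line hl v hφ hc, mul_comm]

/-! ### Boundary traces of the resolvent -/

lemma lintegral_sq_eq_eLpNorm {α : Type*} [MeasurableSpace α] {F : Type*} [NormedAddCommGroup F]
    (ν : Measure α) (f : α → F) : ∫⁻ x, ‖f x‖ₑ ^ 2 ∂ν = eLpNorm f 2 ν ^ 2 := by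
  have := eLpNorm_nnreal_pow_eq_lintegral (f := f) (μ := ν) (p := 2) two_ne_zero
  simpa using this.symm

lemma memLp_two_of_lintegral {α : Type*} [MeasurableSpace α] {F : Type*} [NormedAddCommGroup F]
    {ν : Measure α} {f : α → F} (hm : AEStronglyMeasurable f ν)
    (h : ∫⁻ x, ‖f x‖ₑ ^ 2 ∂ν ≠ ⊤) : MemLp f 2 ν := by
  refine ⟨hm, ?_⟩
  rw [lintegral_sq_eq_eLpNorm] at h
  by_contra hc
  rw [not_lt, top_le_iff] at hc
  simp [hc] at h

/-- A linear change of variables scales Lebesgue measure. Only finiteness of the factors is needed,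
so the determinant is never computed. -/
lemma exists_lintegral_comp_equiv (E : (ℝ × (ℝ × ℝ)) ≃L[ℝ] Config) :
    (∃ c : ℝ≥0∞, c ≠ ⊤ ∧ ∀ F : Config → ℝ≥0∞, Measurable F → ∫⁻ p, F (E p) = c * ∫⁻ x, F x) ∧
    ∃ c : ℝ≥0∞, c ≠ ⊤ ∧ ∀ F : Config → ℝ≥0∞, Measurable F → ∫⁻ x, F x = c * ∫⁻ p, F (E p) := by
  have i1 : (volume : Measure (ℝ × ℝ)).IsAddHaarMeasure := by
    rw [Measure.volume_eq_prod]; infer_instance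
  have i2 : (volume : Measure (ℝ × (ℝ × ℝ))).IsAddHaarMeasure := by
    rw [Measure.volume_eq_prod]; infer_instance
  have hE : (volume.map E).IsAddHaarMeasure := E.isAddHaarMeasure_map volume
  have h1 := Measure.isAddLeftInvariant_eq_smul (volume.map E) (volume : Measure Config)
  have h2 := Measure.isAddLeftInvariant_eq_smul (volume : Measure Config) (volume.map E)
  refine ⟨⟨Measure.addHaarScalarFactor (volume.map E) volume, ENNReal.coe_ne_top,
    fun F hF => ?_⟩, ⟨Measure.addHaarScalarFactor volume (volume.map E), ENNReal.coe_ne_top,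
    fun F hF => ?_⟩⟩
  · rw [← lintegral_map hF E.continuous.measurable]
    exact (congrArg (fun ν => ∫⁻ x, F x ∂ν) h1).trans (lintegral_smul_measure _ _)
  · rw [← lintegral_map hF E.continuous.measurable]
    exact (congrArg (fun ν => ∫⁻ x, F x ∂ν) h2).trans (lintegral_smul_measure _ _)

/-- Since v is transversal to the slices, (t, q) ↦ e(h, q) - tv is a linear change of variables up
to a translation depending on h. Its Jacobian is independent of h, so the bound is uniform over all
slices. -/
lemma exists_slice_bound (e : (ℝ × (ℝ × ℝ)) ≃L[ℝ] Config) {v : Config} (hv : (e.symm v).1 ≠ 0) :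
    ∃ c : ℝ≥0∞, c ≠ ⊤ ∧ ∀ (l : ℝ), 0 < l → ∀ (ζ : Config → ℂ), Measurable ζ → ∀ h : ℝ,
      ∫⁻ q, ∫⁻ t in Ioi (0 : ℝ), expWeight l t * ‖ζ (e (h, q) - t • v)‖ₑ ^ 2
        ≤ c * ∫⁻ x, ‖ζ x‖ₑ ^ 2 := by
  let L : ℝ × (ℝ × ℝ) →ₗ[ℝ] Config :=
    e.toLinearEquiv.toLinearMap ∘ₗ LinearMap.inr ℝ ℝ (ℝ × ℝ) ∘ₗ LinearMap.snd ℝ ℝ (ℝ × ℝ)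
      - (LinearMap.fst ℝ ℝ (ℝ × ℝ)).smulRight v
  have hLapp : ∀ t q, L (t, q) = e (0, q) - t • v := fun _ _ => rfl
  have hL : Function.Surjective L := by
    intro x
    obtain ⟨y, rfl⟩ := e.surjective x
    -- The time t is fixed by matching the first face coordinate, where division by the transversal
    -- speed is possible; the remaining coordinates then determine q.
    refine ⟨(-(y.1 / (e.symm v).1), y.2 - (y.1 / (e.symm v).1) • (e.symm v).2), ?_⟩
    apply e.symm.injective
    rw [hLapp, map_sub, map_smul, e.symm_apply_apply, e.symm_apply_apply]
    ext
    · simp [hv]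
    · simp
    · simp
  have hinj : Function.Injective L := by
    refine (LinearMap.injective_iff_surjective_of_finrank_eq_finrank ?_).2 hL
    simp
  let E : (ℝ × (ℝ × ℝ)) ≃L[ℝ] Config :=
    (LinearEquiv.ofBijective L ⟨hinj, hL⟩).toContinuousLinearEquiv
  obtain ⟨⟨c, hc, hcE⟩, -⟩ := exists_lintegral_comp_equiv E
  refine ⟨c, hc, fun l hl ζ hζ h => ?_⟩
  have hF : Measurable fun x => ‖ζ (x + e (h, 0))‖ₑ ^ 2 := (hζ.comp (by fun_prop)).enorm.pow_const 2
  have hmeas : Measurable fun p : (ℝ × ℝ) × ℝ => ‖ζ (e (h, p.1) - p.2 • v)‖ₑ ^ 2 := by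
    refine ((hζ.comp ?_).enorm.pow_const 2)
    exact ((e.continuous.comp (by fun_prop)).sub (by fun_prop)).measurable
  calc ∫⁻ q, ∫⁻ t in Ioi (0 : ℝ), expWeight l t * ‖ζ (e (h, q) - t • v)‖ₑ ^ 2
      ≤ ∫⁻ q, ∫⁻ t, ‖ζ (e (h, q) - t • v)‖ₑ ^ 2 := by
        refine lintegral_mono fun q => ?_
        refine (setLIntegral_mono (hmeas.comp measurable_prodMk_left) fun t ht => ?_).trans
          (setLIntegral_le_lintegral _ _)
        refine mul_le_of_le_one_left zero_le ?_
        rw [expWeight, ENNReal.ofReal_le_one, Real.exp_le_one_iff]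
        have : 0 < l * t := mul_pos hl ht
        linarith
    _ = ∫⁻ t, ∫⁻ q, ‖ζ (e (h, q) - t • v)‖ₑ ^ 2 := lintegral_lintegral_swap hmeas.aemeasurable
    _ = ∫⁻ p : ℝ × (ℝ × ℝ), ‖ζ (E p + e (h, 0))‖ₑ ^ 2 := by
        refine Eq.trans ?_ (lintegral_prod (μ := volume) (ν := volume) _
          (hF.comp E.continuous.measurable).aemeasurable).symm
        refine lintegral_congr fun t => lintegral_congr fun q => ?_
        have : E (t, q) + e (h, 0) = e (h, q) - t • v := by
          change L (t, q) + _ = _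
          rw [hLapp, sub_add_eq_add_sub, ← map_add]
          simp
        rw [← this]
        rfl
    _ = _ := by
        rw [hcE _ hF, lintegral_add_right_eq_self (fun x => ‖ζ x‖ₑ ^ 2) (e (h, 0))]

lemma continuous_resolv {l : ℝ} (hl : 0 < l) (v : Config) {ζ : Config → ℂ} (hζ : Continuous ζ)
    (hc : HasCompactSupport ζ) : Continuous (resolv l v ζ) := by
  obtain ⟨C, hC⟩ := exists_norm_le hζ hc
  refine continuous_of_dominated (bound := fun t => Real.exp (-(l * t)) * C) (fun x => ?_)
    (fun x => Eventually.of_forall fun t => ?_) ((integrableOn_exp hl).mul_const C)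
    (Eventually.of_forall fun t => ?_)
  · exact (Measurable.mul (by fun_prop) (measurable_line hζ.measurable x v)).aestronglyMeasurable
  · rw [norm_mul, Complex.norm_real, Real.norm_eq_abs, abs_of_pos (Real.exp_pos _)]
    exact mul_le_mul_of_nonneg_left (hC _) (Real.exp_pos _).le
  · exact continuous_const.mul (hζ.comp (by fun_prop))

lemma sq_enorm_sub_le (a b c d : ℂ) :
    ‖a - d‖ₑ ^ 2 ≤ 3 * (‖a - b‖ₑ ^ 2 + ‖b - c‖ₑ ^ 2 + ‖d - c‖ₑ ^ 2) := by
  have h : ‖a - d‖ ^ 2 ≤ 3 * (‖a - b‖ ^ 2 + ‖b - c‖ ^ 2 + ‖d - c‖ ^ 2) := by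
    have h1 : ‖a - d‖ ≤ ‖a - b‖ + ‖b - c‖ + ‖d - c‖ := by
      have e : a - d = (a - b) + (b - c) - (d - c) := by ring
      rw [e]
      exact (norm_sub_le _ _).trans (add_le_add_left (norm_add_le _ _) _)
    have h2 := pow_le_pow_left₀ (norm_nonneg _) h1 2
    nlinarith [sq_nonneg (‖a - b‖ - ‖b - c‖), sq_nonneg (‖a - b‖ - ‖d - c‖),
      sq_nonneg (‖b - c‖ - ‖d - c‖)]
  have h3 := ENNReal.ofReal_le_ofReal h
  rw [ENNReal.ofReal_mul (by norm_num), ENNReal.ofReal_add (by positivity) (by positivity),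
    ENNReal.ofReal_add (by positivity) (by positivity)] at h3
  simpa [ENNReal.ofReal_pow, ofReal_norm] using h3

/-- For a continuous compactly supported source the resolvent is continuous and its slices converge
uniformly on K. The uniform slice bound extends this to L² sources by approximation. -/
lemma IsFace.hasTrace_resolv {e : (ℝ × (ℝ × ℝ)) ≃L[ℝ] Config} {σ : ℝ → ℝ × ℝ → Config}
    (he : IsFace e σ) {v : Config} (hv : (e.symm v).1 ≠ 0) {l : ℝ} (hl : 0 < l) {ζ : Config → ℂ}
    (hζ : Measurable ζ) (h2 : ∫⁻ x, ‖ζ x‖ₑ ^ 2 ≠ ⊤) :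
    HasTrace σ (resolv l v ζ) (fun q => resolv l v ζ (σ 0 q)) := by
  obtain ⟨c, hc, hbound⟩ := exists_slice_bound e hv
  have hσ : σ = fun h q => e (h, q) := by ext1 h; ext1 q; exact he.apply h q
  subst hσ
  have hw := measurable_resolv l v hζ
  refine ⟨(hw.comp (e.continuous.comp (by fun_prop)).measurable).aestronglyMeasurable,
    fun K hK _ => ?_⟩
  set D : ℝ≥0∞ := ENNReal.ofReal (1 / l) * c with hD
  have hDtop : D ≠ ⊤ := ENNReal.mul_ne_top ENNReal.ofReal_ne_top hc
  have hslice : ∀ ξ : Config → ℂ, Measurable ξ → ∫⁻ x, ‖ξ x‖ₑ ^ 2 ≠ ⊤ → ∀ h : ℝ,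
      ∫⁻ q, ‖resolv l v ζ (e (h, q)) - resolv l v ξ (e (h, q))‖ₑ ^ 2
        ≤ D * ∫⁻ x, ‖ζ x - ξ x‖ₑ ^ 2 := by
    intro ξ hξ hξ2 h
    -- A slice is a null set, so convergence of the defining integral almost everywhere in space is
    -- not enough; the slice bound gives it almost everywhere on each slice.
    have hfin : ∀ χ : Config → ℂ, Measurable χ → ∫⁻ x, ‖χ x‖ₑ ^ 2 ≠ ⊤ → ∀ᵐ q : ℝ × ℝ,
        ∫⁻ t in Ioi (0 : ℝ), expWeight l t * ‖χ (e (h, q) - t • v)‖ₑ ^ 2 ≠ ⊤ := by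
      intro χ hχ hχ2
      refine (ae_lt_top ?_ ((hbound l hl χ hχ h).trans_lt (ENNReal.mul_lt_top
        (lt_top_iff_ne_top.2 hc) (lt_top_iff_ne_top.2 hχ2))).ne).mono fun q hq => hq.ne
      exact (measurable_kernel l v hχ).lintegral_prod_right'.comp
        (e.continuous.comp (by fun_prop)).measurable
    calc ∫⁻ q, ‖resolv l v ζ (e (h, q)) - resolv l v ξ (e (h, q))‖ₑ ^ 2
        = ∫⁻ q, ‖resolv l v (fun y => ζ y - ξ y) (e (h, q))‖ₑ ^ 2 := by
          refine lintegral_congr_ae ?_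
          filter_upwards [hfin ζ hζ h2, hfin ξ hξ hξ2] with q h1 h2
          rw [resolv_sub hl hζ hξ h1 h2]
      _ ≤ ∫⁻ q, ENNReal.ofReal (1 / l) * ∫⁻ t in Ioi (0 : ℝ),
            expWeight l t * ‖ζ (e (h, q) - t • v) - ξ (e (h, q) - t • v)‖ₑ ^ 2 :=
          lintegral_mono fun q => enorm_resolv_sq_le hl v (hζ.sub hξ) _
      _ ≤ D * ∫⁻ x, ‖ζ x - ξ x‖ₑ ^ 2 := by
          rw [lintegral_const_mul' _ _ ENNReal.ofReal_ne_top, hD, mul_assoc]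
          exact mul_le_mul_right (hbound l hl _ (hζ.sub hξ) h) _
  rw [ENNReal.tendsto_nhds_zero]
  intro ε hε
  have hKtop : volume K ≠ ⊤ := hK.measure_ne_top
  -- The constant collects the three errors: approximation at height s, uniform continuity on K, and
  -- approximation at height 0. The 3 is from squaring a sum of three terms. Below, δ' only converts
  -- the bound on the norm into one on its square.
  obtain ⟨δ, hδ, hδε⟩ := ENNReal.exists_nnreal_pos_mul_lt
    (a := 3 * (D + volume K + D)) (b := ε) (by finiteness) hε.ne'
  obtain ⟨δ', hδ', hδ'δ⟩ : ∃ δ' : ℝ≥0∞, δ' ≠ 0 ∧ δ' ^ 2 ≤ δ := by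
    refine ⟨min 1 δ, by simp [hδ.ne'], ?_⟩
    calc (min 1 (δ : ℝ≥0∞)) ^ 2 = min 1 (δ : ℝ≥0∞) * min 1 (δ : ℝ≥0∞) := sq _
      _ ≤ 1 * δ := mul_le_mul' (min_le_left _ _) (min_le_right _ _)
      _ = δ := one_mul _
  obtain ⟨ξ, hξc, hξε, hξ, hξm⟩ := (memLp_two_of_lintegral hζ.aestronglyMeasurable
    h2).exists_hasCompactSupport_eLpNorm_sub_le ENNReal.ofNat_ne_top hδ'
  have hξδ : ∫⁻ x, ‖ζ x - ξ x‖ₑ ^ 2 ≤ δ := by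
    have := lintegral_sq_eq_eLpNorm volume (ζ - ξ)
    simp only [Pi.sub_apply] at this
    rw [this]
    exact (pow_le_pow_left' hξε 2).trans hδ'δ
  have hξ2 := lintegral_enorm_sq_ne_top hξ hξc
  have hcont := continuous_resolv hl v hξ hξc
  have hunif : ∀ᶠ s : ℝ in 𝓝 0, ∀ q ∈ K,
      ‖resolv l v ξ (e (s, q)) - resolv l v ξ (e (0, q))‖ₑ ^ 2 < δ := by
    refine hK.eventually_forall_of_forall_eventually fun q _ => ?_
    have hF : Continuous fun z : ℝ × (ℝ × ℝ) =>
        ‖resolv l v ξ (e (z.1, z.2)) - resolv l v ξ (e (0, z.2))‖ₑ ^ 2 := by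
      refine ENNReal.continuous_pow 2 |>.comp (continuous_enorm.comp ?_)
      exact (hcont.comp (e.continuous.comp (by fun_prop))).sub
        (hcont.comp (e.continuous.comp (by fun_prop)))
    refine hF.continuousAt.eventually_lt_const ?_
    simpa using hδ
  obtain ⟨r, hr, hunif'⟩ := Metric.eventually_nhds_iff.1 hunif
  filter_upwards [Ioo_mem_nhdsGT hr] with h hh
  have hmeas : Measurable fun p : ℝ × (ℝ × ℝ) =>
      ‖resolv l v ζ (e (p.1, p.2)) - resolv l v ζ (e (0, p.2))‖ₑ ^ 2 :=
    ((hw.comp (e.continuous.comp (by fun_prop)).measurable).sub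
      (hw.comp (e.continuous.comp (by fun_prop)).measurable)).enorm.pow_const 2
  have hmw : ∀ s : ℝ, Measurable fun q : ℝ × ℝ => resolv l v ζ (e (s, q)) := fun s =>
    hw.comp (e.continuous.comp (by fun_prop)).measurable
  have hmx : ∀ s : ℝ, Measurable fun q : ℝ × ℝ => resolv l v ξ (e (s, q)) := fun s =>
    hcont.measurable.comp (e.continuous.comp (by fun_prop)).measurable
  have hinner : ∀ s ∈ Ioo (0 : ℝ) h,
      ∫⁻ q in K, ‖resolv l v ζ (e (s, q)) - resolv l v ζ (e (0, q))‖ₑ ^ 2 ≤ ε := by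
    intro s hs
    calc ∫⁻ q in K, ‖resolv l v ζ (e (s, q)) - resolv l v ζ (e (0, q))‖ₑ ^ 2
        ≤ ∫⁻ q in K, 3 * (‖resolv l v ζ (e (s, q)) - resolv l v ξ (e (s, q))‖ₑ ^ 2
          + ‖resolv l v ξ (e (s, q)) - resolv l v ξ (e (0, q))‖ₑ ^ 2
          + ‖resolv l v ζ (e (0, q)) - resolv l v ξ (e (0, q))‖ₑ ^ 2) :=
          lintegral_mono fun q => sq_enorm_sub_le _ _ _ _
      _ = 3 * (∫⁻ q in K, ‖resolv l v ζ (e (s, q)) - resolv l v ξ (e (s, q))‖ₑ ^ 2)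
          + 3 * (∫⁻ q in K, ‖resolv l v ξ (e (s, q)) - resolv l v ξ (e (0, q))‖ₑ ^ 2)
          + 3 * (∫⁻ q in K, ‖resolv l v ζ (e (0, q)) - resolv l v ξ (e (0, q))‖ₑ ^ 2) := by
          rw [lintegral_const_mul' _ _ (by simp), lintegral_add_right, lintegral_add_right]
          · ring
          · exact ((hmx s).sub (hmx 0)).enorm.pow_const 2
          · exact ((hmw 0).sub (hmx 0)).enorm.pow_const 2
      _ ≤ 3 * (D * δ) + 3 * (δ * volume K) + 3 * (D * δ) := by
          refine add_le_add (add_le_add (mul_le_mul_right ?_ _) (mul_le_mul_right ?_ _))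
            (mul_le_mul_right ?_ _)
          · exact (setLIntegral_le_lintegral _ _).trans ((hslice ξ hξ.measurable hξ2 s).trans
              (mul_le_mul_right hξδ _))
          · rw [← setLIntegral_const]
            refine setLIntegral_mono measurable_const fun q hq => (hunif' ?_ q hq).le
            rw [Real.dist_0_eq_abs, abs_of_pos hs.1]
            exact hs.2.trans hh.2
          · exact (setLIntegral_le_lintegral _ _).trans ((hslice ξ hξ.measurable hξ2 0).trans
              (mul_le_mul_right hξδ _))
      _ = δ * (3 * (D + volume K + D)) := by ring
      _ ≤ ε := hδε.le
  rw [Measure.volume_eq_prod, ← Measure.prod_restrict, lintegral_prod _ hmeas.aemeasurable]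
  calc (ENNReal.ofReal h)⁻¹ * ∫⁻ s in Ioo (0 : ℝ) h,
        ∫⁻ q in K, ‖resolv l v ζ (e (s, q)) - resolv l v ζ (e (0, q))‖ₑ ^ 2
      ≤ (ENNReal.ofReal h)⁻¹ * ∫⁻ s in Ioo (0 : ℝ) h, ε :=
        mul_le_mul_right (setLIntegral_mono measurable_const hinner) _
    _ = ε := by
        rw [setLIntegral_const, Real.volume_Ioo, sub_zero, mul_comm ε, ← mul_assoc,
          ENNReal.inv_mul_cancel (by simpa using hh.1) ENNReal.ofReal_ne_top, one_mul]

/-! ### Uniqueness for the transport equation -/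

lemma sq_lintegral_le {α : Type*} [MeasurableSpace α] (ν : Measure α) {f : α → ℝ≥0∞}
    (hf : AEMeasurable f ν) : (∫⁻ x, f x ∂ν) ^ 2 ≤ ν univ * ∫⁻ x, f x ^ 2 ∂ν := by
  have h := ENNReal.lintegral_mul_le_Lp_mul_Lq ν (Real.HolderConjugate.two_two)
    (f := fun _ => 1) (g := f) aemeasurable_const hf
  simp only [Pi.mul_apply, one_mul, ENNReal.rpow_two, one_pow, lintegral_one] at h
  refine (pow_le_pow_left' h 2).trans_eq ?_
  rw [mul_pow, ← ENNReal.rpow_two, ← ENNReal.rpow_two, ← ENNReal.rpow_mul, ← ENNReal.rpow_mul]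
  norm_num

/-- The points from which the flow of `v` reaches `s` within time `T`. -/
def backward (v : Config) (T : ℝ) (s : Set Config) : Set Config :=
  {x | ∃ t ∈ Icc 0 T, x + t • v ∈ s}

lemma isCompact_backward (v : Config) (T : ℝ) {s : Set Config} (hs : IsCompact s) :
    IsCompact (backward v T s) := by
  have : backward v T s = (fun p : Config × ℝ => p.1 - p.2 • v) '' (s ×ˢ Icc 0 T) := by
    ext x
    constructor
    · rintro ⟨t, ht, hx⟩
      exact ⟨(x + t • v, t), ⟨hx, ht⟩, by simp⟩
    · rintro ⟨⟨y, t⟩, ⟨hy, ht⟩, rfl⟩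
      exact ⟨t, ht, by simpa using hy⟩
  rw [this]
  exact (hs.prod isCompact_Icc).image (by fun_prop)

/-- The integral is a convolution of ρ with the finite measure obtained by pushing e^{-ls} ds on (0,
T] forward to the segment -sv; smoothness follows from that of ρ. -/
lemma contDiff_integral_line (l : ℝ) (v : Config) (T : ℝ) {ρ : Config → ℂ}
    (hρ : ContDiff ℝ ∞ ρ) (hc : HasCompactSupport ρ) :
    ContDiff ℝ ∞ fun x => ∫ s in Ioc 0 T, Real.exp (-(l * s)) • ρ (x + s • v) := by
  let w : ℝ → NNReal := fun s => (Real.exp (-(l * s))).toNNReal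
  have hw : Measurable w := by fun_prop
  let ν₀ : Measure ℝ := (volume.restrict (Ioc 0 T)).withDensity fun s => w s
  have hfin : IsFiniteMeasure ν₀ := by
    refine isFiniteMeasure_withDensity ?_
    have : IntegrableOn (fun s => Real.exp (-(l * s))) (Ioc 0 T) :=
      (Continuous.integrableOn_Icc (by fun_prop)).mono_set Ioc_subset_Icc_self
    have h2 := this.2
    rw [hasFiniteIntegral_iff_enorm] at h2
    refine ne_of_lt (lt_of_le_of_lt (le_of_eq ?_) h2)
    refine lintegral_congr fun s => ?_
    rw [Real.enorm_eq_ofReal (Real.exp_pos _).le]; rfl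
  have hmap : Measurable fun s : ℝ => -(s • v) := by fun_prop
  let ν : Measure Config := ν₀.map fun s => -(s • v)
  have h1 : ContDiff ℝ ∞
      (convolution (fun _ : Config => (1 : ℝ)) ρ (ContinuousLinearMap.lsmul ℝ ℝ) ν) :=
    hc.contDiff_convolution_right _ (locallyIntegrable_const _) hρ
  convert h1 using 1
  ext x
  rw [convolution_def]
  simp only [ContinuousLinearMap.lsmul_apply, one_smul]
  have hx : Continuous fun y => ρ (x - y) := hρ.continuous.comp (by fun_prop)
  have hI : ∫ y, ρ (x - y) ∂ν = ∫ s, ρ (x - -(s • v)) ∂ν₀ :=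
    integral_map hmap.aemeasurable hx.aestronglyMeasurable
  rw [hI, integral_withDensity_eq_integral_smul hw]
  refine integral_congr_ae (Eventually.of_forall fun s => ?_)
  simp only [w, sub_neg_eq_add, NNReal.smul_def, Real.coe_toNNReal _ (Real.exp_pos _).le]

/-- Solution of the adjoint transport equation by integration over a finite time. -/
lemma exists_backward_solution (l : ℝ) (v : Config) {T : ℝ} (hT : 0 < T) {ρ : Config → ℂ}
    (hρ : ContDiff ℝ ∞ ρ) (hc : HasCompactSupport ρ) :
    ∃ φ : Config → ℂ, ContDiff ℝ ∞ φ ∧ tsupport φ ⊆ backward v T (tsupport ρ) ∧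
      ∀ x, l * φ x - fderiv ℝ φ x v = ρ x - Real.exp (-(l * T)) * ρ (x + T • v) := by
  set φ : Config → ℂ := fun x => ∫ s in Ioc 0 T, Real.exp (-(l * s)) • ρ (x + s • v) with hφ
  have hφs : ContDiff ℝ ∞ φ := contDiff_integral_line l v T hρ hc
  refine ⟨φ, hφs, ?_, fun x => ?_⟩
  · refine closure_minimal (fun x hx => ?_) (isCompact_backward v T hc).isClosed
    by_contra hn
    apply hx
    refine setIntegral_eq_zero_of_forall_eq_zero fun s hs => ?_
    have : x + s • v ∉ tsupport ρ := fun h => hn ⟨s, Ioc_subset_Icc_self hs, h⟩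
    rw [image_eq_zero_of_notMem_tsupport this, smul_zero]
  · set g : ℝ → ℂ := fun r => Real.exp (-(l * r)) • ρ (x + r • v) with hg
    have hgc : Continuous g :=
      (Real.continuous_exp.comp (by fun_prop)).smul (hρ.continuous.comp (by fun_prop))
    -- Substituting r = s + t along the flow line leaves a fixed integrand over a moving window, so
    -- the derivative comes from the fundamental theorem of calculus.
    have hval : ∀ t, φ (x + t • v) = Real.exp (l * t) • ∫ r in t..(T + t), g r := by
      intro t
      rw [hφ]
      simp only
      rw [← intervalIntegral.integral_of_le hT.le, ← intervalIntegral.integral_smul]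
      have := intervalIntegral.integral_comp_add_right (a := 0) (b := T)
        (fun r => Real.exp (l * t) • g r) t
      rw [zero_add] at this
      rw [← this]
      refine intervalIntegral.integral_congr fun s _ => ?_
      simp only [hg, smul_smul, ← Real.exp_add, add_assoc, ← add_smul]
      congr 3
      · ring
      · rw [add_comm]
    have hD : HasDerivAt (fun t : ℝ => φ (x + t • v))
        (l * φ x + (Real.exp (-(l * T)) * ρ (x + T • v) - ρ x)) 0 := by
      have hJ : HasDerivAt (fun t => ∫ r in t..(T + t), g r) (g T - g 0) 0 := by
        have e : (fun t => ∫ r in t..(T + t), g r)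
            = fun t => (∫ r in (0 : ℝ)..(T + t), g r) - ∫ r in (0 : ℝ)..t, g r := by
          ext t
          rw [intervalIntegral.integral_interval_sub_left (hgc.intervalIntegrable _ _)
            (hgc.intervalIntegrable _ _)]
        rw [e]
        have h1 : HasDerivAt (fun t => ∫ r in (0 : ℝ)..t, g r) (g (T + 0)) (T + 0) :=
          intervalIntegral.integral_hasDerivAt_right (hgc.intervalIntegrable _ _)
            (hgc.stronglyMeasurableAtFilter _ _) hgc.continuousAt
        have h2 : HasDerivAt (fun t => ∫ r in (0 : ℝ)..t, g r) (g 0) 0 :=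
          intervalIntegral.integral_hasDerivAt_right (hgc.intervalIntegrable _ _)
            (hgc.stronglyMeasurableAtFilter _ _) hgc.continuousAt
        have h3 := (h1.comp_const_add T 0).sub h2
        rw [add_zero] at h3
        exact h3
      have hE : HasDerivAt (fun t : ℝ => Real.exp (l * t)) l 0 := by
        simpa using ((hasDerivAt_id (0 : ℝ)).const_mul l).exp
      have := hE.smul hJ
      have e : (fun t : ℝ => φ (x + t • v))
          = (fun t : ℝ => Real.exp (l * t)) • fun t => ∫ r in t..(T + t), g r := by
        ext t; exact hval t
      rw [e]
      refine this.congr_deriv ?_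
      have h0 := hval 0
      simp only [zero_smul, add_zero, mul_zero, Real.exp_zero, one_smul] at h0
      simp only [mul_zero, Real.exp_zero, one_smul, add_zero]
      rw [← h0]
      simp only [hg, Complex.real_smul, mul_zero, zero_smul, neg_zero, Real.exp_zero, add_zero,
        Complex.ofReal_one, one_mul]
      ring
    have h1 := hasDerivAt_line hφs x v 0
    rw [zero_smul, add_zero] at h1
    rw [hD.unique h1 |>.symm]
    ring

lemma memLp_test {ρ : Config → ℂ} (hρ : ContDiff ℝ ∞ ρ) (hc : HasCompactSupport ρ)
    (ν : Measure Config) [IsFiniteMeasureOnCompacts ν] : MemLp ρ 2 ν :=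
  hρ.continuous.memLp_of_hasCompactSupport hc

lemma ae_eq_zero_of_integral_test {u : Config → ℂ} (hu : MemLp u 2 volS1)
    (h : ∀ ρ : Config → ℂ, ContDiff ℝ ∞ ρ → HasCompactSupport ρ → tsupport ρ ⊆ (S1 : Set Config) →
      ∫ x, (starRingEnd ℂ) (u x) * ρ x ∂volS1 = 0) : u =ᵐ[volS1] fun _ => 0 := by
  have hloc : LocallyIntegrableOn (fun x => (starRingEnd ℂ) (u x)) (S1 : Set Config) volume :=
    locallyIntegrableOn_of_locallyIntegrable_restrict
      (hu.star.locallyIntegrable (by norm_num))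
  have key : ∀ᵐ x ∂(volume : Measure Config), x ∈ (S1 : Set Config) → (starRingEnd ℂ) (u x) = 0 := by
    refine S1.isOpen.ae_eq_zero_of_integral_contDiff_smul_eq_zero hloc fun g hg hgc hgs => ?_
    have hs : tsupport (fun x => (g x : ℂ)) ⊆ tsupport g := by
      refine closure_minimal (fun x hx => subset_tsupport _ fun h0 => hx ?_) (isClosed_tsupport _)
      simp only [h0, Complex.ofReal_zero]
    have := h (fun x => (g x : ℂ)) (Complex.ofRealCLM.contDiff.comp hg)
      (IsCompact.of_isClosed_subset hgc (isClosed_tsupport _) hs) (hs.trans hgs)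
    rw [integral_volS1_eq] at this
    · rw [← this]
      refine integral_congr_ae (Eventually.of_forall fun x => ?_)
      simp only [Complex.real_smul, mul_comm]
    · intro x hx
      rw [image_eq_zero_of_notMem_tsupport fun h => hx (hgs (hs h)), mul_zero]
  filter_upwards [(ae_restrict_iff' S1.isOpen.measurableSet).2 key] with x hx
  simpa using hx

lemma WeakTransport.integral_eq_zero {l : ℝ} {v : Config} {u : Config → ℂ} (hu : MemLp u 2 volS1)
    (h : WeakTransport v u fun x => l * u x) {φ : Config → ℂ} (hφ : ContDiff ℝ ∞ φ)
    (hc : HasCompactSupport φ) (hs : tsupport φ ⊆ (S1 : Set Config)) :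
    ∫ x, (starRingEnd ℂ) (u x) * (l * φ x - fderiv ℝ φ x v) ∂volS1 = 0 := by
  have hd : MemLp (fun x => fderiv ℝ φ x v) 2 volS1 :=
    ((hφ.continuous_fderiv (by simp)).clm_apply continuous_const).memLp_of_hasCompactSupport
      (hc.fderiv_apply ℝ v)
  have h1 : Integrable (fun x => (starRingEnd ℂ) (l * u x) * φ x) volS1 :=
    (hu.const_mul (l : ℂ)).star.integrable_mul (memLp_test hφ hc _)
  have h2 : Integrable (fun x => (starRingEnd ℂ) (u x) * fderiv ℝ φ x v) volS1 :=
    hu.star.integrable_mul hd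
  have h3 := sub_eq_zero.2 (h φ hφ hc hs)
  rw [← integral_sub h1 h2] at h3
  rw [← h3]
  refine integral_congr_ae (Eventually.of_forall fun x => ?_)
  simp only [map_mul, Complex.conj_ofReal]
  ring

/-- Uniqueness if `S1` is invariant under the backward flow. -/
lemma WeakTransport.ae_eq_zero_of_invariant {l : ℝ} (hl : 0 < l) {v : Config} {u : Config → ℂ}
    (hu : MemLp u 2 volS1) (h : WeakTransport v u fun x => l * u x)
    (hv : ∀ x ∈ S1, ∀ t : ℝ, 0 ≤ t → x - t • v ∈ S1) : u =ᵐ[volS1] fun _ => 0 := by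
  refine ae_eq_zero_of_integral_test hu fun ρ hρ hc hs => ?_
  set M : ℝ≥0∞ := ∫⁻ x, ‖u x‖ₑ ^ 2 ∂volS1 + ∫⁻ x, ‖ρ x‖ₑ ^ 2 with hM
  have hMtop : M ≠ ⊤ := by
    refine ENNReal.add_ne_top.2 ⟨?_, lintegral_enorm_sq_ne_top hρ.continuous hc⟩
    rw [lintegral_sq_eq_eLpNorm]
    exact ENNReal.pow_ne_top hu.eLpNorm_ne_top
  -- The finite-time adjoint solution stays supported in `S1` by invariance. Testing with it
  -- replaces ρ by the endpoint term, whose factor e^{-lT} tends to 0.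
  have key : ∀ T : ℝ, 0 < T →
      ‖∫ x, (starRingEnd ℂ) (u x) * ρ x ∂volS1‖ₑ ≤ expWeight l T * M := by
    intro T hT
    obtain ⟨φ, h1, h2, h3⟩ := exists_backward_solution l v hT hρ hc
    have hφs : tsupport φ ⊆ (S1 : Set Config) := by
      intro x hx
      obtain ⟨t, ht, hxt⟩ := h2 hx
      have := hv _ (hs hxt) t ht.1
      simpa using this
    have hφc : HasCompactSupport φ :=
      (isCompact_backward v T hc).of_isClosed_subset (isClosed_tsupport _) h2
    have h4 := h.integral_eq_zero hu h1 hφc hφs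
    have hm : MemLp (fun x => ρ (x + T • v)) 2 volS1 := by
      refine (hρ.continuous.comp (by fun_prop)).memLp_of_hasCompactSupport ?_
      exact hc.comp_homeomorph (Homeomorph.addRight (T • v))
    simp only [h3, mul_sub] at h4
    have i1 : Integrable (fun x => (starRingEnd ℂ) (u x) * ρ x) volS1 :=
      hu.star.integrable_mul (memLp_test hρ hc _)
    have i2 : Integrable (fun x => (starRingEnd ℂ) (u x) *
        ((Real.exp (-(l * T)) : ℂ) * ρ (x + T • v))) volS1 :=
      hu.star.integrable_mul (hm.const_mul _)
    rw [integral_sub i1 i2, sub_eq_zero] at h4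
    rw [h4]
    have e : ∀ x, (starRingEnd ℂ) (u x) * ((Real.exp (-(l * T)) : ℂ) * ρ (x + T • v))
        = (Real.exp (-(l * T)) : ℂ) * ((starRingEnd ℂ) (u x) * ρ (x + T • v)) := fun x => by ring
    simp only [e]
    rw [integral_const_mul, enorm_exp_mul]
    refine mul_le_mul_right ((enorm_integral_le_lintegral_enorm _).trans ?_) _
    calc ∫⁻ x, ‖(starRingEnd ℂ) (u x) * ρ (x + T • v)‖ₑ ∂volS1
        ≤ ∫⁻ x, (‖u x‖ₑ ^ 2 + ‖ρ (x + T • v)‖ₑ ^ 2) ∂volS1 := by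
          refine lintegral_mono fun x => ?_
          rw [enorm_mul, RCLike.enorm_conj]
          exact enorm_mul_le_sq_add _ _
      _ = ∫⁻ x, ‖u x‖ₑ ^ 2 ∂volS1 + ∫⁻ x, ‖ρ (x + T • v)‖ₑ ^ 2 ∂volS1 :=
          lintegral_add_right _ ((hρ.continuous.comp (by fun_prop)).measurable.enorm.pow_const 2)
      _ ≤ M := by
          refine add_le_add le_rfl ((setLIntegral_le_lintegral _ _).trans_eq ?_)
          exact lintegral_add_right_eq_self (fun x => ‖ρ x‖ₑ ^ 2) (T • v)
  have hlim : Tendsto (fun T => expWeight l T * M) atTop (𝓝 0) := by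
    have h1 : Tendsto (fun T => expWeight l T) atTop (𝓝 0) := by
      have := ENNReal.tendsto_ofReal (Real.tendsto_exp_neg_atTop_nhds_zero.comp
        (tendsto_id.const_mul_atTop hl))
      rw [ENNReal.ofReal_zero] at this
      exact this
    have := ENNReal.Tendsto.mul_const h1 (Or.inr hMtop)
    simpa using this
  have h0 := ge_of_tendsto hlim ((eventually_gt_atTop 0).mono key)
  simpa using h0

/-! ### Uniqueness with vanishing incoming trace -/

lemma HasTrace.congr_trace {σ : ℝ → ℝ × ℝ → Config} {u : Config → ℂ} {g g' : ℝ × ℝ → ℂ}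
    (h : HasTrace σ u g) (hg : g =ᵐ[volume.restrict halfPlane] g') : HasTrace σ u g' := by
  refine ⟨h.1.congr hg, fun K hK hKs => (h.2 K hK hKs).congr fun r => ?_⟩
  congr 1
  have h1 : g =ᵐ[volume.restrict K] g' := ae_restrict_of_ae_restrict_of_subset hKs hg
  have h2 : ∀ᵐ p : ℝ × (ℝ × ℝ) ∂(volume.restrict (Ioo (0 : ℝ) r ×ˢ K)), g p.2 = g' p.2 := by
    rw [Measure.volume_eq_prod, ← Measure.prod_restrict]
    exact Measure.quasiMeasurePreserving_snd.ae h1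
  refine lintegral_congr_ae ?_
  filter_upwards [h2] with p hp
  rw [hp]

/-- The trace of the zero function is zero. -/
lemma HasTrace.ae_eq_zero {σ : ℝ → ℝ × ℝ → Config} (hσ : GoodSlices σ) {u : Config → ℂ}
    {g : ℝ × ℝ → ℂ} (h : HasTrace σ u g) (hu : u =ᵐ[volS1] fun _ => 0) :
    g =ᵐ[volume.restrict halfPlane] fun _ => 0 := by
  have h' := h.congr hσ hu
  let K : ℕ → Set (ℝ × ℝ) := fun n => Icc (-(n : ℝ)) n ×ˢ Icc (1 / ((n : ℝ) + 1)) n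
  have hK : ∀ n, IsCompact (K n) := fun n => isCompact_Icc.prod isCompact_Icc
  have hKs : ∀ n, K n ⊆ halfPlane := by
    rintro n ⟨a, b⟩ ⟨-, hb⟩
    refine ⟨mem_univ _, ?_⟩
    have : (0 : ℝ) < 1 / ((n : ℝ) + 1) := by positivity
    exact this.trans_le hb.1
  have hU : halfPlane ⊆ ⋃ n, K n := by
    rintro ⟨a, b⟩ ⟨-, hb⟩
    have hb' : 0 < b := hb
    obtain ⟨n₁, h1⟩ := exists_nat_gt |a|
    obtain ⟨n₂, h2⟩ := exists_nat_gt b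
    obtain ⟨n₃, h3⟩ := exists_nat_one_div_lt hb'
    have m1 : (n₁ : ℝ) ≤ (max n₁ (max n₂ n₃) : ℕ) := by exact_mod_cast le_max_left _ _
    have m2 : (n₂ : ℝ) ≤ (max n₁ (max n₂ n₃) : ℕ) := by
      exact_mod_cast (le_max_left _ _).trans (le_max_right _ _)
    have m3 : (n₃ : ℝ) ≤ (max n₁ (max n₂ n₃) : ℕ) := by
      exact_mod_cast (le_max_right _ _).trans (le_max_right _ _)
    refine mem_iUnion.2 ⟨max n₁ (max n₂ n₃), ⟨abs_le.1 (h1.le.trans m1), ?_, h2.le.trans m2⟩⟩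
    refine (one_div_le_one_div_of_le (by positivity) ?_).trans h3.le
    linarith
  refine ae_restrict_of_ae_restrict_of_subset hU ((ae_restrict_iUnion_iff _ _).2 fun n => ?_)
  have hgK : AEStronglyMeasurable g (volume.restrict (K n)) :=
    h.1.mono_measure (Measure.restrict_mono (hKs n) le_rfl)
  -- For u = 0 the averaged quantity does not depend on the thickness r, so its limit being 0 makes
  -- it 0.
  have hconst : ∀ r ∈ Ioi (0 : ℝ), (ENNReal.ofReal r)⁻¹ *
      ∫⁻ p in Ioo (0 : ℝ) r ×ˢ K n, ‖(0 : ℂ) - g p.2‖ₑ ^ 2 = ∫⁻ q in K n, ‖g q‖ₑ ^ 2 := by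
    intro r hr
    have hm : AEMeasurable (fun p : ℝ × (ℝ × ℝ) => ‖(0 : ℂ) - g p.2‖ₑ ^ 2)
        ((volume.restrict (Ioo (0 : ℝ) r)).prod (volume.restrict (K n))) := by
      simp only [zero_sub, enorm_neg]
      exact (hgK.comp_snd.enorm).pow_const 2
    rw [Measure.volume_eq_prod, ← Measure.prod_restrict, lintegral_prod _ hm]
    simp only [zero_sub, enorm_neg]
    rw [lintegral_const, Measure.restrict_apply_univ, Real.volume_Ioo, sub_zero, mul_comm (lintegral _ _),
      ← mul_assoc, ENNReal.inv_mul_cancel (by simpa using hr) ENNReal.ofReal_ne_top, one_mul]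
  have hlim := h'.2 (K n) (hK n) (hKs n)
  have h0 : ∫⁻ q in K n, ‖g q‖ₑ ^ 2 = 0 := by
    refine tendsto_nhds_unique (tendsto_const_nhds.congr' ?_) hlim
    filter_upwards [self_mem_nhdsWithin] with r hr
    exact (hconst r hr).symm
  have h1 := (lintegral_eq_zero_iff' ((hgK.enorm).pow_const 2)).1 h0
  filter_upwards [h1] with q hq
  simpa using hq

/-- A smooth transition from `0` on `r ≤ 1/2` to `1` on `r ≥ 3/4`. -/
def cutoff (r : ℝ) : ℝ := Real.smoothTransition (4 * r - 2)

lemma contDiff_cutoff : ContDiff ℝ ∞ cutoff :=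
  Real.smoothTransition.contDiff.comp (by fun_prop)

lemma cutoff_of_le {r : ℝ} (h : r ≤ 1 / 2) : cutoff r = 0 :=
  Real.smoothTransition.zero_of_nonpos (by linarith)

lemma cutoff_of_ge {r : ℝ} (h : 3 / 4 ≤ r) : cutoff r = 1 :=
  Real.smoothTransition.one_of_one_le (by linarith)

lemma deriv_cutoff_of_ge {r : ℝ} (h : 1 ≤ r) : deriv cutoff r = 0 := by
  have : cutoff =ᶠ[𝓝 r] fun _ => 1 := by
    filter_upwards [lt_mem_nhds (show (3 / 4 : ℝ) < r by linarith)] with s hs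
    exact cutoff_of_ge hs.le
  rw [this.deriv_eq, deriv_const]

lemma exists_deriv_cutoff_le : ∃ C : ℝ, ∀ r, 0 ≤ r → ‖deriv cutoff r‖ ≤ C := by
  have hc : Continuous (deriv cutoff) := contDiff_cutoff.continuous_deriv (by simp)
  obtain ⟨C, hC⟩ := isCompact_Icc.exists_bound_of_continuousOn (s := Icc (0 : ℝ) 1) hc.continuousOn
  refine ⟨max C 0, fun r hr => ?_⟩
  rcases le_total r 1 with h | h
  · exact (hC r ⟨hr, h⟩).trans (le_max_left _ _)
  · rw [deriv_cutoff_of_ge h, norm_zero]; exact le_max_right _ _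

/-- Duality: ρ is the image of a backward solution φ under the adjoint transport operator, but the
support of φ may reach the face. Cutting φ off at height r creates an error of size 1/r in the slab
of height r; against u it tends to 0 precisely because the mean square of u over such slabs does. -/
lemma IsFace.ae_eq_zero_of_hasTrace_zero {e : (ℝ × (ℝ × ℝ)) ≃L[ℝ] Config}
    {σ : ℝ → ℝ × ℝ → Config} (he : IsFace e σ) {l : ℝ} {v : Config} {u : Config → ℂ}
    (hum : Measurable u) (hu : MemLp u 2 volS1) (h : WeakTransport v u fun x => l * u x)
    (hv : (e.symm v).1 = 1)
    (hback : ∀ x ∈ S1, ∀ t : ℝ, 0 ≤ t → (e.symm (x - t • v)).2 ∈ halfPlane)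
    (htr : HasTrace σ u fun _ => 0) : u =ᵐ[volS1] fun _ => 0 := by
  refine ae_eq_zero_of_integral_test hu fun ρ hρ hc hs => ?_
  have hσ : σ = fun h q => e (h, q) := by ext1 h; ext1 q; exact he.apply h q
  subst hσ
  have hmem : ∀ x, x ∈ S1 ↔ 0 < (e.symm x).1 ∧ (e.symm x).2 ∈ halfPlane := by
    intro x
    have := he.mem_iff (e.symm x)
    rwa [e.apply_symm_apply] at this
  have hcl : Continuous fun x => (e.symm x).1 := by fun_prop
  obtain ⟨δ, hδ, hδρ⟩ := isCompact_subset_pos (s := tsupport ρ) hc hcl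
    (fun x hx => ((hmem x).1 (hs hx)).1)
  obtain ⟨T₀, hT₀⟩ := IsCompact.exists_bound_of_continuousOn (s := tsupport ρ) hc hcl.continuousOn
  -- The height grows at unit speed along v and is positive on `S1`, so after time T every point of
  -- `S1` is above the support of ρ and the endpoint term vanishes.
  set T : ℝ := max T₀ 1 with hTdef
  have hT : 0 < T := lt_max_of_lt_right one_pos
  obtain ⟨φ, hφ, hφs, hφe⟩ := exists_backward_solution l v hT hρ hc
  have hBc : IsCompact (backward v T (tsupport ρ)) := isCompact_backward v T hc
  have hφc : HasCompactSupport φ := hBc.of_isClosed_subset (isClosed_tsupport _) hφs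
  have hφe' : ∀ x ∈ S1, l * φ x - fderiv ℝ φ x v = ρ x := by
    intro x hx
    have : ρ (x + T • v) = 0 := by
      refine image_eq_zero_of_notMem_tsupport fun hm => ?_
      have h1 := (le_abs_self _).trans (hT₀ _ hm)
      rw [map_add, map_smul, Prod.fst_add, Prod.smul_fst, hv, smul_eq_mul, mul_one] at h1
      have h2 := ((hmem x).1 hx).1
      have h3 : T₀ ≤ T := le_max_left _ _
      linarith
    rw [hφe, this, mul_zero, sub_zero]
  -- The shadow of the support of φ on the face: by `hback` it stays in the open half plane, away
  -- from the edge, so the trace condition can be used on it.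
  set K : Set (ℝ × ℝ) := (fun x => (e.symm x).2) '' backward v T (tsupport ρ) with hKdef
  have hK : IsCompact K := hBc.image (by fun_prop)
  have hKs : K ⊆ halfPlane := by
    rintro _ ⟨x, ⟨t, ht, hx⟩, rfl⟩
    simpa using hback _ (hs hx) t ht.1
  obtain ⟨C, hC⟩ := exists_deriv_cutoff_le
  obtain ⟨C', hC'⟩ := exists_norm_le hφ.continuous hφc
  have hC'0 : 0 ≤ C' := (norm_nonneg _).trans (hC' 0)
  obtain ⟨-, c, hctop, hcE⟩ := exists_lintegral_comp_equiv e
  set A : ℝ≥0∞ := ENNReal.ofReal (C * C') * c with hA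
  -- the error made by cutting off the test function near the face
  have key : ∀ r ∈ Ioo 0 δ, ‖∫ x, (starRingEnd ℂ) (u x) * ρ x ∂volS1‖ₑ ^ 2 ≤
      A ^ 2 * volume K * ((ENNReal.ofReal r)⁻¹ *
        ∫⁻ p in Ioo (0 : ℝ) r ×ˢ K, ‖u (e (p.1, p.2)) - 0‖ₑ ^ 2) := by
    intro r hr
    set χ : Config → ℝ := fun x => cutoff ((e.symm x).1 / r) with hχ
    have hχs : ContDiff ℝ ∞ χ := by
      refine contDiff_cutoff.comp (ContDiff.div_const ?_ r)
      exact contDiff_fst.comp e.symm.contDiff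
    set φr : Config → ℂ := fun x => (χ x : ℂ) * φ x with hφr
    have hχs' : ContDiff ℝ ∞ fun x => (χ x : ℂ) := Complex.ofRealCLM.contDiff.comp hχs
    have hφrs : ContDiff ℝ ∞ φr := hχs'.mul hφ
    have hφrc : HasCompactSupport φr := hφc.mul_left
    have hφrS : tsupport φr ⊆ (S1 : Set Config) := by
      intro x hx
      have h1 : x ∈ tsupport φ := tsupport_mul_subset_right hx
      have h2 : r / 2 ≤ (e.symm x).1 := by
        have hcl' : IsClosed {y : Config | r / 2 ≤ (e.symm y).1} := isClosed_le continuous_const hcl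
        refine closure_minimal (fun y hy => ?_) hcl' hx
        by_contra hn
        apply hy
        have : χ y = 0 := by
          refine cutoff_of_le ?_
          rw [div_le_iff₀ hr.1]
          simp only [mem_ofPred_eq, not_le] at hn
          linarith
        simp only [hφr, this, Complex.ofReal_zero, zero_mul]
      obtain ⟨t, ht, hxt⟩ := hφs h1
      refine (hmem x).2 ⟨by linarith [hr.1], ?_⟩
      simpa using hback _ (hs hxt) t ht.1
    have hder : ∀ x, fderiv ℝ φr x v
        = (χ x : ℂ) * fderiv ℝ φ x v + ((deriv cutoff ((e.symm x).1 / r) / r : ℝ) : ℂ) * φ x := by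
      intro x
      have h1 := hasDerivAt_line hφrs x v 0
      have h2 := hasDerivAt_line hφ x v 0
      have h3 : HasDerivAt (fun t : ℝ => χ (x + t • v)) (deriv cutoff ((e.symm x).1 / r) / r) 0 := by
        have h4 : HasDerivAt (fun t : ℝ => ((e.symm x).1 + t) / r) (1 / r) 0 :=
          ((hasDerivAt_id (0 : ℝ)).const_add _).div_const r
        have h5 : HasDerivAt cutoff (deriv cutoff ((e.symm x).1 / r)) (((e.symm x).1 + 0) / r) := by
          rw [add_zero]
          exact (contDiff_cutoff.differentiable (by simp) _).hasDerivAt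
        have h6 := h5.comp (0 : ℝ) h4
        rw [mul_one_div] at h6
        refine h6.congr_of_eventuallyEq (Eventually.of_forall fun t => ?_)
        simp [hχ, hv]
      rw [zero_smul, add_zero] at h1 h2
      have h7 := h3.ofReal_comp.mul h2
      rw [zero_smul, add_zero] at h7
      rw [h1.unique h7]
      ring
    have hzero := h.integral_eq_zero hu hφrs hφrc hφrS
    set E : Config → ℂ := fun x =>
      ((deriv cutoff ((e.symm x).1 / r) / r : ℝ) : ℂ) * φ x with hE
    have hEc : Continuous E := by
      refine (Complex.continuous_ofReal.comp ?_).mul hφ.continuous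
      exact ((contDiff_cutoff.continuous_deriv (by simp)).comp (hcl.div_const r)).div_const r
    have hEs : HasCompactSupport E := hφc.mul_left
    have heq : ∀ x ∈ S1, l * φr x - fderiv ℝ φr x v = ρ x - E x := by
      intro x hx
      rw [hder]
      have h1 : (χ x : ℂ) * ρ x = ρ x := by
        by_cases hxρ : x ∈ tsupport ρ
        · have : χ x = 1 := by
            refine cutoff_of_ge ?_
            rw [le_div_iff₀ hr.1]
            have := hδρ x hxρ
            linarith [hr.1, hr.2]
          rw [this, Complex.ofReal_one, one_mul]
        · rw [image_eq_zero_of_notMem_tsupport hxρ, mul_zero]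
      rw [← h1, ← hφe' x hx]
      simp only [hφr, hE]
      ring
    have hsplit : ∫ x, (starRingEnd ℂ) (u x) * ρ x ∂volS1
        = ∫ x, (starRingEnd ℂ) (u x) * E x ∂volS1 := by
      have i1 : Integrable (fun x => (starRingEnd ℂ) (u x) * ρ x) volS1 :=
        hu.star.integrable_mul (memLp_test hρ hc _)
      have hEm : MemLp E 2 volS1 := hEc.memLp_of_hasCompactSupport hEs
      have i2 : Integrable (fun x => (starRingEnd ℂ) (u x) * E x) volS1 :=
        hu.star.integrable_mul hEm
      rw [← sub_eq_zero, ← integral_sub i1 i2, ← hzero]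
      refine setIntegral_congr_fun S1.isOpen.measurableSet fun x hx => ?_
      rw [heq x hx, mul_sub]
    have hmeasK : MeasurableSet (Ioo (0 : ℝ) r ×ˢ K) := measurableSet_Ioo.prod hK.measurableSet
    set F : Config → ℝ≥0∞ := fun x =>
      (Ioo (0 : ℝ) r ×ˢ K).indicator (fun p => ‖u (e p)‖ₑ) (e.symm x) with hF
    have hum' : Measurable fun p : ℝ × (ℝ × ℝ) => ‖u (e p)‖ₑ :=
      (hum.comp e.continuous.measurable).enorm
    have hFm : Measurable F := (hum'.indicator hmeasK).comp e.symm.continuous.measurable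
    have hpt : ∀ x ∈ S1, ‖(starRingEnd ℂ) (u x) * E x‖ₑ
        ≤ ENNReal.ofReal (C * C' / r) * F x := by
      intro x hx
      have hx1 := (hmem x).1 hx
      by_cases hxK : e.symm x ∈ Ioo (0 : ℝ) r ×ˢ K
      · rw [hF]
        simp only [indicator_of_mem hxK, e.apply_symm_apply]
        rw [enorm_mul, RCLike.enorm_conj, mul_comm]
        refine mul_le_mul_left ?_ _
        rw [← ofReal_norm]
        refine ENNReal.ofReal_le_ofReal ?_
        rw [hE]
        simp only
        rw [norm_mul, Complex.norm_real, norm_div, Real.norm_of_nonneg hr.1.le, div_mul_eq_mul_div]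
        refine div_le_div_of_nonneg_right ?_ hr.1.le
        have h0 : 0 ≤ (e.symm x).1 / r := div_nonneg hx1.1.le hr.1.le
        exact mul_le_mul (hC _ h0) (hC' x) (norm_nonneg _) ((norm_nonneg _).trans (hC _ h0))
      · have hE0 : E x = 0 := by
          by_cases hxφ : x ∈ tsupport φ
          · have h2 : (e.symm x).2 ∈ K := ⟨x, hφs hxφ, rfl⟩
            have h3 : r ≤ (e.symm x).1 := by
              by_contra hn
              exact hxK ⟨⟨hx1.1, not_le.1 hn⟩, h2⟩
            simp only [hE]
            rw [deriv_cutoff_of_ge ((one_le_div hr.1).2 h3)]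
            simp
          · simp only [hE, image_eq_zero_of_notMem_tsupport hxφ, mul_zero]
        rw [hE0, mul_zero, enorm_zero]
        exact zero_le
    have hbound : ‖∫ x, (starRingEnd ℂ) (u x) * ρ x ∂volS1‖ₑ ≤
        A * (ENNReal.ofReal r)⁻¹ * ∫⁻ p in Ioo (0 : ℝ) r ×ˢ K, ‖u (e p)‖ₑ := by
      rw [hsplit]
      calc ‖∫ x, (starRingEnd ℂ) (u x) * E x ∂volS1‖ₑ
          ≤ ∫⁻ x in (S1 : Set Config), ‖(starRingEnd ℂ) (u x) * E x‖ₑ :=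
            enorm_integral_le_lintegral_enorm _
        _ ≤ ∫⁻ x in (S1 : Set Config), ENNReal.ofReal (C * C' / r) * F x :=
            setLIntegral_mono (hFm.const_mul _) hpt
        _ ≤ ∫⁻ x, ENNReal.ofReal (C * C' / r) * F x := setLIntegral_le_lintegral _ _
        _ = ENNReal.ofReal (C * C' / r) * (c * ∫⁻ p, F (e p)) := by
            rw [lintegral_const_mul _ hFm, hcE F hFm]
        _ = A * (ENNReal.ofReal r)⁻¹ * ∫⁻ p in Ioo (0 : ℝ) r ×ˢ K, ‖u (e p)‖ₑ := by
            rw [← lintegral_indicator hmeasK, hA, ENNReal.ofReal_div_of_pos hr.1,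
              ENNReal.div_eq_inv_mul]
            simp only [hF, e.symm_apply_apply]
            ring
    have hr0 : ENNReal.ofReal r ≠ 0 := by simpa using hr.1
    calc ‖∫ x, (starRingEnd ℂ) (u x) * ρ x ∂volS1‖ₑ ^ 2
        ≤ (A * (ENNReal.ofReal r)⁻¹ * ∫⁻ p in Ioo (0 : ℝ) r ×ˢ K, ‖u (e p)‖ₑ) ^ 2 :=
          pow_le_pow_left' hbound 2
      -- Cauchy-Schwarz on a slab of measure r·|K| turns r⁻² into r⁻¹, the averaging factor in
      -- `HasTrace`.
      _ ≤ (A * (ENNReal.ofReal r)⁻¹) ^ 2 * ((volume.restrict (Ioo (0 : ℝ) r ×ˢ K)) univ *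
            ∫⁻ p in Ioo (0 : ℝ) r ×ˢ K, ‖u (e p)‖ₑ ^ 2) := by
          rw [mul_pow]
          exact mul_le_mul_right (sq_lintegral_le _ hum'.aemeasurable) _
      _ = _ := by
          rw [Measure.restrict_apply_univ, Measure.volume_eq_prod, Measure.prod_prod,
            Real.volume_Ioo, sub_zero]
          simp only [sub_zero]
          rw [mul_pow, sq ((ENNReal.ofReal r)⁻¹)]
          have : (ENNReal.ofReal r)⁻¹ * ENNReal.ofReal r = 1 :=
            ENNReal.inv_mul_cancel hr0 ENNReal.ofReal_ne_top
          generalize ∫⁻ p in Ioo (0 : ℝ) r ×ˢ K, ‖u (e p)‖ₑ ^ 2 ∂(volume.prod volume) = X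
          calc A ^ 2 * ((ENNReal.ofReal r)⁻¹ * (ENNReal.ofReal r)⁻¹)
                * (ENNReal.ofReal r * volume K * X)
              = A ^ 2 * volume K * ((ENNReal.ofReal r)⁻¹ * X)
                * ((ENNReal.ofReal r)⁻¹ * ENNReal.ofReal r) := by ring
            _ = _ := by rw [this, mul_one]
  have hlim := ENNReal.Tendsto.const_mul (a := A ^ 2 * volume K) (htr.2 K hK hKs)
    (Or.inr (ENNReal.mul_ne_top (ENNReal.pow_ne_top (ENNReal.mul_ne_top ENNReal.ofReal_ne_top hctop))
      hK.measure_ne_top))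
  rw [mul_zero] at hlim
  have h0 := ge_of_tendsto hlim (by
    filter_upwards [Ioo_mem_nhdsGT hδ] with r hr
    exact key r hr)
  simpa using h0

/-! ### Uniqueness for the boundary value problem -/

@[simp] lemma sgn_zero : sgn 0 = 1 := rfl

@[simp] lemma sgn_one : sgn 1 = -1 := rfl

@[simp] lemma vel_apply_zero (a : Spin) : vel a 0 = sgn a.1 := rfl

@[simp] lemma vel_apply_one (a : Spin) : vel a 1 = sgn a.2.1 := rfl

@[simp] lemma vel_apply_two (a : Spin) : vel a 2 = sgn a.2.2 := rfl

lemma sgn_le_one (i : Fin 2) : sgn i ≤ 1 := by fin_cases i <;> simp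

lemma neg_one_le_sgn (i : Fin 2) : -1 ≤ sgn i := by fin_cases i <;> simp

/-- The backward flow of a component that is not incoming at any face stays in `S1`. -/
lemma sub_smul_vel_mem {a : Spin} (h1 : sgn a.1 ≤ sgn a.2.1) (h2 : sgn a.2.2 ≤ sgn a.1) :
    ∀ x ∈ S1, ∀ t : ℝ, 0 ≤ t → x - t • vel a ∈ S1 := by
  intro x hx t ht
  rw [mem_S1] at hx ⊢
  simp only [Pi.sub_apply, Pi.smul_apply, vel_apply_zero, vel_apply_one, vel_apply_two, smul_eq_mul]
  have := mul_le_mul_of_nonneg_left h1 ht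
  have := mul_le_mul_of_nonneg_left h2 ht
  constructor <;> linarith [hx.1, hx.2]

/-- The photon already moves at the maximal velocity +1, so backwards in time its distance to the
second electron cannot shrink; the backward flow can leave `S1` only through `C₁`. -/
lemma backward_mem_halfPlane1 (c : Fin 2) (x : Config) (hx : x ∈ S1) (t : ℝ) (ht : 0 ≤ t) :
    (faceEquiv1.symm (x - t • vel (0, 1, c))).2 ∈ halfPlane := by
  rw [mem_S1] at hx
  refine ⟨mem_univ _, ?_⟩
  have := mul_le_mul_of_nonneg_left (sgn_le_one c) ht
  simp only [faceEquiv1_symm_apply, Pi.sub_apply, Pi.smul_apply, vel_apply_zero, vel_apply_two,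
    smul_eq_mul, sgn_zero, mem_Ioi]
  linarith [hx.2]

lemma backward_mem_halfPlane2 (b : Fin 2) (x : Config) (hx : x ∈ S1) (t : ℝ) (ht : 0 ≤ t) :
    (faceEquiv2.symm (x - t • vel (1, b, 0))).2 ∈ halfPlane := by
  rw [mem_S1] at hx
  refine ⟨mem_univ _, ?_⟩
  have := mul_le_mul_of_nonneg_left (neg_one_le_sgn b) ht
  simp only [faceEquiv2_symm_apply, Pi.sub_apply, Pi.smul_apply, vel_apply_zero, vel_apply_one,
    smul_eq_mul, sgn_one, mem_Ioi]
  linarith [hx.1]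

lemma faceEquiv1_symm_vel_in (c : Fin 2) : (faceEquiv1.symm (vel (0, 1, c))).1 = 1 := by
  simp only [faceEquiv1_symm_apply, vel_apply_zero, vel_apply_one, sgn_zero, sgn_one]; norm_num

lemma faceEquiv1_symm_vel_out (c : Fin 2) : (faceEquiv1.symm (vel (1, 0, c))).1 = -1 := by
  simp only [faceEquiv1_symm_apply, vel_apply_zero, vel_apply_one, sgn_zero, sgn_one]; norm_num

lemma faceEquiv2_symm_vel_in (b : Fin 2) : (faceEquiv2.symm (vel (1, b, 0))).1 = 1 := by
  simp only [faceEquiv2_symm_apply, vel_apply_zero, vel_apply_two, sgn_zero, sgn_one]; norm_num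

lemma faceEquiv2_symm_vel_out (b : Fin 2) : (faceEquiv2.symm (vel (0, b, 1))).1 = -1 := by
  simp only [faceEquiv2_symm_apply, vel_apply_zero, vel_apply_two, sgn_zero, sgn_one]; norm_num

/-- If the outgoing component vanishes, the trace of the incoming one vanishes, and so does the
incoming component. -/
lemma incoming_ae_eq_zero {e : (ℝ × (ℝ × ℝ)) ≃L[ℝ] Config} {σ : ℝ → ℝ × ℝ → Config}
    (he : IsFace e σ) {l : ℝ} {Ψ : L2S1} {a b : Spin} {k : ℝ × ℝ → ℂ}
    (htr : ∃ g, HasTrace σ (comp a Ψ) g ∧ HasTrace σ (comp b Ψ) (fun q => k q * g q))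
    (hw : WeakTransport (vel b) (comp b Ψ) fun x => l * comp b Ψ x)
    (hv : (e.symm (vel b)).1 = 1)
    (hback : ∀ x ∈ S1, ∀ t : ℝ, 0 ≤ t → (e.symm (x - t • vel b)).2 ∈ halfPlane)
    (h0 : comp a Ψ =ᵐ[volS1] fun _ => 0) : comp b Ψ =ᵐ[volS1] fun _ => 0 := by
  obtain ⟨g, h1, h2⟩ := htr
  have hg := h1.ae_eq_zero he.goodSlices h0
  refine he.ae_eq_zero_of_hasTrace_zero (measurable_comp b Ψ) (memLp_comp b Ψ) hw hv hback
    (h2.congr_trace ?_)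
  filter_upwards [hg] with q hq
  rw [hq, mul_zero]

/-- Four components have backward-invariant flow and vanish outright. The other four follow along
(1,0,1) → (0,1,1) → (1,1,0) and (0,0,1) → (1,0,0) → (0,1,0). -/
lemma evolGraph_eq_zero {θ₁ θ₂ : ℝ} {μ : ℝ → ℝ} {l : ℝ} (hl : 0 < l) {Ψ : L2S1}
    (h : (Ψ, (l : ℂ) • Ψ) ∈ evolGraph θ₁ θ₂ μ) : Ψ = 0 := by
  rw [mem_evolGraph] at h
  obtain ⟨⟨h1, h2⟩, h3⟩ := h
  have hw : ∀ a, WeakTransport (vel a) (comp a Ψ) fun x => l * comp a Ψ x := fun a =>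
    (h3 a).congr EventuallyEq.rfl (comp_smul a l Ψ)
  have hA : ∀ a : Spin, sgn a.1 ≤ sgn a.2.1 → sgn a.2.2 ≤ sgn a.1 →
      comp a Ψ =ᵐ[volS1] fun _ => 0 := fun a ha hb =>
    (hw a).ae_eq_zero_of_invariant hl (memLp_comp a Ψ) (sub_smul_vel_mem ha hb)
  have hB : ∀ c, comp (1, 0, c) Ψ =ᵐ[volS1] (fun _ => 0) →
      comp (0, 1, c) Ψ =ᵐ[volS1] fun _ => 0 := fun c =>
    incoming_ae_eq_zero isFace1 (h1 c) (hw _) (faceEquiv1_symm_vel_in c) (backward_mem_halfPlane1 c)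
  have hC : ∀ b, comp (0, b, 1) Ψ =ᵐ[volS1] (fun _ => 0) →
      comp (1, b, 0) Ψ =ᵐ[volS1] fun _ => 0 := fun b =>
    incoming_ae_eq_zero isFace2 (h2 b) (hw _) (faceEquiv2_symm_vel_in b) (backward_mem_halfPlane2 b)
  have k101 := hA (1, 0, 1) (by simp) (by simp)
  have k001 := hA (0, 0, 1) (by simp) (by simp)
  have k000 := hA (0, 0, 0) (by simp) (by simp)
  have k111 := hA (1, 1, 1) (by simp) (by simp)
  have k011 := hB 1 k101
  have k110 := hC 1 k011
  have k100 := hC 0 k001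
  have k010 := hB 0 k100
  refine (Lp.eq_zero_iff_ae_eq_zero).2 ?_
  filter_upwards [k101, k001, k000, k111, k011, k110, k100, k010] with x e1 e2 e3 e4 e5 e6 e7 e8
  ext ⟨a, b, c⟩
  fin_cases a <;> fin_cases b <;> fin_cases c
  exacts [e3, e2, e8, e5, e7, e1, e6, e4]

/-! ### Unfolded sources -/

/-- A permutation of the coordinates of a configuration. -/
def sw (π : Equiv.Perm (Fin 3)) (x : Config) : Config := fun k => x (π k)

/-- The reflection at the face `C₁`. -/
abbrev sw1 : Config → Config := sw (Equiv.swap 0 1)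

/-- The reflection at the face `C₂`. -/
abbrev sw2 : Config → Config := sw (Equiv.swap 0 2)

lemma measurable_sw (π : Equiv.Perm (Fin 3)) : Measurable (sw π) := by
  unfold sw; fun_prop

lemma measurePreserving_sw (π : Equiv.Perm (Fin 3)) : MeasurePreserving (sw π) volume volume :=
  (volume_measurePreserving_piCongrLeft (fun _ : Fin 3 => ℝ) π).symm

lemma sw_sub_smul (π : Equiv.Perm (Fin 3)) (x v : Config) (t : ℝ) :
    sw π (x - t • v) = sw π x - t • sw π v := rfl

lemma sw1_vel (c : Fin 2) : sw1 (vel (0, 1, c)) = vel (1, 0, c) := by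
  ext k; fin_cases k <;> rfl

lemma sw2_vel (b : Fin 2) : sw2 (vel (1, b, 0)) = vel (0, b, 1) := by
  ext k; fin_cases k <;> rfl

lemma sw1_slice1 (q : ℝ × ℝ) : sw1 (slice1 0 q) = slice1 0 q := by
  ext k
  fin_cases k
  · simp [sw, slice1, relPoint]
  · simp [sw, slice1, relPoint]
  · rfl

lemma sw2_slice2 (q : ℝ × ℝ) : sw2 (slice2 0 q) = slice2 0 q := by
  ext k
  fin_cases k
  · simp [sw, slice2, relPoint]
  · rfl
  · simp [sw, slice2, relPoint]

/-- The component `a` of `η`, extended by zero. -/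
def ext0 (η : L2S1) (a : Spin) : Config → ℂ := (S1 : Set Config).indicator (comp a η)

lemma measurable_ext0 (η : L2S1) (a : Spin) : Measurable (ext0 η a) :=
  (measurable_comp a η).indicator S1.isOpen.measurableSet

lemma ext0_of_mem (η : L2S1) (a : Spin) {x : Config} (hx : x ∈ S1) : ext0 η a x = comp a η x :=
  indicator_of_mem (s := (S1 : Set Config)) hx _

lemma ext0_of_notMem (η : L2S1) (a : Spin) {x : Config} (hx : x ∉ S1) : ext0 η a x = 0 :=
  indicator_of_notMem (s := (S1 : Set Config)) hx _

lemma mem_of_ext0_ne_zero {η : L2S1} {a : Spin} {x : Config} (h : ext0 η a x ≠ 0) : x ∈ S1 := by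
  by_contra hx
  exact h (ext0_of_notMem η a hx)

lemma lintegral_ext0 (η : L2S1) (a : Spin) :
    ∫⁻ x, ‖ext0 η a x‖ₑ ^ 2 = ∫⁻ x, ‖comp a η x‖ₑ ^ 2 ∂volS1 := by
  rw [← lintegral_indicator S1.isOpen.measurableSet]
  refine lintegral_congr fun x => ?_
  by_cases hx : x ∈ S1
  · rw [ext0_of_mem η a hx, indicator_of_mem (s := (S1 : Set Config)) hx]
  · rw [ext0_of_notMem η a hx, indicator_of_notMem (s := (S1 : Set Config)) hx]; simp

lemma lintegral_ext0_ne_top (η : L2S1) (a : Spin) : ∫⁻ x, ‖ext0 η a x‖ₑ ^ 2 ≠ ⊤ := by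
  rw [lintegral_ext0, lintegral_sq_eq_eLpNorm]
  exact ENNReal.pow_ne_top (memLp_comp a η).eLpNorm_ne_top

/-- The continuation `f + κ(|x_i - x_j|) g∘s` of a source by the reflected source of another
component. -/
def addReflected (κ : ℝ → ℂ) (i j : Fin 3) (π : Equiv.Perm (Fin 3)) (f g : Config → ℂ) (x : Config) : ℂ :=
  f x + κ |x i - x j| * g (sw π x)

/-- The sources on the whole space whose resolvents solve the boundary value problem with
reflection coefficients `κ₁` and `κ₂` on the two faces. -/
def source (κ₁ κ₂ : ℝ → ℂ) (η : L2S1) : Spin → Config → ℂ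
  | (0, 1, 1) => addReflected κ₁ 1 2 (Equiv.swap 0 1) (ext0 η (0, 1, 1)) (ext0 η (1, 0, 1))
  | (1, 1, 0) => addReflected κ₂ 0 1 (Equiv.swap 0 2) (ext0 η (1, 1, 0))
      (addReflected κ₁ 1 2 (Equiv.swap 0 1) (ext0 η (0, 1, 1)) (ext0 η (1, 0, 1)))
  | (1, 0, 0) => addReflected κ₂ 1 2 (Equiv.swap 0 2) (ext0 η (1, 0, 0)) (ext0 η (0, 0, 1))
  | (0, 1, 0) => addReflected κ₁ 0 2 (Equiv.swap 0 1) (ext0 η (0, 1, 0))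
      (addReflected κ₂ 1 2 (Equiv.swap 0 2) (ext0 η (1, 0, 0)) (ext0 η (0, 0, 1)))
  | a => ext0 η a

/-- A uniform bound for the squares of the sources. -/
def sourceBound (η : L2S1) : Spin → Config → ℝ≥0∞
  | (0, 1, 1) => fun x => ‖ext0 η (0, 1, 1) x‖ₑ ^ 2 + ‖ext0 η (1, 0, 1) (sw1 x)‖ₑ ^ 2
  | (1, 1, 0) => fun x => ‖ext0 η (1, 1, 0) x‖ₑ ^ 2 +
      (‖ext0 η (0, 1, 1) (sw2 x)‖ₑ ^ 2 + ‖ext0 η (1, 0, 1) (sw1 (sw2 x))‖ₑ ^ 2)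
  | (1, 0, 0) => fun x => ‖ext0 η (1, 0, 0) x‖ₑ ^ 2 + ‖ext0 η (0, 0, 1) (sw2 x)‖ₑ ^ 2
  | (0, 1, 0) => fun x => ‖ext0 η (0, 1, 0) x‖ₑ ^ 2 +
      (‖ext0 η (1, 0, 0) (sw1 x)‖ₑ ^ 2 + ‖ext0 η (0, 0, 1) (sw2 (sw1 x))‖ₑ ^ 2)
  | a => fun x => ‖ext0 η a x‖ₑ ^ 2

/-- The reflection coefficients that are admitted. -/
structure IsCoeff (κ : ℝ → ℂ) : Prop where
  measurable : ∀ i j : Fin 3, Measurable fun x : Config => κ |x i - x j|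
  norm_le : ∀ r, 0 ≤ r → ‖κ r‖ ≤ 1

/-- At each point at most one of the two terms is nonzero, so the square has no cross term and no
factor 2 is lost. Contractivity depends on this. -/
lemma addReflected_enorm_le {κ : ℝ → ℂ} (hκ : IsCoeff κ) {i j : Fin 3} {π : Equiv.Perm (Fin 3)}
    {f g : Config → ℂ} {x : Config} {A B : ℝ≥0∞} (hf : ‖f x‖ₑ ^ 2 ≤ A) (hg : ‖g (sw π x)‖ₑ ^ 2 ≤ B)
    (hdisj : f x = 0 ∨ g (sw π x) = 0) : ‖addReflected κ i j π f g x‖ₑ ^ 2 ≤ A + B := by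
  unfold addReflected
  rcases hdisj with h | h
  · rw [h, zero_add, enorm_mul, mul_pow]
    have h1 : ‖κ |x i - x j|‖ₑ ≤ 1 := by
      rw [← ofReal_norm, ENNReal.ofReal_le_one]
      exact hκ.norm_le _ (abs_nonneg _)
    calc ‖κ |x i - x j|‖ₑ ^ 2 * ‖g (sw π x)‖ₑ ^ 2 ≤ 1 ^ 2 * B :=
          mul_le_mul' (pow_le_pow_left' h1 2) hg
      _ = B := by rw [one_pow, one_mul]
      _ ≤ A + B := le_add_self
  · rw [h, mul_zero, add_zero]
    exact hf.trans le_self_add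

lemma measurable_addReflected {κ : ℝ → ℂ} (hκ : IsCoeff κ) (i j : Fin 3) (π : Equiv.Perm (Fin 3))
    {f g : Config → ℂ} (hf : Measurable f) (hg : Measurable g) :
    Measurable (addReflected κ i j π f g) :=
  hf.add ((hκ.measurable i j).mul (hg.comp (measurable_sw π)))

/-- Induction along the two reflection chains; each implication is one reflection. -/
lemma forall_spin {P : Spin → Prop} (h1 : P (0, 0, 0)) (h2 : P (1, 1, 1)) (h3 : P (1, 0, 1))
    (h4 : P (0, 0, 1)) (h5 : P (1, 0, 1) → P (0, 1, 1)) (h6 : P (0, 1, 1) → P (1, 1, 0))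
    (h7 : P (0, 0, 1) → P (1, 0, 0)) (h8 : P (1, 0, 0) → P (0, 1, 0)) (a : Spin) : P a := by
  obtain ⟨a, b, c⟩ := a
  fin_cases a <;> fin_cases b <;> fin_cases c
  exacts [h1, h4, h8 (h7 h4), h5 h3, h7 h4, h3, h6 (h5 h3), h2]

lemma measurable_source {κ₁ κ₂ : ℝ → ℂ} (h₁ : IsCoeff κ₁) (h₂ : IsCoeff κ₂) (η : L2S1) (a : Spin) :
    Measurable (source κ₁ κ₂ η a) := by
  have h0 := measurable_ext0 η
  refine forall_spin (P := fun a => Measurable (source κ₁ κ₂ η a)) (h0 _) (h0 _) (h0 _) (h0 _)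
    (fun h => ?_) (fun h => ?_) (fun h => ?_)
    (fun h => ?_) a
  · exact measurable_addReflected h₁ _ _ _ (h0 _) h
  · exact measurable_addReflected h₂ _ _ _ (h0 _) h
  · exact measurable_addReflected h₂ _ _ _ (h0 _) h
  · exact measurable_addReflected h₁ _ _ _ (h0 _) h

/-- A configuration in `S1` has its coordinates in the order x₁ < x₀ < x₂. The reflected copies of
`S1` have other orders, so every reflected term vanishes on `S1`. -/
lemma source_of_mem (κ₁ κ₂ : ℝ → ℂ) (η : L2S1) (a : Spin) {x : Config} (hx : x ∈ S1) :
    source κ₁ κ₂ η a x = comp a η x := by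
  have h0 : ∀ a {y : Config}, y ∉ S1 → ext0 η a y = 0 := fun a y hy => ext0_of_notMem η a hy
  rw [mem_S1] at hx
  have hx1 : sw1 x ∉ S1 := fun h => by
    rw [mem_S1] at h; exact lt_asymm h.1 hx.1
  have hx2 : sw2 x ∉ S1 := fun h => by
    rw [mem_S1] at h; exact lt_asymm h.2 hx.2
  have hx12 : sw1 (sw2 x) ∉ S1 := fun h => by
    rw [mem_S1] at h; exact lt_asymm (show x 2 < x 0 from h.1.trans h.2) hx.2
  have hx21 : sw2 (sw1 x) ∉ S1 := fun h => by
    rw [mem_S1] at h; exact lt_asymm (show x 0 < x 1 from h.1.trans h.2) hx.1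
  rw [← ext0_of_mem η a hx]
  refine forall_spin (P := fun a => source κ₁ κ₂ η a x = ext0 η a x) rfl rfl rfl rfl
    (fun _ => ?_) (fun _ => ?_) (fun _ => ?_) (fun _ => ?_) a
  · simp only [source, addReflected, h0 _ hx1, mul_zero, add_zero]
  · simp only [source, addReflected, h0 _ hx2, h0 _ hx12, mul_zero, add_zero]
  · simp only [source, addReflected, h0 _ hx2, mul_zero, add_zero]
  · simp only [source, addReflected, h0 _ hx1, h0 _ hx21, mul_zero, add_zero]

/-- The bound is free of the coefficients: it serves both the energy inequality and, uniformly in ε,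
as a dominating function for the limit. -/
lemma source_enorm_sq_le {κ₁ κ₂ : ℝ → ℂ} (h₁ : IsCoeff κ₁) (h₂ : IsCoeff κ₂) (η : L2S1) (a : Spin)
    (x : Config) : ‖source κ₁ κ₂ η a x‖ₑ ^ 2 ≤ sourceBound η a x := by
  have h0 : ∀ a {y : Config}, y ∉ S1 → ext0 η a y = 0 := fun a y hy => ext0_of_notMem η a hy
  have key : ∀ (y : Config) (a b : Spin) (s : Config → Config), (y ∈ S1 → s y ∈ S1 → False) →
      ext0 η a y = 0 ∨ ext0 η b (s y) = 0 := by
    intro y a b s h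
    by_cases hy : y ∈ S1
    · exact Or.inr (h0 _ fun hs => h hy hs)
    · exact Or.inl (h0 _ hy)
  have d1 : ∀ y : Config, y ∈ S1 → sw1 y ∈ S1 → False := fun y hy h => by
    rw [mem_S1] at h hy; exact lt_asymm h.1 hy.1
  have d2 : ∀ y : Config, y ∈ S1 → sw2 y ∈ S1 → False := fun y hy h => by
    rw [mem_S1] at h hy; exact lt_asymm h.2 hy.2
  have d12 : ∀ y : Config, y ∈ S1 → sw1 (sw2 y) ∈ S1 → False := fun y hy h => by
    rw [mem_S1] at h hy; exact lt_asymm (show y 2 < y 0 from h.1.trans h.2) hy.2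
  have d21 : ∀ y : Config, y ∈ S1 → sw2 (sw1 y) ∈ S1 → False := fun y hy h => by
    rw [mem_S1] at h hy; exact lt_asymm (show y 0 < y 1 from h.1.trans h.2) hy.1
  have e011 : ∀ y, ‖source κ₁ κ₂ η (0, 1, 1) y‖ₑ ^ 2 ≤ sourceBound η (0, 1, 1) y := fun y =>
    addReflected_enorm_le h₁ le_rfl le_rfl (key y _ _ _ (d1 y))
  have e100 : ∀ y, ‖source κ₁ κ₂ η (1, 0, 0) y‖ₑ ^ 2 ≤ sourceBound η (1, 0, 0) y := fun y =>
    addReflected_enorm_le h₂ le_rfl le_rfl (key y _ _ _ (d2 y))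
  refine forall_spin (P := fun a => ‖source κ₁ κ₂ η a x‖ₑ ^ 2 ≤ sourceBound η a x)
    le_rfl le_rfl le_rfl le_rfl (fun _ => e011 x) (fun _ => ?_) (fun _ => e100 x) (fun _ => ?_) a
  · refine addReflected_enorm_le h₂ le_rfl (e011 (sw2 x)) ?_
    by_cases hx : x ∈ S1
    · right
      simp only [addReflected, h0 _ (d2 x hx), h0 _ (d12 x hx), mul_zero, add_zero]
    · exact Or.inl (h0 _ hx)
  · refine addReflected_enorm_le h₁ le_rfl (e100 (sw1 x)) ?_
    by_cases hx : x ∈ S1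
    · right
      simp only [addReflected, h0 _ (d1 x hx), h0 _ (d21 x hx), mul_zero, add_zero]
    · exact Or.inl (h0 _ hx)

/-! ### The energy inequality -/

lemma sw_sw {π : Equiv.Perm (Fin 3)} (hπ : ∀ k, π (π k) = k) (x : Config) : sw π (sw π x) = x := by
  ext k; simp only [sw, hπ]

/-- The coordinate permutations preserve volume. As they are involutions, the inverse of the
composition has the factors in reverse order. -/
lemma setLIntegral_comp_sw_sw {π π' : Equiv.Perm (Fin 3)} (hπ : ∀ k, π (π k) = k)
    (hπ' : ∀ k, π' (π' k) = k) {F : Config → ℝ≥0∞} (hF : Measurable F) :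
    ∫⁻ x in (S1 : Set Config), F (sw π (sw π' x))
      = ∫⁻ x in {y | sw π' (sw π y) ∈ (S1 : Set Config)}, F x := by
  have hs : MeasurableSet {y | sw π' (sw π y) ∈ (S1 : Set Config)} :=
    S1.isOpen.measurableSet.preimage ((measurable_sw π').comp (measurable_sw π))
  rw [← ((measurePreserving_sw π).comp (measurePreserving_sw π')).setLIntegral_comp_preimage hs hF]
  congr 2
  ext x
  simp only [mem_preimage, mem_ofPred_eq, Function.comp_apply, sw_sw hπ, sw_sw hπ']

lemma setLIntegral_comp_sw {π : Equiv.Perm (Fin 3)} (hπ : ∀ k, π (π k) = k)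
    {F : Config → ℝ≥0∞} (hF : Measurable F) :
    ∫⁻ x in (S1 : Set Config), F (sw π x) = ∫⁻ x in {y | sw π y ∈ (S1 : Set Config)}, F x :=
  setLIntegral_comp_sw_sw (π' := 1) hπ (fun _ => rfl) hF

/-- The waves reaching `S1` directly, after one reflection and after two reflections come from
disjoint sets. -/
lemma chain_energy {π π' : Equiv.Perm (Fin 3)} (hπ : ∀ k, π (π k) = k) (hπ' : ∀ k, π' (π' k) = k)
    (h1 : ∀ y ∈ S1, sw π y ∉ S1) (h1' : ∀ y ∈ S1, sw π' y ∉ S1)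
    (h2 : ∀ y ∈ S1, sw π' (sw π y) ∉ S1) {F G H : Config → ℝ≥0∞} (hF : Measurable F)
    (hG : Measurable G) (hH : Measurable H) :
    (∫⁻ x in (S1 : Set Config), F x) + (∫⁻ x in (S1 : Set Config), (G x + F (sw π x)))
      + (∫⁻ x in (S1 : Set Config), (H x + (G (sw π' x) + F (sw π (sw π' x)))))
      ≤ (∫⁻ x, F x) + (∫⁻ x, G x) + ∫⁻ x, H x := by
  have mS : MeasurableSet (S1 : Set Config) := S1.isOpen.measurableSet
  have mB : MeasurableSet {y | sw π y ∈ (S1 : Set Config)} := mS.preimage (measurable_sw π)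
  have mB' : MeasurableSet {y | sw π' y ∈ (S1 : Set Config)} := mS.preimage (measurable_sw π')
  have mC : MeasurableSet {y | sw π' (sw π y) ∈ (S1 : Set Config)} :=
    mS.preimage ((measurable_sw π').comp (measurable_sw π))
  -- The source F starts the chain and is seen from three disjoint chambers: directly, after one
  -- reflection and after two. G is seen from two chambers and H from one.
  have eF : (∫⁻ x in (S1 : Set Config), F x) + (∫⁻ x in {y | sw π y ∈ (S1 : Set Config)}, F x)
      + (∫⁻ x in {y | sw π' (sw π y) ∈ (S1 : Set Config)}, F x) ≤ ∫⁻ x, F x := by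
    rw [← lintegral_union mB, ← lintegral_union mC]
    · exact setLIntegral_le_lintegral _ _
    · rw [Set.disjoint_left]
      rintro y (hy | hy) hy'
      · exact h2 y hy hy'
      · exact h1' (sw π y) hy hy'
    · exact Set.disjoint_left.2 fun y hy hy' => h1 y hy hy'
  have eG : (∫⁻ x in (S1 : Set Config), G x) + (∫⁻ x in {y | sw π' y ∈ (S1 : Set Config)}, G x)
      ≤ ∫⁻ x, G x := by
    rw [← lintegral_union mB']
    · exact setLIntegral_le_lintegral _ _
    · exact Set.disjoint_left.2 fun y hy hy' => h1' y hy hy'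
  have hG' : Measurable fun x => G (sw π' x) := hG.comp (measurable_sw π')
  rw [lintegral_add_left hG, lintegral_add_left hH, lintegral_add_left hG', setLIntegral_comp_sw hπ hF,
    setLIntegral_comp_sw hπ' hG, setLIntegral_comp_sw_sw hπ hπ' hF]
  have eH : ∫⁻ x in (S1 : Set Config), H x ≤ ∫⁻ x, H x := setLIntegral_le_lintegral _ _
  refine le_trans (le_of_eq ?_) (add_le_add (add_le_add eF eG) eH)
  ring

lemma sum_spin {M : Type*} [AddCommMonoid M] (f : Spin → M) : ∑ a, f a =
    f (0, 0, 0) + f (1, 1, 1) + (f (1, 0, 1) + f (0, 1, 1) + f (1, 1, 0))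
      + (f (0, 0, 1) + f (1, 0, 0) + f (0, 1, 0)) := by
  simp only [Fintype.sum_prod_type, Fin.sum_univ_two]
  abel

/-- At each fixed time, for each chain, the reflection carries the flow of one component to that of
the next, so the translated bounds have the form required by `chain_energy`. The two components
without reflections are bounded directly. -/
lemma sum_sourceBound_le (η : L2S1) (t : ℝ) :
    ∑ a, ∫⁻ x in (S1 : Set Config), sourceBound η a (x - t • vel a)
      ≤ ∑ a, ∫⁻ x, ‖ext0 η a x‖ₑ ^ 2 := by
  have hm : ∀ a, Measurable fun x => ‖ext0 η a (x - t • vel a)‖ₑ ^ 2 := fun a =>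
    ((measurable_ext0 η a).comp (by fun_prop)).enorm.pow_const 2
  have htr : ∀ a, ∫⁻ x, ‖ext0 η a (x - t • vel a)‖ₑ ^ 2 = ∫⁻ x, ‖ext0 η a x‖ₑ ^ 2 := fun a =>
    lintegral_translate (fun x => ‖ext0 η a x‖ₑ ^ 2) _
  have i1 : ∀ k : Fin 3, Equiv.swap 0 1 (Equiv.swap 0 1 k) = k := fun k => Equiv.swap_apply_self _ _ k |>.symm ▸ rfl
  have i2 : ∀ k : Fin 3, Equiv.swap 0 2 (Equiv.swap 0 2 k) = k := fun k => Equiv.swap_apply_self _ _ k |>.symm ▸ rfl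
  have d1 : ∀ y ∈ S1, sw1 y ∉ S1 := fun y hy h => by
    rw [mem_S1] at h hy; exact lt_asymm h.1 hy.1
  have d2 : ∀ y ∈ S1, sw2 y ∉ S1 := fun y hy h => by
    rw [mem_S1] at h hy; exact lt_asymm h.2 hy.2
  have d12 : ∀ y ∈ S1, sw1 (sw2 y) ∉ S1 := fun y hy h => by
    rw [mem_S1] at h hy; exact lt_asymm (show y 2 < y 0 from h.1.trans h.2) hy.2
  have d21 : ∀ y ∈ S1, sw2 (sw1 y) ∉ S1 := fun y hy h => by
    rw [mem_S1] at h hy; exact lt_asymm (show y 0 < y 1 from h.1.trans h.2) hy.1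
  have c1 := chain_energy i1 i2 d1 d2 d21 (hm (1, 0, 1)) (hm (0, 1, 1)) (hm (1, 1, 0))
  have c2 := chain_energy i2 i1 d2 d1 d12 (hm (0, 0, 1)) (hm (1, 0, 0)) (hm (0, 1, 0))
  simp only [htr] at c1 c2
  rw [sum_spin, sum_spin]
  have e1 : ∀ c x, sw1 (x - t • vel (0, 1, c)) = sw1 x - t • vel (1, 0, c) := fun c x => by
    exact (sw_sub_smul _ _ _ _).trans (congrArg (fun v => sw1 x - t • v) (sw1_vel c))
  have e2 : ∀ b x, sw2 (x - t • vel (1, b, 0)) = sw2 x - t • vel (0, b, 1) := fun b x => by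
    exact (sw_sub_smul _ _ _ _).trans (congrArg (fun v => sw2 x - t • v) (sw2_vel b))
  refine add_le_add (add_le_add (add_le_add ?_ ?_) (le_trans (le_of_eq ?_) c1))
    (le_trans (le_of_eq ?_) c2)
  · exact (setLIntegral_le_lintegral _ _).trans_eq (htr (0, 0, 0))
  · exact (setLIntegral_le_lintegral _ _).trans_eq (htr (1, 1, 1))
  · simp only [sourceBound, e1, e2]
  · simp only [sourceBound, e1, e2]

lemma measurable_sourceBound (η : L2S1) (a : Spin) : Measurable (sourceBound η a) := by
  have h0 : ∀ a, Measurable fun x => ‖ext0 η a x‖ₑ ^ 2 := fun a =>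
    (measurable_ext0 η a).enorm.pow_const 2
  have m := measurable_sw
  refine forall_spin (P := fun a => Measurable (sourceBound η a)) (h0 _) (h0 _) (h0 _) (h0 _)
    (fun _ => ?_) (fun _ => ?_) (fun _ => ?_) (fun _ => ?_) a
  · exact (h0 _).add ((h0 _).comp (m _))
  · exact (h0 _).add (((h0 _).comp (m _)).add ((h0 _).comp ((m _).comp (m _))))
  · exact (h0 _).add ((h0 _).comp (m _))
  · exact (h0 _).add (((h0 _).comp (m _)).add ((h0 _).comp ((m _).comp (m _))))

lemma lintegral_sourceBound_ne_top (η : L2S1) (a : Spin) : ∫⁻ x, sourceBound η a x ≠ ⊤ := by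
  have h0 : ∀ a, Measurable fun x => ‖ext0 η a x‖ₑ ^ 2 := fun a =>
    (measurable_ext0 η a).enorm.pow_const 2
  have f0 := lintegral_ext0_ne_top η
  have f1 : ∀ a π, ∫⁻ x, ‖ext0 η a (sw π x)‖ₑ ^ 2 ≠ ⊤ := fun a π => by
    rw [(measurePreserving_sw π).lintegral_comp (h0 a)]; exact f0 a
  have f2 : ∀ a π π', ∫⁻ x, ‖ext0 η a (sw π (sw π' x))‖ₑ ^ 2 ≠ ⊤ := fun a π π' => by
    have := ((measurePreserving_sw π).comp (measurePreserving_sw π')).lintegral_comp (h0 a)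
    exact this.trans_ne (f0 a)
  have h0' : ∀ a π, Measurable fun x => ‖ext0 η a (sw π x)‖ₑ ^ 2 := fun a π =>
    (h0 a).comp (measurable_sw π)
  refine forall_spin (P := fun a => ∫⁻ x, sourceBound η a x ≠ ⊤) (f0 _) (f0 _) (f0 _) (f0 _)
    (fun _ => ?_) (fun _ => ?_) (fun _ => ?_) (fun _ => ?_) a
  · simp only [sourceBound]
    rw [lintegral_add_left (h0 _)]
    exact ENNReal.add_ne_top.2 ⟨f0 _, f1 _ _⟩
  · simp only [sourceBound]
    rw [lintegral_add_left (h0 _), lintegral_add_left (h0' _ _)]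
    exact ENNReal.add_ne_top.2 ⟨f0 _, ENNReal.add_ne_top.2 ⟨f1 _ _, f2 _ _ _⟩⟩
  · simp only [sourceBound]
    rw [lintegral_add_left (h0 _)]
    exact ENNReal.add_ne_top.2 ⟨f0 _, f1 _ _⟩
  · simp only [sourceBound]
    rw [lintegral_add_left (h0 _), lintegral_add_left (h0' _ _)]
    exact ENNReal.add_ne_top.2 ⟨f0 _, ENNReal.add_ne_top.2 ⟨f1 _ _, f2 _ _ _⟩⟩

lemma lintegral_source_ne_top {κ₁ κ₂ : ℝ → ℂ} (h₁ : IsCoeff κ₁) (h₂ : IsCoeff κ₂) (η : L2S1)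
    (a : Spin) : ∫⁻ x, ‖source κ₁ κ₂ η a x‖ₑ ^ 2 ≠ ⊤ :=
  ne_top_of_le_ne_top (lintegral_sourceBound_ne_top η a)
    (lintegral_mono fun x => source_enorm_sq_le h₁ h₂ η a x)

/-! ### Solutions of the boundary value problem -/

lemma enorm_sq_C8 (x : C8) : ‖x‖ₑ ^ 2 = ∑ a, ‖x a‖ₑ ^ 2 := by
  have h := EuclideanSpace.norm_sq_eq x
  rw [← ofReal_norm, ← ENNReal.ofReal_pow (norm_nonneg _), h,
    ENNReal.ofReal_sum_of_nonneg fun _ _ => sq_nonneg _]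
  refine Finset.sum_congr rfl fun a _ => ?_
  rw [ENNReal.ofReal_pow (norm_nonneg _), ofReal_norm]

lemma enorm_sq_L2 (Ψ : L2S1) : ‖Ψ‖ₑ ^ 2 = ∑ a, ∫⁻ x, ‖comp a Ψ x‖ₑ ^ 2 ∂volS1 := by
  rw [Lp.enorm_def, ← lintegral_sq_eq_eLpNorm,
    ← lintegral_finsetSum _ fun a _ => (measurable_comp a Ψ).enorm.pow_const 2]
  exact lintegral_congr fun x => enorm_sq_C8 _

/-- `Ψ` is given by the resolvents of the unfolded sources. -/
def IsSolution (l : ℝ) (κ₁ κ₂ : ℝ → ℂ) (η Ψ : L2S1) : Prop :=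
  ∀ a, comp a Ψ =ᵐ[volS1] resolv l (vel a) (source κ₁ κ₂ η a)

section Solution

variable {l : ℝ} {κ₁ κ₂ : ℝ → ℂ}

lemma exists_isSolution (hl : 0 < l) (h₁ : IsCoeff κ₁) (h₂ : IsCoeff κ₂) (η : L2S1) :
    ∃ Ψ, IsSolution l κ₁ κ₂ η Ψ := by
  let u : Config → C8 := fun x => WithLp.toLp 2 fun a => resolv l (vel a) (source κ₁ κ₂ η a) x
  have hr : ∀ a, Measurable (resolv l (vel a) (source κ₁ κ₂ η a)) := fun a =>
    measurable_resolv l (vel a) (measurable_source h₁ h₂ η a)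
  have hum : Measurable u :=
    (PiLp.continuous_toLp 2 _).measurable.comp (measurable_pi_iff.2 hr)
  have hu : MemLp u 2 volS1 := by
    refine memLp_two_of_lintegral hum.aestronglyMeasurable ?_
    simp only [enorm_sq_C8]
    rw [lintegral_finsetSum _ fun a _ => (hr a).enorm.pow_const 2]
    refine ENNReal.sum_ne_top.2 fun a _ => ?_
    refine ne_top_of_le_ne_top ?_ ((setLIntegral_le_lintegral _ _).trans
      (lintegral_resolv_le hl (vel a) (measurable_source h₁ h₂ η a)))
    exact ENNReal.mul_ne_top ENNReal.ofReal_ne_top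
      (ENNReal.mul_ne_top ENNReal.ofReal_ne_top (lintegral_source_ne_top h₁ h₂ η a))
  refine ⟨hu.toLp u, fun a => ?_⟩
  filter_upwards [hu.coeFn_toLp] with x hx
  change hu.toLp u x a = _
  rw [hx]

/-- One factor 1/l comes from Cauchy-Schwarz with weight e^{-lt}, the other from integrating the
weight against the time-independent energy bound. The sum over components must be taken inside the
time integral, since only the total energy is controlled. -/
lemma IsSolution.norm_le (hl : 0 < l) (h₁ : IsCoeff κ₁) (h₂ : IsCoeff κ₂) {η Ψ : L2S1}
    (h : IsSolution l κ₁ κ₂ η Ψ) : ‖(l : ℂ) • Ψ‖ ≤ ‖η‖ := by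
  have hinv : ENNReal.ofReal l * ENNReal.ofReal (1 / l) = 1 := by
    rw [← ENNReal.ofReal_mul hl.le, mul_one_div_cancel hl.ne', ENNReal.ofReal_one]
  have key : ‖Ψ‖ₑ ^ 2 ≤ ENNReal.ofReal (1 / l) * (ENNReal.ofReal (1 / l) * ‖η‖ₑ ^ 2) := by
    calc ‖Ψ‖ₑ ^ 2 = ∑ a, ∫⁻ x, ‖resolv l (vel a) (source κ₁ κ₂ η a) x‖ₑ ^ 2 ∂volS1 := by
          rw [enorm_sq_L2]
          refine Finset.sum_congr rfl fun a _ => lintegral_congr_ae ?_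
          filter_upwards [h a] with x hx
          rw [hx]
      _ ≤ ∑ a, ENNReal.ofReal (1 / l) * ∫⁻ t in Ioi (0 : ℝ), expWeight l t *
            ∫⁻ x, sourceBound η a (x - t • vel a) ∂volS1 := by
          refine Finset.sum_le_sum fun a _ =>
            (setLIntegral_resolv_le hl (vel a) (measurable_source h₁ h₂ η a) volS1).trans ?_
          refine mul_le_mul_right (lintegral_mono fun t => mul_le_mul_right
            (lintegral_mono fun x => source_enorm_sq_le h₁ h₂ η a _) _) _
      _ = ENNReal.ofReal (1 / l) * ∫⁻ t in Ioi (0 : ℝ), expWeight l t *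
            ∑ a, ∫⁻ x, sourceBound η a (x - t • vel a) ∂volS1 := by
          rw [← Finset.mul_sum, ← lintegral_finsetSum]
          · simp only [Finset.mul_sum]
          · intro a _
            refine (measurable_expWeight l).mul ?_
            refine Measurable.lintegral_prod_right (f := fun t x => sourceBound η a (x - t • vel a)) ?_
            exact (measurable_sourceBound η a).comp (by fun_prop)
      _ ≤ ENNReal.ofReal (1 / l) * ∫⁻ t in Ioi (0 : ℝ), expWeight l t * ‖η‖ₑ ^ 2 := by
          refine mul_le_mul_right (lintegral_mono fun t => mul_le_mul_right ?_ _) _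
          refine (sum_sourceBound_le η t).trans_eq ?_
          rw [enorm_sq_L2]
          exact Finset.sum_congr rfl fun a _ => lintegral_ext0 η a
      _ = _ := by rw [lintegral_mul_const _ (measurable_expWeight l), lintegral_expWeight hl]
  have h2 : ‖(l : ℂ) • Ψ‖ₑ ^ 2 ≤ ‖η‖ₑ ^ 2 := by
    have e : ‖(l : ℂ)‖ₑ = ENNReal.ofReal l := by
      rw [← ofReal_norm, Complex.norm_real, Real.norm_of_nonneg hl.le]
    rw [enorm_smul, e, mul_pow]
    calc ENNReal.ofReal l ^ 2 * ‖Ψ‖ₑ ^ 2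
        ≤ ENNReal.ofReal l ^ 2 * (ENNReal.ofReal (1 / l) * (ENNReal.ofReal (1 / l) * ‖η‖ₑ ^ 2)) :=
          mul_le_mul_right key _
      _ = (ENNReal.ofReal l * ENNReal.ofReal (1 / l)) *
            (ENNReal.ofReal l * ENNReal.ofReal (1 / l)) * ‖η‖ₑ ^ 2 := by ring
      _ = ‖η‖ₑ ^ 2 := by rw [hinv, one_mul, one_mul]
  rw [← ofReal_norm, ← ofReal_norm, ← ENNReal.ofReal_pow (norm_nonneg _),
    ← ENNReal.ofReal_pow (norm_nonneg _), ENNReal.ofReal_le_ofReal_iff (sq_nonneg _)] at h2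
  exact le_of_sq_le_sq h2 (norm_nonneg _)

/-- The whole-space equation of the free resolvent is tested only with functions supported in `S1`,
where the unfolded source equals η. -/
lemma IsSolution.weakTransport (hl : 0 < l) (h₁ : IsCoeff κ₁) (h₂ : IsCoeff κ₂) {η Ψ : L2S1}
    (h : IsSolution l κ₁ κ₂ η Ψ) (a : Spin) :
    WeakTransport (vel a) (comp a Ψ) (comp a ((l : ℂ) • Ψ - η)) := by
  intro φ hφ hc hs
  have hd : MemLp (fun x => fderiv ℝ φ x (vel a)) 2 volS1 :=
    ((hφ.continuous_fderiv (by simp)).clm_apply continuous_const).memLp_of_hasCompactSupport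
      (hc.fderiv_apply ℝ (vel a))
  have hout : ∀ x, x ∉ (S1 : Set Config) → φ x = 0 ∧ fderiv ℝ φ x (vel a) = 0 := by
    intro x hx
    have hx' : x ∉ tsupport φ := fun h => hx (hs h)
    refine ⟨image_eq_zero_of_notMem_tsupport hx', ?_⟩
    have : fderiv ℝ φ x = 0 := by
      by_contra hne
      exact hx' (support_fderiv_subset ℝ hne)
    rw [this]; rfl
  have h1 := integral_conj_resolv_mul hl (vel a) (measurable_source h₁ h₂ η a)
    (lintegral_source_ne_top h₁ h₂ η a) hφ hc
  rw [← integral_volS1_eq fun x hx => by rw [(hout x hx).1, (hout x hx).2]; simp,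
    ← integral_volS1_eq fun x hx => by rw [(hout x hx).1]; simp] at h1
  have h2 : ∫ x, (starRingEnd ℂ) (comp a Ψ x) * (l * φ x - fderiv ℝ φ x (vel a)) ∂volS1
      = ∫ x, (starRingEnd ℂ) (comp a η x) * φ x ∂volS1 := by
    have e1 : ∫ x, (starRingEnd ℂ) (comp a Ψ x) * (l * φ x - fderiv ℝ φ x (vel a)) ∂volS1
        = ∫ x, (starRingEnd ℂ) (resolv l (vel a) (source κ₁ κ₂ η a) x) *
          (l * φ x - fderiv ℝ φ x (vel a)) ∂volS1 := by
      refine integral_congr_ae ?_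
      filter_upwards [h a] with x hx
      rw [hx]
    rw [e1, h1]
    refine setIntegral_congr_fun S1.isOpen.measurableSet fun x hx => ?_
    simp only [source_of_mem κ₁ κ₂ η a hx]
  have hΨ := memLp_comp a Ψ
  have i1 : Integrable (fun x => (starRingEnd ℂ) (comp a Ψ x) * (l * φ x)) volS1 :=
    hΨ.star.integrable_mul ((memLp_test hφ hc _).const_mul (l : ℂ))
  have i2 : Integrable (fun x => (starRingEnd ℂ) (comp a Ψ x) * fderiv ℝ φ x (vel a)) volS1 :=
    hΨ.star.integrable_mul hd
  have i3 : Integrable (fun x => (starRingEnd ℂ) (comp a η x) * φ x) volS1 :=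
    (memLp_comp a η).star.integrable_mul (memLp_test hφ hc _)
  simp only [mul_sub] at h2
  rw [integral_sub i1 i2] at h2
  have e2 : ∫ x, (starRingEnd ℂ) (comp a ((l : ℂ) • Ψ - η) x) * φ x ∂volS1
      = ∫ x, ((starRingEnd ℂ) (comp a Ψ x) * (l * φ x) - (starRingEnd ℂ) (comp a η x) * φ x)
        ∂volS1 := by
    refine integral_congr_ae ?_
    filter_upwards [Lp.coeFn_sub ((l : ℂ) • Ψ) η, Lp.coeFn_smul (l : ℂ) Ψ] with x hx1 hx2
    have : comp a ((l : ℂ) • Ψ - η) x = l * comp a Ψ x - comp a η x := by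
      change ((l : ℂ) • Ψ - η : L2S1) x a = _
      rw [hx1, Pi.sub_apply, hx2]
      rfl
    rw [this, map_sub, map_mul, Complex.conj_ofReal]
    ring
  rw [e2, integral_sub i1 i3, ← h2]
  ring

/-- Behind the face the direct source f is absent. The reflection fixes y and carries the flow line
of v to that of w, while v i = v j keeps the coefficient constant along the line, so it can be taken
out of the integral. -/
lemma resolv_addReflected (l : ℝ) (κ : ℝ → ℂ) {i j : Fin 3} {π : Equiv.Perm (Fin 3)} {f g : Config → ℂ}
    {v w y : Config} (hvw : sw π v = w) (hij : v i = v j)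
    (hf : ∀ t : ℝ, 0 < t → f (y - t • v) = 0) (hy : sw π y = y) :
    resolv l v (addReflected κ i j π f g) y = κ |y i - y j| * resolv l w g y := by
  unfold resolv
  rw [← integral_const_mul]
  refine setIntegral_congr_fun measurableSet_Ioi fun t ht => ?_
  simp only [addReflected]
  rw [hf t ht, sw_sub_smul, hvw, hy, zero_add]
  have : (y - t • v) i - (y - t • v) j = y i - y j := by
    simp only [Pi.sub_apply, Pi.smul_apply, hij]; ring
  rw [this]
  ring

lemma ext0_slice1_sub (η : L2S1) (c : Fin 2) (q : ℝ × ℝ) {t : ℝ} (ht : 0 < t) :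
    ext0 η (0, 1, c) (slice1 0 q - t • vel (0, 1, c)) = 0 := by
  refine ext0_of_notMem η _ fun h => ?_
  have := (mem_S1.1 h).1
  simp only [slice1, relPoint, Pi.sub_apply, Pi.smul_apply, vel_apply_one, vel_apply_zero, sgn_zero,
    sgn_one, smul_eq_mul, Matrix.cons_val_zero, Matrix.cons_val_one] at this
  linarith

lemma ext0_slice2_sub (η : L2S1) (b : Fin 2) (q : ℝ × ℝ) {t : ℝ} (ht : 0 < t) :
    ext0 η (1, b, 0) (slice2 0 q - t • vel (1, b, 0)) = 0 := by
  refine ext0_of_notMem η _ fun h => ?_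
  have := (mem_S1.1 h).2
  simp only [slice2, relPoint, Pi.sub_apply, Pi.smul_apply, vel_apply_two, vel_apply_zero, sgn_zero,
    sgn_one, smul_eq_mul, Matrix.cons_val_zero, Matrix.cons_val] at this
  linarith

lemma resolv_source_slice1 (l : ℝ) (κ₁ κ₂ : ℝ → ℂ) (η : L2S1) (c : Fin 2) (q : ℝ × ℝ) :
    resolv l (vel (0, 1, c)) (source κ₁ κ₂ η (0, 1, c)) (slice1 0 q)
      = κ₁ (elDist (slice1 0 q)) *
        resolv l (vel (1, 0, c)) (source κ₁ κ₂ η (1, 0, c)) (slice1 0 q) := by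
  fin_cases c
  -- In this component the second electron moves with the photon, so the distance conserved along
  -- the flow is |x₀ - x₂|. On `C₁`, where x₀ = x₁, it is the electron distance.
  · have e : slice1 0 q 0 = slice1 0 q 1 := by simp [slice1, relPoint]
    have := resolv_addReflected l κ₁ (i := 0) (j := 2) (g := source κ₁ κ₂ η (1, 0, 0)) (sw1_vel 0) rfl
      (fun t ht => ext0_slice1_sub η 0 q ht) (sw1_slice1 q)
    rw [e] at this
    exact this
  · exact resolv_addReflected l κ₁ (i := 1) (j := 2) (g := source κ₁ κ₂ η (1, 0, 1)) (sw1_vel 1) rfl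
      (fun t ht => ext0_slice1_sub η 1 q ht) (sw1_slice1 q)

lemma resolv_source_slice2 (l : ℝ) (κ₁ κ₂ : ℝ → ℂ) (η : L2S1) (b : Fin 2) (q : ℝ × ℝ) :
    resolv l (vel (1, b, 0)) (source κ₁ κ₂ η (1, b, 0)) (slice2 0 q)
      = κ₂ (elDist (slice2 0 q)) *
        resolv l (vel (0, b, 1)) (source κ₁ κ₂ η (0, b, 1)) (slice2 0 q) := by
  fin_cases b
  · exact resolv_addReflected l κ₂ (i := 1) (j := 2) (g := source κ₁ κ₂ η (0, 0, 1)) (sw2_vel 0) rfl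
      (fun t ht => ext0_slice2_sub η 0 q ht) (sw2_slice2 q)
  · have e : slice2 0 q 0 = slice2 0 q 2 := by simp [slice2, relPoint]
    have := resolv_addReflected l κ₂ (i := 0) (j := 1) (g := source κ₁ κ₂ η (0, 1, 1)) (sw2_vel 1) rfl
      (fun t ht => ext0_slice2_sub η 1 q ht) (sw2_slice2 q)
    rw [e, abs_sub_comm] at this
    exact this

lemma IsSolution.hasTrace (hl : 0 < l) (h₁ : IsCoeff κ₁) (h₂ : IsCoeff κ₂) {η Ψ : L2S1}
    (h : IsSolution l κ₁ κ₂ η Ψ) {e : (ℝ × (ℝ × ℝ)) ≃L[ℝ] Config} {σ : ℝ → ℝ × ℝ → Config}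
    (he : IsFace e σ) {a : Spin} (hv : (e.symm (vel a)).1 ≠ 0) :
    HasTrace σ (comp a Ψ) fun q => resolv l (vel a) (source κ₁ κ₂ η a) (σ 0 q) :=
  (he.hasTrace_resolv hv hl (measurable_source h₁ h₂ η a)
    (lintegral_source_ne_top h₁ h₂ η a)).congr he.goodSlices (h a).symm

end Solution

/-- The reflection coefficient with phase `θ`. -/
def coeff (μ : ℝ → ℝ) (θ : ℝ) (r : ℝ) : ℂ := (μ r : ℂ) * Complex.exp (Complex.I * θ)

lemma IsSolution.mem_evolGraph {l θ₁ θ₂ : ℝ} {μ : ℝ → ℝ} (hl : 0 < l)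
    (h₁ : IsCoeff (coeff μ θ₁)) (h₂ : IsCoeff (coeff μ θ₂)) {η Ψ : L2S1}
    (h : IsSolution l (coeff μ θ₁) (coeff μ θ₂) η Ψ) :
    (Ψ, (l : ℂ) • Ψ - η) ∈ evolGraph θ₁ θ₂ μ := by
  rw [ElPhEl.mem_evolGraph]
  refine ⟨⟨fun c => ⟨_, h.hasTrace hl h₁ h₂ isFace1 (a := (1, 0, c)) ?_, ?_⟩,
    fun b => ⟨_, h.hasTrace hl h₁ h₂ isFace2 (a := (0, b, 1)) ?_, ?_⟩⟩, h.weakTransport hl h₁ h₂⟩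
  · rw [faceEquiv1_symm_vel_out]; norm_num
  · have := h.hasTrace hl h₁ h₂ isFace1 (a := (0, 1, c)) (by
      rw [faceEquiv1_symm_vel_in]; norm_num)
    simp only [resolv_source_slice1] at this
    exact this
  · rw [faceEquiv2_symm_vel_out]; norm_num
  · have := h.hasTrace hl h₁ h₂ isFace2 (a := (1, b, 0)) (by
      rw [faceEquiv2_symm_vel_in]; norm_num)
    simp only [resolv_source_slice2] at this
    exact this

lemma isContractive_evolGraph {θ₁ θ₂ : ℝ} {μ : ℝ → ℝ} (h₁ : IsCoeff (coeff μ θ₁))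
    (h₂ : IsCoeff (coeff μ θ₂)) : IsContractive (evolGraph θ₁ θ₂ μ) where
  exists_resolvent l hl η := by
    obtain ⟨Ψ, h⟩ := exists_isSolution hl h₁ h₂ η
    exact ⟨Ψ, h.mem_evolGraph hl h₁ h₂, h.norm_le hl h₁ h₂⟩
  eq_zero _ hl _ h := evolGraph_eq_zero hl h

/-! ### The limit of the resolvents -/

/-- The function μ is controlled only on [0, ∞), so measurability is obtained for its composition
with a distance, not for μ itself. -/
lemma IsTransition.isCoeff {ε : ℝ} {μ : ℝ → ℝ} (h : IsTransition ε μ) (θ : ℝ) :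
    IsCoeff (coeff μ θ) where
  measurable i j := by
    have hc : Continuous fun x : Config => μ |x i - x j| :=
      h.smooth.continuousOn.comp_continuous (by fun_prop) fun x => abs_nonneg (x i - x j)
    exact (Complex.measurable_ofReal.comp hc.measurable).mul_const _
  norm_le r hr := by
    have := h.mem_Icc r hr
    rw [coeff, mul_comm Complex.I, norm_mul, Complex.norm_exp_ofReal_mul_I, mul_one,
      Complex.norm_real, Real.norm_of_nonneg this.1]
    exact this.2

lemma isCoeff_coeff_one (θ : ℝ) : IsCoeff (coeff (fun _ => 1) θ) where
  measurable i j := measurable_const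
  norm_le r hr := by
    rw [coeff, mul_comm Complex.I, norm_mul, Complex.norm_exp_ofReal_mul_I, mul_one]
    simp

/-- By linearity the difference of two solutions for the same η is the resolvent of the difference
of the sources, and the free bound on the whole space suffices. -/
lemma IsSolution.enorm_sq_sub_le {l : ℝ} (hl : 0 < l) {κ₁ κ₂ κ₁' κ₂' : ℝ → ℂ} (h₁ : IsCoeff κ₁)
    (h₂ : IsCoeff κ₂) (h₁' : IsCoeff κ₁') (h₂' : IsCoeff κ₂') {η Ψ Ψ' : L2S1}
    (h : IsSolution l κ₁ κ₂ η Ψ) (h' : IsSolution l κ₁' κ₂' η Ψ') :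
    ‖Ψ - Ψ'‖ₑ ^ 2 ≤ ∑ a, ENNReal.ofReal (1 / l) * (ENNReal.ofReal (1 / l) *
      ∫⁻ x, ‖source κ₁ κ₂ η a x - source κ₁' κ₂' η a x‖ₑ ^ 2) := by
  rw [enorm_sq_L2]
  refine Finset.sum_le_sum fun a _ => ?_
  have m := measurable_source h₁ h₂ η a
  have m' := measurable_source h₁' h₂' η a
  refine le_trans (le_of_eq ?_) ((setLIntegral_le_lintegral (S1 : Set Config) _).trans
    (lintegral_resolv_le hl (vel a) (m.sub m')))
  refine lintegral_congr_ae ?_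
  filter_upwards [Lp.coeFn_sub Ψ Ψ', h a, h' a,
    ae_restrict_of_ae (ae_kernel_ne_top hl (vel a) m (lintegral_source_ne_top h₁ h₂ η a)),
    ae_restrict_of_ae (ae_kernel_ne_top hl (vel a) m' (lintegral_source_ne_top h₁' h₂' η a))]
    with x hx hx1 hx2 hk hk'
  have e : comp a (Ψ - Ψ') x = comp a Ψ x - comp a Ψ' x := by
    change (Ψ - Ψ' : L2S1) x a = _
    rw [hx]
    rfl
  rw [e, hx1, hx2, ← resolv_sub hl m m' hk hk']

lemma addReflected_congr {κ κ' : ℝ → ℂ} {i j : Fin 3} {π : Equiv.Perm (Fin 3)} {f g g' : Config → ℂ}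
    {x : Config} (hg : g (sw π x) = g' (sw π x))
    (hκ : g' (sw π x) ≠ 0 → κ |x i - x j| = κ' |x i - x j|) :
    addReflected κ i j π f g x = addReflected κ' i j π f g' x := by
  unfold addReflected
  rw [hg]
  by_cases h : g' (sw π x) = 0
  · rw [h, mul_zero, mul_zero]
  · rw [hκ h]

/-- Sources live on permuted copies of `S1`, where the three coordinates are distinct. Hence the
distance in each reflection coefficient is positive wherever it matters. -/
lemma ne_of_source_ne_zero (κ₁ κ₂ : ℝ → ℂ) (η : L2S1) (a : Spin) {x : Config}
    (h : source κ₁ κ₂ η a x ≠ 0) : x 0 ≠ x 1 ∧ x 1 ≠ x 2 ∧ x 0 ≠ x 2 := by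
  have h0 : ∀ a (x : Config), ext0 η a x ≠ 0 → x 0 ≠ x 1 ∧ x 1 ≠ x 2 ∧ x 0 ≠ x 2 := by
    intro a x hx
    have := mem_S1.1 (mem_of_ext0_ne_zero hx)
    exact ⟨this.1.ne', (this.1.trans this.2).ne, this.2.ne⟩
  have hu : ∀ (κ : ℝ → ℂ) (i j : Fin 3) (π : Equiv.Perm (Fin 3)) (a : Spin) (g : Config → ℂ)
      (x : Config), addReflected κ i j π (ext0 η a) g x ≠ 0 →
        (x 0 ≠ x 1 ∧ x 1 ≠ x 2 ∧ x 0 ≠ x 2) ∨ g (sw π x) ≠ 0 := by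
    intro κ i j π a g x hx
    by_contra! hc
    refine hx ?_
    have : ext0 η a x = 0 := by
      by_contra hne
      obtain ⟨h1, h2, h3⟩ := h0 a x hne
      exact h3 (hc.1 h1 h2)
    rw [addReflected, this, hc.2, mul_zero, add_zero]
  revert x
  refine forall_spin (P := fun a => ∀ {x : Config}, source κ₁ κ₂ η a x ≠ 0 →
    x 0 ≠ x 1 ∧ x 1 ≠ x 2 ∧ x 0 ≠ x 2) (h0 _ _) (h0 _ _) (h0 _ _) (h0 _ _)
    (fun h x hx => ?_) (fun h x hx => ?_) (fun h x hx => ?_) (fun h x hx => ?_) a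
  · rcases hu _ _ _ _ _ _ _ hx with h' | h'
    · exact h'
    · have := h h'
      exact ⟨this.1.symm, this.2.2, this.2.1⟩
  · rcases hu _ _ _ _ _ _ _ hx with h' | h'
    · exact h'
    · have := h h'
      exact ⟨this.2.1.symm, this.1.symm, this.2.2.symm⟩
  · rcases hu _ _ _ _ _ _ _ hx with h' | h'
    · exact h'
    · have := h h'
      exact ⟨this.2.1.symm, this.1.symm, this.2.2.symm⟩
  · rcases hu _ _ _ _ _ _ _ hx with h' | h'
    · exact h'
    · have := h h'
      exact ⟨this.1.symm, this.2.2, this.2.1⟩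

lemma add_sq_le_two_mul (a b : ℝ≥0∞) : (a + b) ^ 2 ≤ 2 * (a ^ 2 + b ^ 2) := by
  have := ENNReal.rpow_add_le_mul_rpow_add_rpow a b (p := 2) (by norm_num)
  norm_num at this
  exact_mod_cast this

section Limit

variable {μ : ℝ → ℝ → ℝ}

lemma eventually_coeff_eq (hμ : ∀ ε : ℝ, 0 < ε → IsTransition ε (μ ε))
    (θ : ℝ) {r s : ℝ} (hrs : r ≠ s) :
    ∀ᶠ ε in 𝓝[>] (0 : ℝ), coeff (μ ε) θ |r - s| = coeff (fun _ => 1) θ |r - s| := by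
  have h1 : ∀ᶠ ε in 𝓝[>] (0 : ℝ), ε < |r - s| / 2 :=
    nhdsWithin_le_nhds (Iio_mem_nhds (half_pos (abs_pos.2 (sub_ne_zero.2 hrs))))
  filter_upwards [self_mem_nhdsWithin, h1] with ε hε h
  rw [coeff, coeff, (hμ ε hε).eq_one _ (by linarith)]

/-- At a fixed point either the reflected term vanishes or the relevant distance is positive; in the
latter case the coefficient has its limiting value as soon as 2ε is below that distance. -/
lemma eventually_source_eq (hμ : ∀ ε : ℝ, 0 < ε → IsTransition ε (μ ε))
    (θ₁ θ₂ : ℝ) (η : L2S1) (a : Spin) (x : Config) :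
    ∀ᶠ ε in 𝓝[>] (0 : ℝ), source (coeff (μ ε) θ₁) (coeff (μ ε) θ₂) η a x
      = source (coeff (fun _ => 1) θ₁) (coeff (fun _ => 1) θ₂) η a x := by
  have key : ∀ (θ : ℝ) (i j : Fin 3) (π : Equiv.Perm (Fin 3)) (f : Config → ℂ)
      (g : ℝ → Config → ℂ) (g' : Config → ℂ) (x : Config),
      (∀ᶠ ε in 𝓝[>] (0 : ℝ), g ε (sw π x) = g' (sw π x)) → (g' (sw π x) ≠ 0 → x i ≠ x j) →
      ∀ᶠ ε in 𝓝[>] (0 : ℝ), addReflected (coeff (μ ε) θ) i j π f (g ε) x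
        = addReflected (coeff (fun _ => 1) θ) i j π f g' x := by
    intro θ i j π f g g' x hg hne
    by_cases h0 : g' (sw π x) = 0
    · filter_upwards [hg] with ε hε
      exact addReflected_congr hε fun h => absurd h0 h
    · filter_upwards [hg, eventually_coeff_eq hμ θ (hne h0)] with ε hε hc
      exact addReflected_congr hε fun _ => hc
  revert x
  refine forall_spin (P := fun a => ∀ x, ∀ᶠ ε in 𝓝[>] (0 : ℝ),
    source (coeff (μ ε) θ₁) (coeff (μ ε) θ₂) η a x
      = source (coeff (fun _ => 1) θ₁) (coeff (fun _ => 1) θ₂) η a x)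
    (fun _ => Eventually.of_forall fun _ => rfl) (fun _ => Eventually.of_forall fun _ => rfl)
    (fun _ => Eventually.of_forall fun _ => rfl) (fun _ => Eventually.of_forall fun _ => rfl)
    (fun h x => ?_) (fun h x => ?_) (fun h x => ?_) (fun h x => ?_) a
  · exact key _ _ _ _ _ (fun ε => source (coeff (μ ε) θ₁) (coeff (μ ε) θ₂) η (1, 0, 1)) _ _ (h _)
      fun hn => (ne_of_source_ne_zero (coeff (fun _ => 1) θ₁) (coeff (fun _ => 1) θ₂) η
        (1, 0, 1) hn).2.2
  · exact key _ _ _ _ _ (fun ε => source (coeff (μ ε) θ₁) (coeff (μ ε) θ₂) η (0, 1, 1)) _ _ (h _)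
      fun hn => (ne_of_source_ne_zero (coeff (fun _ => 1) θ₁) (coeff (fun _ => 1) θ₂) η
        (0, 1, 1) hn).2.1.symm
  · exact key _ _ _ _ _ (fun ε => source (coeff (μ ε) θ₁) (coeff (μ ε) θ₂) η (0, 0, 1)) _ _ (h _)
      fun hn => (ne_of_source_ne_zero (coeff (fun _ => 1) θ₁) (coeff (fun _ => 1) θ₂) η
        (0, 0, 1) hn).1.symm
  · exact key _ _ _ _ _ (fun ε => source (coeff (μ ε) θ₁) (coeff (μ ε) θ₂) η (1, 0, 0)) _ _ (h _)
      fun hn => (ne_of_source_ne_zero (coeff (fun _ => 1) θ₁) (coeff (fun _ => 1) θ₂) η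
        (1, 0, 0) hn).2.1

lemma tendsto_lintegral_source_sub (hμ : ∀ ε : ℝ, 0 < ε → IsTransition ε (μ ε))
    (θ₁ θ₂ : ℝ) (η : L2S1) (a : Spin) :
    Tendsto (fun ε => ∫⁻ x, ‖source (coeff (μ ε) θ₁) (coeff (μ ε) θ₂) η a x
      - source (coeff (fun _ => 1) θ₁) (coeff (fun _ => 1) θ₂) η a x‖ₑ ^ 2) (𝓝[>] 0) (𝓝 0) := by
  have := tendsto_lintegral_filter_of_dominated_convergence (μ := (volume : Measure Config))
    (l := 𝓝[>] (0 : ℝ)) (f := fun _ => 0)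
    (F := fun ε x => ‖source (coeff (μ ε) θ₁) (coeff (μ ε) θ₂) η a x
      - source (coeff (fun _ => 1) θ₁) (coeff (fun _ => 1) θ₂) η a x‖ₑ ^ 2)
    -- An ε-independent majorant: both sources obey the same bound, and the factor 2 is from
    -- squaring a difference.
    (fun x => 2 * (sourceBound η a x + sourceBound η a x)) ?_ ?_ ?_ ?_
  · rwa [lintegral_zero] at this
  · filter_upwards [self_mem_nhdsWithin] with ε hε
    exact ((measurable_source ((hμ ε hε).isCoeff θ₁) ((hμ ε hε).isCoeff θ₂) η a).sub
      (measurable_source (isCoeff_coeff_one θ₁) (isCoeff_coeff_one θ₂) η a)).enorm.pow_const 2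
  · filter_upwards [self_mem_nhdsWithin] with ε hε
    refine Eventually.of_forall fun x => ?_
    refine (pow_le_pow_left' enorm_sub_le 2).trans ?_
    refine (add_sq_le_two_mul _ _).trans (mul_le_mul_right (add_le_add ?_ ?_) _)
    · exact source_enorm_sq_le ((hμ ε hε).isCoeff θ₁) ((hμ ε hε).isCoeff θ₂) η a x
    · exact source_enorm_sq_le (isCoeff_coeff_one θ₁) (isCoeff_coeff_one θ₂) η a x
  · have h := lintegral_sourceBound_ne_top η a
    rw [lintegral_const_mul' _ _ (by simp), lintegral_add_left (measurable_sourceBound η a)]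
    exact ENNReal.mul_ne_top (by simp) (ENNReal.add_ne_top.2 ⟨h, h⟩)
  · refine Eventually.of_forall fun x => tendsto_const_nhds.congr' ?_
    filter_upwards [eventually_source_eq hμ θ₁ θ₂ η a x] with ε hε
    rw [hε, sub_self, enorm_zero, zero_pow two_ne_zero]

lemma tendsto_isSolution (hμ : ∀ ε : ℝ, 0 < ε → IsTransition ε (μ ε))
    (θ₁ θ₂ : ℝ) {l : ℝ} (hl : 0 < l) {η Ψ₀ : L2S1} {Ψ : ℝ → L2S1}
    (h : ∀ ε, 0 < ε → IsSolution l (coeff (μ ε) θ₁) (coeff (μ ε) θ₂) η (Ψ ε))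
    (h₀ : IsSolution l (coeff (fun _ => 1) θ₁) (coeff (fun _ => 1) θ₂) η Ψ₀) :
    Tendsto Ψ (𝓝[>] 0) (𝓝 Ψ₀) := by
  have hsum : Tendsto (fun ε => ∑ a, ENNReal.ofReal (1 / l) * (ENNReal.ofReal (1 / l) *
      ∫⁻ x, ‖source (coeff (μ ε) θ₁) (coeff (μ ε) θ₂) η a x
        - source (coeff (fun _ => 1) θ₁) (coeff (fun _ => 1) θ₂) η a x‖ₑ ^ 2))
      (𝓝[>] 0) (𝓝 0) := by
    have : ∀ a, Tendsto (fun ε => ENNReal.ofReal (1 / l) * (ENNReal.ofReal (1 / l) *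
      ∫⁻ x, ‖source (coeff (μ ε) θ₁) (coeff (μ ε) θ₂) η a x
        - source (coeff (fun _ => 1) θ₁) (coeff (fun _ => 1) θ₂) η a x‖ₑ ^ 2))
      (𝓝[>] 0) (𝓝 0) := fun a => by
      have := ENNReal.Tendsto.const_mul (a := ENNReal.ofReal (1 / l))
        (ENNReal.Tendsto.const_mul (a := ENNReal.ofReal (1 / l))
          (tendsto_lintegral_source_sub hμ θ₁ θ₂ η a) (Or.inr ENNReal.ofReal_ne_top))
        (Or.inr ENNReal.ofReal_ne_top)
      rwa [mul_zero, mul_zero] at this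
    simpa using tendsto_finsetSum Finset.univ fun a _ => this a
  have hsq : Tendsto (fun ε => ‖Ψ ε - Ψ₀‖ₑ ^ 2) (𝓝[>] 0) (𝓝 0) := by
    refine tendsto_of_tendsto_of_tendsto_of_le_of_le' tendsto_const_nhds hsum
      (Eventually.of_forall fun _ => zero_le) ?_
    filter_upwards [self_mem_nhdsWithin] with ε hε
    exact (h ε hε).enorm_sq_sub_le hl ((hμ ε hε).isCoeff θ₁) ((hμ ε hε).isCoeff θ₂)
      (isCoeff_coeff_one θ₁) (isCoeff_coeff_one θ₂) h₀
  rw [tendsto_iff_edist_tendsto_0]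
  have := (ENNReal.continuous_rpow_const (y := (1 / 2 : ℝ))).continuousAt.tendsto.comp hsq
  rw [ENNReal.zero_rpow_of_pos (by norm_num)] at this
  refine this.congr fun ε => ?_
  rw [edist_eq_enorm_sub, Function.comp_apply, ← ENNReal.rpow_natCast, ← ENNReal.rpow_mul]
  norm_num

end Limit

/-! ### The resolvent equations for the family of boundary conditions -/

lemma exists_tendsto_resolvent {μ : ℝ → ℝ → ℝ} (hμ : ∀ ε : ℝ, 0 < ε → IsTransition ε (μ ε))
    (θ₁ θ₂ : ℝ) (η : L2S1) : ∃ Ψ : ℝ → L2S1, ∃ Ψ₀ : L2S1,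
      (∀ ε, 0 < ε → (Ψ ε, Ψ ε - η) ∈ evolGraph θ₁ θ₂ (μ ε)) ∧
      (Ψ₀, Ψ₀ - η) ∈ evolGraph θ₁ θ₂ (fun _ => 1) ∧ Tendsto Ψ (𝓝[>] 0) (𝓝 Ψ₀) := by
  obtain ⟨Ψ₀, h₀⟩ := exists_isSolution one_pos (isCoeff_coeff_one θ₁) (isCoeff_coeff_one θ₂) η
  have hex : ∀ ε : ℝ, ∃ Ψ, 0 < ε → IsSolution 1 (coeff (μ ε) θ₁) (coeff (μ ε) θ₂) η Ψ := by
    intro ε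
    by_cases hε : 0 < ε
    · obtain ⟨Ψ, h⟩ := exists_isSolution one_pos ((hμ ε hε).isCoeff θ₁) ((hμ ε hε).isCoeff θ₂) η
      exact ⟨Ψ, fun _ => h⟩
    · exact ⟨0, fun h => absurd h hε⟩
  choose Ψ hΨ using hex
  refine ⟨Ψ, Ψ₀, fun ε hε => ?_, ?_, tendsto_isSolution hμ θ₁ θ₂ one_pos hΨ h₀⟩
  · simpa using (hΨ ε hε).mem_evolGraph one_pos ((hμ ε hε).isCoeff θ₁) ((hμ ε hε).isCoeff θ₂)
  · simpa using h₀.mem_evolGraph one_pos (isCoeff_coeff_one θ₁) (isCoeff_coeff_one θ₂)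

lemma isContractive_evolGraph_one (θ₁ θ₂ : ℝ) : IsContractive (evolGraph θ₁ θ₂ fun _ => 1) :=
  isContractive_evolGraph (isCoeff_coeff_one θ₁) (isCoeff_coeff_one θ₂)

lemma isSelfAdjoint_tildeH {ħ : ℝ} (hħ : 0 < ħ) (m θ₁ θ₂ : ℝ) :
    IsSelfAdjoint (tildeH ħ m θ₁ θ₂) := by
  have hd : Dense ((tildeH ħ m θ₁ θ₂).domain : Set L2S1) :=
    (freeH_dense ħ m).mono (freeH_le_boundaryH ħ m θ₁ θ₂ fun _ => 1).1
  have hc : -(Complex.I / (ħ : ℂ)) ≠ 0 :=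
    neg_ne_zero.2 (div_ne_zero Complex.I_ne_zero (Complex.ofReal_ne_zero.2 hħ.ne'))
  exact isSelfAdjoint_of_skew (isContractive_evolGraph_one θ₁ θ₂)
    (isContractive_negGraph (isContractive_evolGraph_one (-θ₁) (-θ₂))) (massOp_inner ħ m) hd hc
    (conj_neg_I_div ħ) (mem_graph_iff_evolGraph hħ m θ₁ θ₂ fun _ => 1)

end ElPhEl

end

/-! ### Assembly: maximal dissipativity, self-adjointness and the extended limit -/

theorem mainTheorem5 (ħ m θ₁ θ₂ : ℝ) (hħ : 0 < ħ) (hm : 0 ≤ m)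
    (μ : ℝ → ℝ → ℝ) (hμ : ∀ ε : ℝ, 0 < ε → ElPhEl.IsTransition ε (μ ε)) :
    (∀ ε : ℝ, 0 < ε →
      (-(Complex.I / ħ)) • ElPhEl.freeH ħ m
          ≤ (-(Complex.I / ħ)) • ElPhEl.boundaryH ħ m θ₁ θ₂ (μ ε) ∧
      ElPhEl.IsMaximallyDissipative
        ((-(Complex.I / ħ)) • ElPhEl.boundaryH ħ m θ₁ θ₂ (μ ε))) ∧
    (ElPhEl.freeH ħ m ≤ ElPhEl.tildeH ħ m θ₁ θ₂ ∧ IsSelfAdjoint (ElPhEl.tildeH ħ m θ₁ θ₂)) ∧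
    ElPhEl.extendedLimitGraph
        (fun ε : ℝ => (-(Complex.I / ħ)) • ElPhEl.boundaryH ħ m θ₁ θ₂ (μ ε))
      = (((-(Complex.I / ħ)) • ElPhEl.tildeH ħ m θ₁ θ₂).graph :
          Set (ElPhEl.L2S1 × ElPhEl.L2S1)) := by
  have hG : ∀ ε : ℝ, 0 < ε → ElPhEl.IsContractive (ElPhEl.evolGraph θ₁ θ₂ (μ ε)) := fun ε hε =>
    ElPhEl.isContractive_evolGraph ((hμ ε hε).isCoeff θ₁) ((hμ ε hε).isCoeff θ₂)
  refine ⟨fun ε hε => ⟨ElPhEl.smul_le_smul_pmap _ (ElPhEl.freeH_le_boundaryH ħ m θ₁ θ₂ (μ ε)),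
      (hG ε hε).isMaximallyDissipative (ElPhEl.massOp_re_inner ħ m)
        (ElPhEl.mem_graph_iff_evolGraph hħ m θ₁ θ₂ (μ ε))⟩,
    ⟨ElPhEl.freeH_le_boundaryH ħ m θ₁ θ₂ _, ElPhEl.isSelfAdjoint_tildeH hħ m θ₁ θ₂⟩, ?_⟩
  exact ElPhEl.extendedLimitGraph_eq hG (ElPhEl.exists_tendsto_resolvent hμ θ₁ θ₂)
    (ElPhEl.isContractive_evolGraph_one θ₁ θ₂)
    (fun ε _ => ElPhEl.mem_graph_iff_evolGraph hħ m θ₁ θ₂ (μ ε))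
    (ElPhEl.mem_graph_iff_evolGraph hħ m θ₁ θ₂ fun _ => 1)
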